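/- Let $\kappa\in\mathbb R\setminus\{0\}$ and $\eta=\mathrm{diag}(-1,1,1,1,1)$. Indices $a,b,\dots$ run over $0,\dots,4$, indices $\mu,\nu$ over $0,\dots,3$, indices $j,k$ over $1,2,3$; repeated indices are summed. **Setting.** For functions on $\mathbb R^4\ni(t,x)=(x^0,\vec x)$ put $$(f\star g)(t,x)=\tfrac1{2\pi}\int dv\int du\,f(t+u,x)\,g(t,e^{v/\kappa}x)\,e^{-iuv},\qquad f^\dagger(t,x)=\tfrac1{2\pi}\int dv\int du\,\overline{f(t+u,e^{v/\kappa}x)}\,e^{-iuv},$$ oscillatory integrals being limits for $\varepsilon\to0^+$ of the integrals with the factor $e^{-\varepsilon u^2}$. Let $\mathcal S$ be the set of functions whose partial Fourier transform in $x^0$ is a Schwartz function with compact support in the frequency variable, and let $\mathcal A$ be the set of sums of a polynomial in the coordinates $x^\mu$ and an element of $\mathcal S$. The integral $\int f\,\mathbf{vol}^5$ is the Lebesgue integral of $f$ over $\mathbb R^4$. Let $P_j\triangleright f=-i\,\partial_jf$ and $e^{cP_0}\triangleright f=\tfrac1{2\pi}\int dv\int du\,f(t+u,x)e^{-cv}e^{-iuv}$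 (that is, $P_0=i\,\partial_0$). Forms are $\omega=\sum_I\omega_I e^I$, where $e^I=e^{i_1}\wedge\dots\wedge e^{i_n}$ for $I=\{i_1<\dots<i_n\}\subseteq\{0,\dots,4\}$; $\Gamma^n$ is the set of those with $\omega_I\in\mathcal A$ and $|I|=n$, $\Gamma^n_{\mathcal S}$ the set of those with $\omega_I\in\mathcal S$ and $|I|=n$, and $\Gamma^\wedge=\bigoplus_{n=0}^{5}\Gamma^n$. The product is determined by $\star$, by $e^a\wedge e^b=-e^b\wedge e^a$ and by $e^af=(\lambda^a{}_b\triangleright f)e^b$, where $$\lambda=\begin{pmatrix}\cosh\frac{P_0}\kappa+\frac{e^{P_0/\kappa}|\vec P|^2}{2\kappa^2}&\frac1\kappa\vec P&-\sinh\frac{P_0}\kappa-\frac{e^{P_0/\kappa}|\vec P|^2}{2\kappa^2}\\ \frac1\kappa e^{P_0/\kappa}\vec P&I&-\frac1\kappa e^{P_0/\kappa}\vec P\\-\sinh\frac{P_0}\kappa+\frac{e^{P_0/\kappa}|\vec P|^2}{2\kappa^2}&\frac1\kappa\vec P&\cosh\frac{P_0}\kappa-\frac{e^{P_0/\kappa}|\vec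 P|^2}{2\kappa^2}\end{pmatrix};$$ the involution on forms is $\big(\sum_I\omega_Ie^I\big)^\dagger=\sum_I(-1)^{|I|(|I|-1)/2}e^I\,\omega_I^\dagger$, and $\mathbf{vol}^5=e^0\wedge e^1\wedge e^2\wedge e^3\wedge e^4$. **Definition.** A *Hodge star* is a map $*:\Gamma^\wedge\to\Gamma^\wedge$ which * maps $\Gamma^n$ to $\Gamma^{5-n}$ and $\Gamma^n_{\mathcal S}$ to $\Gamma^{5-n}_{\mathcal S}$, with $*\circ*=(-1)^{n(5-n)}\,\mathrm{id}$ on $\Gamma^n$, for $0\le n\le5$; * is left and right $\mathcal A$-linear: it is additive, $*(f\omega)=f\,{*\omega}$ and $*(\omega f)=(*\omega)f$ for $f\in\mathcal A$; * for $0\le n\le 5$ is such that $(\omega,\rho)=\int\omega^\dagger\wedge*\rho$ is, on $\Gamma^n_{\mathcal S}$, given by a convergent integral, sesquilinear (conjugate-linear in $\omega$), Hermitian, $\overline{(\omega,\rho)}=(\rho,\omega)$, and nondegenerate: $(\omega,\cdot)=0\Leftrightarrow\omega=0$. **Proposition.** 1. The above realises the $\kappa$-Minkowski relations and the differential calculus: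 $[x^j,x^0]=\frac i\kappa x^j$, $[x^j,x^k]=0$, $(x^\mu)^\dagger=x^\mu$, $[x^\mu,e^\nu]=\frac i\kappa(\eta^{\mu\nu}e^0-\eta^{0\nu}e^\mu-\eta^{\mu\nu}e^4)$ and $[x^\mu,e^4]=\frac i\kappa e^\mu$. 2. There is a Hodge star satisfying $$*(1)=\mathbf{vol}^5,\qquad *(e^a)=\tfrac1{4!}\eta^{ab}\epsilon_{bcdef}\,e^c\wedge e^d\wedge e^e\wedge e^f,\qquad *(e^a\wedge e^b)=\tfrac1{3!}\eta^{ac}\eta^{bd}\epsilon_{cdefg}\,e^e\wedge e^f\wedge e^g,$$ where $\epsilon$ is the Levi-Civita symbol with $\epsilon_{01234}=1$. It is the only Hodge star satisfying these rules, and it is compatible with the bimodule relations: $$[x^\mu,*(e^\nu)]=\tfrac i\kappa\big(\eta^{\mu\nu}{*(e^0)}-\eta^{0\nu}{*(e^\mu)}-\eta^{\mu\nu}{*(e^4)}\big),\qquad[x^\mu,*(e^4)]=\tfrac i\kappa\,{*(e^\mu)}.$$ 3. For $f\in\mathcal S$: $\int f^\dagger\star f=0$ if and only if $f=0$. -/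

import Mathlib

open scoped BigOperators Topology

noncomputable section

namespace KappaMinkowski

/-! ### Functions on spacetime and oscillatory integrals -/

/-- Points `(x⁰, (x¹, x², x³))` of `ℝ⁴`. -/
abbrev Pt : Type := ℝ × (Fin 3 → ℝ)

/-- Complex functions on `ℝ⁴`. -/
abbrev Fn : Type := Pt → ℂ

/-- The oscillatory integral `(2π)⁻¹ ∫ dv ∫ du Φ(u,v) e^{-iuv}`, understood as the limit `ε → 0⁺` of
the integrals with the regularising factor `e^{-ε u²}`. -/
def osc (Φ : ℝ → ℝ → ℂ) : ℂ :=
  Filter.limUnder (𝓝[>] (0 : ℝ)) fun ε : ℝ =>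
    (1 / (2 * (Real.pi : ℂ))) *
      ∫ v : ℝ, ∫ u : ℝ,
        Complex.exp (-((ε * u ^ 2 : ℝ) : ℂ)) * Φ u v * Complex.exp (-(Complex.I * ((u * v : ℝ) : ℂ)))

/-- The star product
`(f ⋆ g)(t,x) = (2π)⁻¹ ∫ dv ∫ du f(t+u, x) g(t, e^{v/κ} x) e^{-iuv}`. -/
def starProd (κ : ℝ) (f g : Fn) : Fn := fun p =>
  osc fun u v => f (p.1 + u, p.2) * g (p.1, Real.exp (v / κ) • p.2)

/-- The involution `f†(t,x) = (2π)⁻¹ ∫ dv ∫ du (conj f)(t+u, e^{v/κ} x) e^{-iuv}`. -/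
def dagFn (κ : ℝ) (f : Fn) : Fn := fun p =>
  osc fun u v => (starRingEnd ℂ) (f (p.1 + u, Real.exp (v / κ) • p.2))

/-- The coordinate functions `x^μ`, `μ = 0,…,3`. -/
def coord (μ : Fin 4) : Fn := fun p =>
  (Fin.cons (p.1 : ℂ) (fun j : Fin 3 => ((p.2 j : ℝ) : ℂ)) : Fin 4 → ℂ) μ

/-- The integrable functions of the star-product realisation: those whose partial Fourier transform
in `x⁰` is a Schwartz function with compact support in the frequency `v`. -/
def schwartzC : Set Fn :=
  {f | ∃ F : SchwartzMap Pt ℂ,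
      (∃ R : ℝ, ∀ (v : ℝ) (x : Fin 3 → ℝ), R < |v| → F (v, x) = 0) ∧
      ∀ (t : ℝ) (x : Fin 3 → ℝ),
        f (t, x) = ∫ v : ℝ, F (v, x) * Complex.exp (Complex.I * ((t * v : ℝ) : ℂ))}

/-- The algebra `𝒜` of functions on `κ`-Minkowski space: polynomials in the coordinates plus
elements of `schwartzC`. -/
def algA : Set Fn :=
  {f | ∃ q : MvPolynomial (Fin 4) ℂ, ∃ s ∈ schwartzC,
      ∀ p : Pt, f p = MvPolynomial.eval (fun μ => coord μ p) q + s p}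

/-! ### The action of translations -/

/-- `P_j ▷ f = -i ∂f/∂x^j`. -/
def momP (j : Fin 3) (f : Fn) : Fn := fun p =>
  -Complex.I * lineDeriv ℝ f p (0, Pi.single j 1)

/-- `e^{c P₀} ▷ f`, where `P₀ = i ∂/∂x⁰`: multiplication by `e^{-cv}` of the component of frequency
`v`, so that `e^{c P₀} ▷ e^{i v x⁰} = e^{-c v} e^{i v x⁰}`. -/
def expP0 (c : ℝ) (f : Fn) : Fn := fun p =>
  osc fun u v => f (p.1 + u, p.2) * ((Real.exp (-(c * v)) : ℝ) : ℂ)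

/-- `cosh (P₀/κ)`. -/
def coshP0 (κ : ℝ) (f : Fn) : Fn := (1 / 2 : ℂ) • (expP0 (1 / κ) f + expP0 (-(1 / κ)) f)

/-- `sinh (P₀/κ)`. -/
def sinhP0 (κ : ℝ) (f : Fn) : Fn := (1 / 2 : ℂ) • (expP0 (1 / κ) f - expP0 (-(1 / κ)) f)

/-- `(2κ²)⁻¹ e^{P₀/κ} |P|²`. -/
def halfPsq (κ : ℝ) (f : Fn) : Fn :=
  (1 / (2 * (κ : ℂ) ^ 2)) • expP0 (1 / κ) (∑ j : Fin 3, momP j (momP j f))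

/-- `κ⁻¹ P_j`. -/
def scaledP (κ : ℝ) (j : Fin 3) (f : Fn) : Fn := (1 / (κ : ℂ)) • momP j f

/-- `κ⁻¹ e^{P₀/κ} P_j`. -/
def twistP (κ : ℝ) (j : Fin 3) (f : Fn) : Fn := (1 / (κ : ℂ)) • expP0 (1 / κ) (momP j f)

/-- The matrix `λ^a_b` of translation operators with `e^a f = (λ^a_b ▷ f) e^b`. -/
def lam (κ : ℝ) : Matrix (Fin 5) (Fin 5) (Fn → Fn) :=
  !![coshP0 κ + halfPsq κ, scaledP κ 0, scaledP κ 1, scaledP κ 2, -sinhP0 κ - halfPsq κ;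
     twistP κ 0, id, 0, 0, -twistP κ 0;
     twistP κ 1, 0, id, 0, -twistP κ 1;
     twistP κ 2, 0, 0, id, -twistP κ 2;
     -sinhP0 κ + halfPsq κ, scaledP κ 0, scaledP κ 1, scaledP κ 2, coshP0 κ - halfPsq κ]

/-! ### Differential forms -/

/-- Differential forms `ω = ∑_I ω_I e^I`, with coefficients on the left, where
`e^I = e^{i₁} ∧ ⋯ ∧ e^{iₙ}` for `I = {i₁ < ⋯ < iₙ} ⊆ {0,…,4}`. -/
abbrev Form : Type := Finset (Fin 5) → Fn

/-- `Γⁿ` with coefficients in a set `C` of functions. -/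
def Gam (C : Set Fn) (n : ℕ) : Set Form :=
  {ω | (∀ I, ω I ∈ C) ∧ ∀ I, I.card ≠ n → ω I = 0}

/-- The exterior algebra `Γ^∧ = Γ⁰ ⊕ ⋯ ⊕ Γ⁵` over `𝒜`. -/
def GamTotal : Set Form := {ω | ∀ I, ω I ∈ algA}

/-- A function as a `0`-form. -/
def zeroForm (f : Fn) : Form := Pi.single ∅ f

/-- `e^I`. -/
def basisForm (I : Finset (Fin 5)) : Form := Pi.single I 1

/-- `e^a`. -/
def e (a : Fin 5) : Form := basisForm {a}

/-- `f ω`. -/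
def lmul (κ : ℝ) (f : Fn) (ω : Form) : Form := fun I => starProd κ f (ω I)

/-- `e^a ∧ ω`: since `e^a ω_J e^J = ∑_b (λ^a_b ▷ ω_J) e^b ∧ e^J` and
`e^b ∧ e^J = (-1)^{#{j ∈ J, j < b}} e^{J ∪ {b}}` for `b ∉ J` (and `0` for `b ∈ J`). -/
def oneFormMul (κ : ℝ) (a : Fin 5) (ω : Form) : Form := fun K =>
  ∑ b ∈ K, ((-1 : ℂ) ^ ((K.erase b).filter (· < b)).card) • lam κ a b (ω (K.erase b))

/-- `ω ∧ ρ = ∑_I ω_I (e^{i₁} ∧ (⋯ ∧ (e^{iₙ} ∧ ρ)))`, `I = {i₁ < ⋯ < iₙ}`. -/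
def wedge (κ : ℝ) (ω ρ : Form) : Form :=
  ∑ I : Finset (Fin 5), lmul κ (ω I) ((I.sort (· ≤ ·)).foldr (oneFormMul κ) ρ)

/-- `ω f`. -/
def rmul (κ : ℝ) (ω : Form) (f : Fn) : Form := wedge κ ω (zeroForm f)

/-- `ω† = ∑_I (e^I)† ω_I†`, with `(e^I)† = (-1)^{n(n-1)/2} e^I` for `#I = n`. -/
def dag (κ : ℝ) (ω : Form) : Form :=
  ∑ I : Finset (Fin 5),
    ((-1 : ℂ) ^ (I.card * (I.card - 1) / 2)) • rmul κ (basisForm I) (dagFn κ (ω I))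

/-- `vol⁵ = e⁰ ∧ e¹ ∧ e² ∧ e³ ∧ e⁴`. -/
def vol5 (κ : ℝ) : Form :=
  wedge κ (e 0) (wedge κ (e 1) (wedge κ (e 2) (wedge κ (e 3) (e 4))))

/-- The integral of a `5`-form `f vol⁵`: the Lebesgue integral of `f` over `ℝ⁴`. -/
def integral5 (ω : Form) : ℂ := ∫ p : Pt, ω Finset.univ p

/-! ### The Hodge star -/

/-- `η^{ab} = diag(-1,1,1,1,1)`. -/
def eta (a b : Fin 5) : ℂ := if a = b then (if a = 0 then -1 else 1) else 0

/-- The Levi-Civita symbol `ε_{i₀i₁i₂i₃i₄}`, `ε_{01234} = 1`, as the determinant of the matrix whose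
`r`-th row is the `i_r`-th unit vector. -/
def eps (i : Fin 5 → Fin 5) : ℂ :=
  Matrix.det (Matrix.of fun r c : Fin 5 => if i r = c then (1 : ℂ) else 0)

/-- `(ω, ρ) = ∫ ω† ∧ *ρ` for a given candidate `S` of `*`. -/
def pairing (κ : ℝ) (S : Form → Form) (ω ρ : Form) : ℂ :=
  integral5 (wedge κ (dag κ ω) (S ρ))

/-- Hodge-`*` maps on the exterior algebra over `𝒜`. The pairing is considered on the forms with
coefficients in `schwartzC`, on which the integral converges. -/
structure IsHodgeStar (κ : ℝ) (S : Form → Form) : Prop where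
  degree : ∀ n ≤ 5, ∀ ω ∈ Gam algA n, S ω ∈ Gam algA (5 - n)
  degree_schwartz : ∀ n ≤ 5, ∀ ω ∈ Gam schwartzC n, S ω ∈ Gam schwartzC (5 - n)
  involutive : ∀ n ≤ 5, ∀ ω ∈ Gam algA n, S (S ω) = ((-1 : ℂ) ^ (n * (5 - n))) • ω
  map_add : ∀ ω ∈ GamTotal, ∀ ρ ∈ GamTotal, S (ω + ρ) = S ω + S ρ
  map_lmul : ∀ f ∈ algA, ∀ ω ∈ GamTotal, S (lmul κ f ω) = lmul κ f (S ω)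
  map_rmul : ∀ f ∈ algA, ∀ ω ∈ GamTotal, S (rmul κ ω f) = rmul κ (S ω) f
  integrable : ∀ n ≤ 5, ∀ ω ∈ Gam schwartzC n, ∀ ρ ∈ Gam schwartzC n,
    MeasureTheory.Integrable (wedge κ (dag κ ω) (S ρ) Finset.univ)
  sesq_left : ∀ n ≤ 5, ∀ (c : ℂ), ∀ ω ∈ Gam schwartzC n, ∀ ω' ∈ Gam schwartzC n,
    ∀ ρ ∈ Gam schwartzC n,
      pairing κ S (c • ω + ω') ρ = (starRingEnd ℂ) c * pairing κ S ω ρ + pairing κ S ω' ρ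
  sesq_right : ∀ n ≤ 5, ∀ (c : ℂ), ∀ ω ∈ Gam schwartzC n, ∀ ρ ∈ Gam schwartzC n,
    ∀ ρ' ∈ Gam schwartzC n,
      pairing κ S ω (c • ρ + ρ') = c * pairing κ S ω ρ + pairing κ S ω ρ'
  hermitian : ∀ n ≤ 5, ∀ ω ∈ Gam schwartzC n, ∀ ρ ∈ Gam schwartzC n,
    (starRingEnd ℂ) (pairing κ S ω ρ) = pairing κ S ρ ω
  nondegenerate : ∀ n ≤ 5, ∀ ω ∈ Gam schwartzC n,
    ((∀ ρ ∈ Gam schwartzC n, pairing κ S ω ρ = 0) ↔ ω = 0)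

/-- The rules for `*(1)`, `*(e^a)` and `*(e^a ∧ e^b)`. -/
structure HodgeRules (κ : ℝ) (S : Form → Form) : Prop where
  rule_zero : S (zeroForm 1) = vol5 κ
  rule_one : ∀ a : Fin 5, S (e a) =
    ((1 : ℂ) / (Nat.factorial 4 : ℂ)) •
      ∑ b : Fin 5, ∑ c : Fin 5, ∑ d : Fin 5, ∑ r : Fin 5, ∑ s : Fin 5,
        (eta a b * eps ![b, c, d, r, s]) •
          wedge κ (e c) (wedge κ (e d) (wedge κ (e r) (e s)))
  rule_two : ∀ a b : Fin 5, S (wedge κ (e a) (e b)) =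
    ((1 : ℂ) / (Nat.factorial 3 : ℂ)) •
      ∑ c : Fin 5, ∑ d : Fin 5, ∑ r : Fin 5, ∑ s : Fin 5, ∑ t : Fin 5,
        (eta a c * eta b d * eps ![c, d, r, s, t]) •
          wedge κ (e r) (wedge κ (e s) (e t))

end KappaMinkowski

end

/-!
Everything is computed on partial Fourier transforms in `x⁰`. An element of `algA` is represented by
a pair of a polynomial and a Schwartz function of compact support in the frequency (`Rep`,
`evalRep`). The defining oscillatory integrals are evaluated separately on the two parts: for a
polynomial in `u`, integration by parts moves the powers of `u` to derivatives in `v`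
(`HasOsc.polynomial_mul`), and for a band-limited amplitude the Gaussian regularisation is an
approximate identity (`HasOsc.bandLimited`). Since `osc` is only a limit, additivity needs
convergence, which `HasOsc` records.

The operators `e^{cP₀}` and `P_j` generate a commutative ring `OpRing` acting on representatives, and
`λ` becomes a matrix `lamR` over it. Over any commutative ring this matrix is a Lorentz
transformation of determinant one (`lorentz_orthogonal`, `lorentz_det`). The relation
`e^a f = (λ^a_b ▷ f) e^b` gives `e^I f = ∑_K (minor_{IK} ▷ f) e^K`, where `minor_{IK}` is the minor of
`λ` with rows `I` and columns `K`. The Hodge star is the left linear map with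
`*e^I = ± e^{Iᶜ}`, the signs being `starSign`. Its right linearity is the identity between
complementary minors of a Lorentz matrix (`minor_compl`, `starSign_minor`), proved by letting the
matrix act on the exterior algebra and intertwine contractions.

For the pairing, `∫ f ⋆ g` is a multiple of the bilinear form `beta` on partial Fourier transforms
(`integral_starProd`). Integration by parts shows that the entries of `λ` have as adjoints with
respect to `beta` the entries of `η λᵀ η = λ⁻¹` (`adj_lamR`), so by the Cauchy–Binet formula the minors
of `λ` form an isometry (`sum_betaR_minor`), and the pairing is diagonal in the basis `e^I`
(`pairing_bandForm`). Each diagonal entry is, up to a nonzero real factor, an `L²` inner product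
(`herm_eq`). This gives hermiticity and nondegeneracy, and the statement about `∫ f† ⋆ f`.

A Hodge star is left linear, hence determined by its values on the `e^I`. The rules give those of
degree at most two, and `* ∘ * = 1` the others (`IsHodgeStar.eq_hodge`).
-/

open scoped BigOperators Topology
noncomputable section
namespace KappaMinkowski

/-! ### Exterior algebra in coordinates -/

section Exterior

variable {ι : Type*} [LinearOrder ι] {R : Type*} [CommRing R]
  {M : Type*} [AddCommGroup M] [Module R M]

/-- The sign in `e^b ∧ e^K = sg b K • e^{K ∪ {b}}`, for `b ∉ K`. -/
def sg (b : ι) (K : Finset ι) : ℤ := (-1) ^ (K.filter (· < b)).card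

lemma sg_mul_self (b : ι) (K : Finset ι) : sg b K * sg b K = 1 := by
  rw [sg, ← mul_pow]; simp

lemma sg_erase_of_lt {b c : ι} (K : Finset ι) (h : b < c) : sg b (K.erase c) = sg b K := by
  unfold sg
  congr 2
  ext x
  simp only [Finset.mem_filter, Finset.mem_erase]
  constructor
  · rintro ⟨⟨-, h1⟩, h2⟩; exact ⟨h1, h2⟩
  · rintro ⟨h1, h2⟩; exact ⟨⟨(h2.trans h).ne, h1⟩, h2⟩

lemma sg_eq_neg_erase {b c : ι} {K : Finset ι} (hc : c ∈ K) (h : c < b) :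
    sg b K = -sg b (K.erase c) := by
  unfold sg
  have : K.filter (· < b) = insert c ((K.erase c).filter (· < b)) := by
    ext x
    simp only [Finset.mem_filter, Finset.mem_erase, Finset.mem_insert]
    by_cases hx : x = c
    · subst hx; simp [hc, h]
    · simp [hx]
  rw [this, Finset.card_insert_of_notMem (by simp), pow_succ]; ring

/-- Interchanging two distinct basis one-forms changes the sign. -/
lemma sg_swap {b c : ι} {K : Finset ι} (hb : b ∈ K) (hc : c ∈ K) (hbc : b ≠ c) :
    sg b (K.erase b) * sg c ((K.erase b).erase c)
      = -(sg c (K.erase c) * sg b ((K.erase c).erase b)) := by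
  have key : ∀ {b c : ι}, b ∈ K → c ∈ K → b < c →
      sg b (K.erase b) * sg c ((K.erase b).erase c)
        = -(sg c (K.erase c) * sg b ((K.erase c).erase b)) := by
    intro b c hb hc h
    rw [sg_eq_neg_erase (Finset.mem_erase.2 ⟨h.ne, hb⟩) h,
      Finset.erase_right_comm (a := b) (b := c), ← sg_erase_of_lt (K.erase b) h,
      Finset.erase_right_comm (a := b) (b := c)]
    ring
  rcases lt_or_gt_of_ne hbc with h | h
  · exact key hb hc h
  · rw [key hc hb h]; ring

/-- Left exterior multiplication by the one-form `∑ v_b e^b` on the exterior algebra with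
coefficients in `M`, an element being the family of its coefficients with respect to the `e^K`. -/
def ext (v : ι → R) (ω : Finset ι → M) : Finset ι → M := fun K =>
  ∑ b ∈ K, sg b (K.erase b) • v b • ω (K.erase b)

lemma ext_add (v : ι → R) (ω ρ : Finset ι → M) : ext v (ω + ρ) = ext v ω + ext v ρ := by
  funext K; simp [ext, Finset.sum_add_distrib]

lemma ext_zero (v : ι → R) : ext v (0 : Finset ι → M) = 0 := by
  funext K; simp [ext]

lemma ext_smul {S : Type*} [Semiring S] [Module S M] [SMulCommClass R S M]
    (v : ι → R) (r : S) (ω : Finset ι → M) :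
    ext v (r • ω) = r • ext v ω := by
  funext K
  simp only [ext, Pi.smul_apply, Finset.smul_sum]
  refine Finset.sum_congr rfl fun b _ => ?_
  rw [smul_comm (v b) r, smul_comm _ r]

lemma ext_neg (v : ι → R) (ω : Finset ι → M) : ext v (-ω) = -ext v ω := by
  funext K; simp [ext]

lemma ext_sum {α : Type*} (s : Finset α) (v : ι → R) (ω : α → Finset ι → M) :
    ext v (∑ i ∈ s, ω i) = ∑ i ∈ s, ext v (ω i) := by
  classical
  induction s using Finset.induction_on with
  | empty => simp [ext_zero]
  | insert a s ha ih => rw [Finset.sum_insert ha, Finset.sum_insert ha, ext_add, ih]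

lemma ext_vec_add (v w : ι → R) (ω : Finset ι → M) : ext (v + w) ω = ext v ω + ext w ω := by
  funext K; simp [ext, Finset.sum_add_distrib, add_smul]

lemma ext_vec_smul (r : R) (v : ι → R) (ω : Finset ι → M) : ext (r • v) ω = r • ext v ω := by
  funext K
  simp only [ext, Pi.smul_apply, Finset.smul_sum]
  refine Finset.sum_congr rfl fun b _ => ?_
  rw [smul_eq_mul, mul_smul, smul_comm _ r]

lemma ext_vec_zero (ω : Finset ι → M) : ext (0 : ι → R) ω = 0 := by
  funext K; simp [ext]

lemma ext_vec_sum {α : Type*} (s : Finset α) (v : α → ι → R) (ω : Finset ι → M) :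
    ext (∑ i ∈ s, v i) ω = ∑ i ∈ s, ext (v i) ω := by
  classical
  induction s using Finset.induction_on with
  | empty => simp [ext_vec_zero]
  | insert a s ha ih => rw [Finset.sum_insert ha, Finset.sum_insert ha, ext_vec_add, ih]

lemma ext_ext_apply (v w : ι → R) (ω : Finset ι → M) (K : Finset ι) :
    ext v (ext w ω) K = ∑ b ∈ K, ∑ c ∈ K, if b = c then 0 else
      (sg b (K.erase b) * sg c ((K.erase b).erase c)) •
        (v b * w c) • ω ((K.erase b).erase c) := by
  simp only [ext]
  refine Finset.sum_congr rfl fun b hb => ?_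
  rw [← Finset.add_sum_erase K _ hb, if_pos rfl, zero_add, Finset.smul_sum, Finset.smul_sum]
  refine Finset.sum_congr rfl fun c hc => ?_
  rw [if_neg (Finset.ne_of_mem_erase hc).symm, smul_comm (v b), smul_smul, smul_smul]

/-- One-forms with commuting coefficients anticommute. -/
lemma ext_ext_comm (v w : ι → R) (ω : Finset ι → M) :
    ext v (ext w ω) = -ext w (ext v ω) := by
  funext K
  rw [Pi.neg_apply, ext_ext_apply, ext_ext_apply, ← Finset.sum_neg_distrib, Finset.sum_comm]
  refine Finset.sum_congr rfl fun c hc => ?_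
  rw [← Finset.sum_neg_distrib]
  refine Finset.sum_congr rfl fun b hb => ?_
  by_cases h : b = c
  · simp [h]
  · rw [if_neg h, if_neg (Ne.symm h), sg_swap hb hc h, Finset.erase_right_comm, neg_smul,
      mul_comm (v b)]

lemma ext_ext_self (v : ι → R) (ω : Finset ι → M) : ext v (ext v ω) = 0 := by
  funext K
  rw [ext_ext_apply]
  have h : ∀ (f : ι → ι → M), (∀ b ∈ K, f b b = 0) → (∀ b ∈ K, ∀ c ∈ K, b < c → f b c = - f c b) →
      ∑ b ∈ K, ∑ c ∈ K, f b c = 0 := by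
    intro f h0 h1
    rw [← Finset.sum_product']
    refine Finset.sum_involution (fun p _ => (p.2, p.1)) ?_ ?_ ?_ ?_
    · rintro ⟨b, c⟩ hp
      obtain ⟨hb, hc⟩ := Finset.mem_product.1 hp
      rcases lt_trichotomy b c with hl | rfl | hl
      · simp [h1 b hb c hc hl]
      · simp [h0 b hb]
      · simp [h1 c hc b hb hl]
    · rintro ⟨b, c⟩ hp hne heq
      simp only [Prod.mk.injEq] at heq
      rw [heq.2] at hne
      exact hne (h0 _ (Finset.mem_product.1 hp).2)
    · rintro ⟨b, c⟩ hp
      simpa [and_comm] using hp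
    · simp
  refine h _ (fun b _ => if_pos rfl) fun b hb c hc hbc => ?_
  rw [if_neg hbc.ne, if_neg hbc.ne', sg_swap hb hc hbc.ne, Finset.erase_right_comm, neg_smul,
      mul_comm (v b)]

lemma ext_map {N : Type*} [AddCommGroup N] [Module R N] (φ : M →ₗ[R] N) (v : ι → R)
    (ω : Finset ι → M) : ext v (fun K => φ (ω K)) = fun K => φ (ext v ω K) := by
  funext K; simp [ext, map_sum, map_zsmul]

/-- The basis one-form `e^b` times `e^K`. -/
lemma ext_single_single (b : ι) {K : Finset ι} (hb : b ∉ K) (x : M) :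
    ext (Pi.single b (1 : R)) (Pi.single K x) = sg b K • Pi.single (insert b K) x := by
  funext L
  rw [ext, Pi.smul_apply]
  by_cases hbL : b ∈ L
  · rw [Finset.sum_eq_single b (fun c _ hc => by simp [hc]) (fun h => (h hbL).elim)]
    by_cases hL : L = insert b K
    · subst hL; simp [Finset.erase_insert hb]
    · have : L.erase b ≠ K := fun h => hL (by rw [← h, Finset.insert_erase hbL])
      simp [hL, this]
  · have : L ≠ insert b K := fun h => hbL (by simp [h])
    rw [Pi.single_eq_of_ne this, smul_zero]
    refine Finset.sum_eq_zero fun c hc => ?_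
    have : c ≠ b := fun h => hbL (h ▸ hc)
    simp [this]

lemma ext_single_single_mem (b : ι) {K : Finset ι} (hb : b ∈ K) (x : M) :
    ext (Pi.single b (1 : R)) (Pi.single K x) = 0 := by
  funext L
  rw [ext, Pi.zero_apply]
  refine Finset.sum_eq_zero fun c hc => ?_
  by_cases hcb : c = b
  · subst hcb
    have : L.erase c ≠ K := fun h => by simp [← h] at hb
    simp [this]
  · simp [hcb]

/-- The product `m_{i₁} ∧ (⋯ ∧ (m_{iₙ} ∧ ω))`, `I = {i₁ < ⋯ < iₙ}`, of rows of a matrix `m`,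
considered as one-forms. -/
def extProd (m : ι → ι → R) (I : Finset ι) (ω : Finset ι → M) : Finset ι → M :=
  (I.sort (· ≤ ·)).foldr (fun a => ext (m a)) ω

lemma extProd_empty (m : ι → ι → R) (ω : Finset ι → M) : extProd m ∅ ω = ω := by
  simp [extProd]

lemma extProd_insert_min (m : ι → ι → R) {a : ι} {I : Finset ι} (h : ∀ x ∈ I, a < x)
    (ω : Finset ι → M) : extProd m (insert a I) ω = ext (m a) (extProd m I ω) := by
  have ha : a ∉ I := fun h' => lt_irrefl _ (h a h')
  rw [extProd, Finset.sort_insert (r := (· ≤ ·)) (fun b hb => (h b hb).le) ha, List.foldr_cons]; rfl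

lemma sg_insert_min_self {a : ι} {I : Finset ι} (h : ∀ x ∈ I, a < x) : sg a I = 1 := by
  rw [sg, Finset.filter_eq_empty_iff.2 (fun x hx => (h x hx).le.not_gt)]; simp

/-- Multiplication by a further row moves it to its place in the product. -/
lemma ext_extProd (m : ι → ι → R) (b : ι) (K : Finset ι) (ω : Finset ι → M) :
    (b ∉ K → ext (m b) (extProd m K ω) = sg b K • extProd m (insert b K) ω) ∧
      (b ∈ K → ext (m b) (extProd m K ω) = 0) := by
  induction K using Finset.induction_on_min with
  | empty =>
    refine ⟨fun _ => ?_, fun h => by simp at h⟩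
    rw [extProd_insert_min m (by simp)]
    simp [sg, extProd_empty]
  | insert a K ha ih =>
    have haK : a ∉ K := fun h' => lt_irrefl _ (ha a h')
    have e1 := extProd_insert_min m ha ω
    rcases lt_trichotomy b a with hb | rfl | hb
    · have hlt : ∀ x ∈ insert a K, b < x := by
        intro x hx
        rcases Finset.mem_insert.1 hx with rfl | hx
        · exact hb
        · exact hb.trans (ha x hx)
      refine ⟨fun _ => ?_, fun h => (lt_irrefl _ (hlt b h)).elim⟩
      rw [extProd_insert_min m hlt, sg_insert_min_self hlt, one_smul]
    · refine ⟨fun h => (h (by simp)).elim, fun _ => ?_⟩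
      rw [e1, ext_ext_self]
    · have hne : b ≠ a := hb.ne'
      constructor
      · intro h
        have hbK : b ∉ K := fun h' => h (Finset.mem_insert_of_mem h')
        have hlt : ∀ x ∈ insert b K, a < x := by
          intro x hx
          rcases Finset.mem_insert.1 hx with rfl | hx
          · exact hb
          · exact ha x hx
        rw [e1, ext_ext_comm, ih.1 hbK, Finset.insert_comm, extProd_insert_min m hlt,
          sg_eq_neg_erase (Finset.mem_insert_self a K) hb, Finset.erase_insert haK, neg_smul,
          ext_smul]
      · intro h
        have hbK : b ∈ K := (Finset.mem_insert.1 h).resolve_left hne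
        rw [e1, ext_ext_comm, ih.2 hbK, ext_zero, neg_zero]

lemma extProd_map {N : Type*} [AddCommGroup N] [Module R N] (φ : M →ₗ[R] N) (m : ι → ι → R)
    (I : Finset ι) (ω : Finset ι → M) :
    extProd m I (fun K => φ (ω K)) = fun K => φ (extProd m I ω K) := by
  induction I using Finset.induction_on_min with
  | empty => simp [extProd_empty]
  | insert a K ha ih => rw [extProd_insert_min m ha, ih, ext_map, extProd_insert_min m ha]

lemma extProd_add (m : ι → ι → R) (I : Finset ι) (ω ρ : Finset ι → M) :
    extProd m I (ω + ρ) = extProd m I ω + extProd m I ρ := by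
  induction I using Finset.induction_on_min with
  | empty => simp [extProd_empty]
  | insert a K ha ih => simp only [extProd_insert_min m ha, ih, ext_add]

lemma extProd_zero (m : ι → ι → R) (I : Finset ι) :
    extProd m I (0 : Finset ι → M) = 0 := by
  induction I using Finset.induction_on_min with
  | empty => simp [extProd_empty]
  | insert a K ha ih => simp only [extProd_insert_min m ha, ih, ext_zero]

lemma extProd_sum {α : Type*} (s : Finset α) (m : ι → ι → R) (I : Finset ι)
    (ω : α → Finset ι → M) :
    extProd m I (∑ i ∈ s, ω i) = ∑ i ∈ s, extProd m I (ω i) := by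
  classical
  induction s using Finset.induction_on with
  | empty => simp [extProd_zero]
  | insert a s ha ih => rw [Finset.sum_insert ha, Finset.sum_insert ha, extProd_add, ih]

/-- The minor of the matrix `m` with rows `I` and columns `K`: the coefficient of `e^K` in the
exterior product of the rows in `I`. -/
def minor (m : ι → ι → R) (I K : Finset ι) : R := extProd m I (Pi.single ∅ (1 : R)) K

lemma minor_empty (m : ι → ι → R) : minor m ∅ = Pi.single ∅ 1 := by
  funext K; rw [minor, extProd_empty]

lemma minor_insert_min (m : ι → ι → R) {a : ι} {I : Finset ι} (h : ∀ x ∈ I, a < x) :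
    minor m (insert a I) = ext (m a) (minor m I) := by
  funext K; rw [minor, extProd_insert_min m h]; rfl

lemma minor_eq_zero (m : ι → ι → R) {I K : Finset ι} (h : I.card ≠ K.card) : minor m I K = 0 := by
  induction I using Finset.induction_on_min generalizing K with
  | empty =>
    rw [minor_empty, Pi.single_eq_of_ne]
    rintro rfl; simp at h
  | insert a I ha ih =>
    have haI : a ∉ I := fun h' => lt_irrefl _ (ha a h')
    rw [minor_insert_min m ha, ext]
    refine Finset.sum_eq_zero fun b hb => ?_
    rw [ih, smul_zero, smul_zero]
    rw [Finset.card_insert_of_notMem haI] at h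
    have := Finset.card_erase_add_one hb
    omega

/-- `e^I f = ∑_K (minor_{IK} ▷ f) e^K`. -/
lemma extProd_single_empty (m : ι → ι → R) (I : Finset ι) (x : M) (K : Finset ι) :
    extProd m I (Pi.single ∅ x) K = minor m I K • x := by
  have h := congrFun (extProd_map (LinearMap.toSpanSingleton R M x) m I (Pi.single ∅ 1)) K
  rw [LinearMap.toSpanSingleton_apply] at h
  rw [minor, ← h]
  congr 1
  funext L
  by_cases hL : L = ∅
  · subst hL; simp
  · simp [hL]

lemma ext_minor (m : ι → ι → R) (b : ι) (K : Finset ι) :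
    (b ∉ K → ext (m b) (minor m K) = sg b K • minor m (insert b K)) ∧
      (b ∈ K → ext (m b) (minor m K) = 0) :=
  ext_extProd m b K _

lemma minor_one (I : Finset ι) :
    minor (fun a => Pi.single a (1 : R)) I = Pi.single I 1 := by
  induction I using Finset.induction_on_min with
  | empty => rw [minor_empty]
  | insert a I ha ih =>
    have haI : a ∉ I := fun h' => lt_irrefl _ (ha a h')
    rw [minor_insert_min _ ha, ih, ext_single_single a haI, sg_insert_min_self ha, one_smul]

variable [Fintype ι]

lemma sum_single_smul (ω : Finset ι → M) : ω = ∑ K, Pi.single K (ω K) := by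
  funext L
  rw [Finset.sum_apply, Finset.sum_eq_single L (fun K _ h => by simp [h.symm]) (by simp)]
  simp

lemma vec_eq_sum (v : ι → R) : v = ∑ b, v b • Pi.single b (1 : R) := by
  funext c
  rw [Finset.sum_apply, Finset.sum_eq_single c (fun K _ h => by simp [h.symm]) (by simp)]
  simp

/-- The endomorphism of the exterior algebra induced by the linear map with matrix `m`. -/
def extMap (m : ι → ι → R) (ω : Finset ι → R) : Finset ι → R := ∑ K, ω K • minor m K

lemma extMap_add (m : ι → ι → R) (ω ρ : Finset ι → R) :
    extMap m (ω + ρ) = extMap m ω + extMap m ρ := by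
  simp [extMap, add_smul, Finset.sum_add_distrib]

lemma extMap_smul {S : Type*} [Monoid S] [DistribMulAction S R] [IsScalarTower S R R]
    (m : ι → ι → R) (r : S) (ω : Finset ι → R) :
    extMap m (r • ω) = r • extMap m ω := by
  simp only [extMap, Finset.smul_sum, Pi.smul_apply]
  refine Finset.sum_congr rfl fun K _ => ?_
  funext L
  simp only [Pi.smul_apply, smul_eq_mul, smul_mul_assoc]

lemma extMap_zero (m : ι → ι → R) : extMap m 0 = 0 := by simp [extMap]

lemma extMap_sum {α : Type*} (s : Finset α) (m : ι → ι → R) (ω : α → Finset ι → R) :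
    extMap m (∑ i ∈ s, ω i) = ∑ i ∈ s, extMap m (ω i) := by
  classical
  induction s using Finset.induction_on with
  | empty => simp [extMap_zero]
  | insert a s ha ih => rw [Finset.sum_insert ha, Finset.sum_insert ha, extMap_add, ih]

lemma extMap_single (m : ι → ι → R) (K : Finset ι) (r : R) :
    extMap m (Pi.single K r) = r • minor m K := by
  rw [extMap, Finset.sum_eq_single K (fun L _ h => by simp [h]) (by simp)]
  simp

/-- The induced endomorphism is multiplicative. -/
lemma extMap_ext (m : ι → ι → R) (v : ι → R) (ω : Finset ι → R) :
    extMap m (ext v ω) = ext (∑ b, v b • m b) (extMap m ω) := by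
  have basis : ∀ (b : ι) (K : Finset ι),
      extMap m (ext (Pi.single b (1 : R)) (Pi.single K (1 : R))) = ext (m b) (minor m K) := by
    intro b K
    by_cases hb : b ∈ K
    · rw [ext_single_single_mem b hb, extMap_zero, (ext_minor m b K).2 hb]
    · rw [ext_single_single b hb, extMap_smul, extMap_single, one_smul, (ext_minor m b K).1 hb]
  have hω : ω = ∑ K, ω K • Pi.single K (1 : R) := by
    conv_lhs => rw [sum_single_smul ω]
    refine Finset.sum_congr rfl fun K _ => ?_
    rw [← Pi.single_smul, smul_eq_mul, mul_one]
  conv_lhs => rw [hω, vec_eq_sum v]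
  rw [ext_sum, extMap_sum, extMap, ext_sum]
  refine Finset.sum_congr rfl fun K _ => ?_
  rw [ext_smul, ext_smul, extMap_smul, ext_vec_sum, extMap_sum, ext_vec_sum]
  congr 1
  refine Finset.sum_congr rfl fun b _ => ?_
  rw [ext_vec_smul, extMap_smul, basis, ext_vec_smul]

lemma extMap_one (m : ι → ι → R) : extMap m (Pi.single ∅ 1) = Pi.single ∅ 1 := by
  rw [extMap_single, one_smul, minor_empty]

/-- The Cauchy–Binet formula. -/
lemma minor_mul (m m' : ι → ι → R) (I J : Finset ι) :
    minor (fun a c => ∑ b, m a b * m' b c) I J = ∑ K, minor m I K * minor m' K J := by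
  have h : minor (fun a c => ∑ b, m a b * m' b c) I = extMap m' (minor m I) := by
    induction I using Finset.induction_on_min with
    | empty => rw [minor_empty, minor_empty, extMap_one]
    | insert a I ha ih =>
      rw [minor_insert_min _ ha, minor_insert_min _ ha, ih, extMap_ext]
      congr 1
      funext c
      simp
  rw [h, extMap, Finset.sum_apply]
  simp

end Exterior

/-! ### Contractions and Hodge duality of minors -/

section Hodge

variable {ι : Type*} [LinearOrder ι] {R : Type*} [CommRing R]
  {M : Type*} [AddCommGroup M] [Module R M]

lemma sg_union {b : ι} {J K : Finset ι} (h : Disjoint J K) :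
    sg b (J ∪ K) = sg b J * sg b K := by
  unfold sg
  rw [Finset.filter_union, Finset.card_union_of_disjoint, pow_add]
  exact h.mono (Finset.filter_subset _ _) (Finset.filter_subset _ _)

/-- The sign in `e^L ∧ e^J = wsg L J • e^{L ∪ J}`, for disjoint `L` and `J`. -/
def wsg (L J : Finset ι) : ℤ := ∏ l ∈ L, sg l J

lemma wsg_mul_self (L J : Finset ι) : wsg L J * wsg L J = 1 := by
  rw [wsg, ← Finset.prod_mul_distrib]
  exact Finset.prod_eq_one fun l _ => sg_mul_self l J

lemma wsg_erase {b : ι} {L : Finset ι} (hb : b ∈ L) (J : Finset ι) :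
    wsg L J = sg b J * wsg (L.erase b) J := by
  rw [wsg, wsg, Finset.mul_prod_erase L (fun l => sg l J) hb]

lemma wsg_insert_right {a : ι} {L J : Finset ι} (haJ : a ∉ J) (haL : a ∉ L) :
    wsg L (insert a J) = wsg L J * (-1) ^ L.card * sg a L := by
  induction L using Finset.induction_on with
  | empty => simp [wsg, sg]
  | insert l L hl ih =>
    have hal : a ≠ l := fun h => haL (by simp [h])
    have haL' : a ∉ L := fun h => haL (Finset.mem_insert_of_mem h)
    have e1 : wsg (insert l L) (insert a J) = sg l (insert a J) * wsg L (insert a J) := by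
      rw [wsg, Finset.prod_insert hl]; rfl
    have e2 : wsg (insert l L) J = sg l J * wsg L J := by rw [wsg, Finset.prod_insert hl]; rfl
    rw [e1, e2, ih haL', Finset.card_insert_of_notMem hl]
    rcases lt_or_gt_of_ne hal with h | h
    · have h1 : sg l (insert a J) = - sg l J := by
        rw [sg_eq_neg_erase (Finset.mem_insert_self a J) h, Finset.erase_insert haJ]
      have h2 : sg a (insert l L) = sg a L := by
        rw [← sg_erase_of_lt (insert l L) h, Finset.erase_insert hl]
      rw [h1, h2, pow_succ]; ring
    · have h1 : sg l (insert a J) = sg l J := by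
        rw [← sg_erase_of_lt (insert a J) h, Finset.erase_insert haJ]
      have h2 : sg a (insert l L) = - sg a L := by
        rw [sg_eq_neg_erase (Finset.mem_insert_self l L) h, Finset.erase_insert hl]
      rw [h1, h2, pow_succ]; ring

/-- `e^K g e^L = ∑_N wsg N L (minor_{KN} ▷ g) e^{N ∪ L}`. -/
lemma extProd_single (m : ι → ι → R) (K L : Finset ι) (g : M) (N : Finset ι) :
    extProd m K (Pi.single L g) N =
      if L ⊆ N then wsg (N \ L) L • minor m K (N \ L) • g else 0 := by
  induction K using Finset.induction_on_min generalizing N with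
  | empty =>
    rw [extProd_empty, minor_empty]
    by_cases h : N = L
    · subst h; simp [wsg]
    · rw [Pi.single_eq_of_ne h]
      split_ifs with h'
      · rw [Pi.single_eq_of_ne, zero_smul, smul_zero]
        intro h0
        exact h (Finset.Subset.antisymm (Finset.sdiff_eq_empty_iff_subset.1 h0) h')
      · rfl
  | insert a K ha ih =>
    rw [extProd_insert_min m ha, minor_insert_min m ha, ext]
    simp only [ih]
    split_ifs with hL
    · rw [ext, Finset.sum_smul, Finset.smul_sum]
      symm
      refine Finset.sum_subset_zero_on_sdiff Finset.sdiff_subset ?_ ?_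
      · intro b hb
        have hbL : b ∈ L := by
          by_contra h
          exact (Finset.mem_sdiff.1 hb).2 (Finset.mem_sdiff.2 ⟨(Finset.mem_sdiff.1 hb).1, h⟩)
        rw [if_neg (fun h => (Finset.notMem_erase b N) (h hbL)), smul_zero, smul_zero]
      · intro b hb
        obtain ⟨hbN, hbL⟩ := Finset.mem_sdiff.1 hb
        have hsub : L ⊆ N.erase b := fun x hx =>
          Finset.mem_erase.2 ⟨fun h => hbL (h ▸ hx), hL hx⟩
        have he : N.erase b \ L = (N \ L).erase b := Finset.erase_sdiff_comm N L b
        have hu : N.erase b = (N \ L).erase b ∪ L := by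
          rw [← he, Finset.sdiff_union_of_subset hsub]
        rw [if_pos hsub, he, hu, sg_union (he ▸ Finset.sdiff_disjoint), wsg_erase hb L,
          smul_assoc, smul_assoc, smul_comm (m a b) (wsg _ _), smul_smul, smul_smul, smul_smul]
        congr 1
        ring
    · refine Finset.sum_eq_zero fun b _ => ?_
      rw [if_neg (fun h => hL (h.trans (Finset.erase_subset _ _))), smul_zero, smul_zero]

variable [Fintype ι]

/-- Contraction with the one-form `∑ v_b e^b`, with respect to the diagonal metric `η`. -/
def con (η : ι → ℤ) (v : ι → R) (ω : Finset ι → M) : Finset ι → M := fun K =>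
  ∑ a ∈ Kᶜ, (η a * sg a K) • v a • ω (insert a K)

/-- The Clifford relation between contraction and exterior multiplication. -/
lemma con_ext (η : ι → ℤ) (v w : ι → R) (ω : Finset ι → M) :
    con η v (ext w ω) + ext w (con η v ω) = (∑ a, η a • (v a * w a)) • ω := by
  funext K
  have hsplit : (∑ a, η a • (v a * w a)) • ω K =
      ∑ a ∈ Kᶜ, (η a • (v a * w a)) • ω K + ∑ a ∈ K, (η a • (v a * w a)) • ω K := by
    rw [Finset.sum_compl_add_sum, Finset.sum_smul]
  rw [Pi.add_apply, Pi.smul_apply, hsplit]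
  -- the diagonal terms give the metric, the other ones cancel in pairs
  have h1 : con η v (ext w ω) K = ∑ a ∈ Kᶜ, (η a • (v a * w a)) • ω K +
      ∑ a ∈ Kᶜ, ∑ b ∈ K, (η a * sg a K * sg b ((insert a K).erase b)) •
        (v a * w b) • ω ((insert a K).erase b) := by
    rw [con, ← Finset.sum_add_distrib]
    refine Finset.sum_congr rfl fun a ha => ?_
    have ha' : a ∉ K := Finset.mem_compl.1 ha
    rw [ext, Finset.sum_insert ha', Finset.erase_insert ha', smul_add, smul_add]
    congr 1
    · rw [smul_comm (v a), smul_smul, smul_smul, mul_assoc, sg_mul_self, mul_one, smul_assoc]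
    · rw [Finset.smul_sum, Finset.smul_sum]
      refine Finset.sum_congr rfl fun b _ => ?_
      rw [smul_comm (v a), smul_smul, smul_smul]
  have h2 : ext w (con η v ω) K = ∑ a ∈ K, (η a • (v a * w a)) • ω K +
      ∑ b ∈ K, ∑ a ∈ Kᶜ, (sg b (K.erase b) * (η a * sg a (K.erase b))) •
        (w b * v a) • ω (insert a (K.erase b)) := by
    rw [ext, ← Finset.sum_add_distrib]
    refine Finset.sum_congr rfl fun b hb => ?_
    rw [con, Finset.compl_erase, Finset.sum_insert (by simpa using hb), Finset.insert_erase hb,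
      smul_add, smul_add]
    congr 1
    · rw [smul_comm (w b), smul_smul, smul_smul, mul_comm (w b), ← mul_assoc, mul_comm _ (η b),
        mul_assoc, sg_mul_self, mul_one, smul_assoc]
    · rw [Finset.smul_sum, Finset.smul_sum]
      refine Finset.sum_congr rfl fun a _ => ?_
      rw [smul_comm (w b), smul_smul, smul_smul]
  have h3 : ∑ a ∈ Kᶜ, ∑ b ∈ K, (η a * sg a K * sg b ((insert a K).erase b)) •
        (v a * w b) • ω ((insert a K).erase b) +
      ∑ b ∈ K, ∑ a ∈ Kᶜ, (sg b (K.erase b) * (η a * sg a (K.erase b))) •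
        (w b * v a) • ω (insert a (K.erase b)) = 0 := by
    rw [Finset.sum_comm, ← Finset.sum_add_distrib]
    refine Finset.sum_eq_zero fun b hb => ?_
    rw [← Finset.sum_add_distrib]
    refine Finset.sum_eq_zero fun a ha => ?_
    have haK : a ∉ K := Finset.mem_compl.1 ha
    have hab : a ≠ b := fun h => haK (h ▸ hb)
    have hs := sg_swap (Finset.mem_insert_self a K) (Finset.mem_insert_of_mem hb) hab
    rw [Finset.erase_insert haK, Finset.erase_right_comm, Finset.erase_insert haK] at hs
    have q1 := sg_mul_self b (K.erase b)
    have q2 := sg_mul_self b ((insert a K).erase b)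
    have hsign : η a * sg a K * sg b ((insert a K).erase b) =
        -(sg b (K.erase b) * (η a * sg a (K.erase b))) := by
      linear_combination (η a * sg b (K.erase b) * sg b ((insert a K).erase b)) * hs
        - (η a * sg a K * sg b ((insert a K).erase b)) * q1
        - (η a * sg b (K.erase b) * sg a (K.erase b)) * q2
    rw [hsign, mul_comm (w b), Finset.erase_insert_of_ne hab, neg_smul, neg_add_cancel]
  rw [h1, h2, add_add_add_comm, h3, add_zero]

lemma con_single_empty (η : ι → ℤ) (v : ι → R) (x : M) :
    con η v (Pi.single ∅ x : Finset ι → M) = 0 := by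
  funext K
  rw [con, Pi.zero_apply]
  refine Finset.sum_eq_zero fun a _ => ?_
  rw [Pi.single_eq_of_ne (Finset.insert_ne_empty a K), smul_zero, smul_zero]

lemma con_single (η : ι → ℤ) (a : ι) {J : Finset ι} (ha : a ∈ J) (x : M) :
    con η (Pi.single a (1 : R)) (Pi.single J x) =
      (η a * sg a (J.erase a)) • Pi.single (J.erase a) x := by
  funext K
  rw [con, Pi.smul_apply]
  by_cases haK : a ∈ K
  · have : K ≠ J.erase a := fun h => by simp [h] at haK
    rw [Pi.single_eq_of_ne this, smul_zero]
    refine Finset.sum_eq_zero fun c hc => ?_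
    have : c ≠ a := fun h => (Finset.mem_compl.1 hc) (h ▸ haK)
    simp [this]
  · rw [Finset.sum_eq_single a (fun c _ hc => by simp [hc])
      (fun h => (h (Finset.mem_compl.2 haK)).elim)]
    by_cases hK : K = J.erase a
    · subst hK; simp [Finset.insert_erase ha]
    · have : insert a K ≠ J := fun h => hK (by rw [← h, Finset.erase_insert haK])
      simp [hK, this]

/-- An orthogonal transformation intertwines contractions. -/
lemma extMap_con (η : ι → ℤ) (m : ι → ι → R)
    (hm : ∀ a b, ∑ c, η c • (m a c * m b c) = if a = b then ((η a : ℤ) : R) else 0)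
    (a : ι) (J : Finset ι) :
    extMap m (con η (Pi.single a (1 : R)) (Pi.single J (1 : R))) = con η (m a) (minor m J) := by
  induction J using Finset.induction_on_min with
  | empty => rw [con_single_empty, minor_empty, con_single_empty, extMap_zero]
  | insert i J hi ih =>
    have hiJ : i ∉ J := fun h' => lt_irrefl _ (hi i h')
    have e1 : (Pi.single (insert i J) (1 : R) : Finset ι → R)
        = ext (Pi.single i (1 : R)) (Pi.single J 1) := by
      rw [ext_single_single i hiJ, sg_insert_min_self hi, one_smul]
    have e2 : (∑ c, η c • ((Pi.single a (1 : R) : ι → R) c * (Pi.single i (1 : R) : ι → R) c))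
        = ∑ c, η c • (m a c * m i c) := by
      rw [hm, Finset.sum_eq_single a (fun c _ hc => by simp [hc]) (by simp)]
      by_cases hai : a = i
      · subst hai; simp
      · simp [hai]
    have h1 := con_ext η (Pi.single a (1 : R)) (Pi.single i (1 : R))
      (Pi.single J (1 : R) : Finset ι → R)
    rw [e1, minor_insert_min m hi, eq_sub_of_add_eq h1,
      eq_sub_of_add_eq (con_ext η (m a) (m i) (minor m J)), sub_eq_add_neg, extMap_add,
      ← neg_one_smul R, extMap_smul, extMap_smul, extMap_ext, ih, extMap_single, one_smul,
      neg_one_smul, ← sub_eq_add_neg, e2]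
    congr 2
    funext c
    simp [Pi.single_apply, ite_apply]

/-- The sign in `*e^I = hsg η I • e^{Iᶜ}`, fixed by `e^I ∧ *e^I = η_I vol`. -/
def hsg (η : ι → ℤ) (I : Finset ι) : ℤ := (∏ l ∈ I, η l) * wsg I Iᶜ

/-- The signs satisfy `*(e^a ∧ ω) = ± i_a *ω`. -/
lemma hsg_erase (η : ι → ℤ) {a : ι} {L : Finset ι} (ha : a ∈ L) :
    hsg η L * sg a (L.erase a) =
      η a * sg a Lᶜ * (-1) ^ (L.erase a).card * hsg η (L.erase a) := by
  have hc : (L.erase a)ᶜ = insert a Lᶜ := Finset.compl_erase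
  rw [hsg, hsg, hc, wsg_insert_right (by simpa using ha) (by simp), wsg_erase ha,
    ← Finset.mul_prod_erase L η ha]
  have h2 : ((-1 : ℤ) ^ (L.erase a).card) * (-1) ^ (L.erase a).card = 1 := by
    rw [← mul_pow]; simp
  linear_combination (-(η a * (∏ l ∈ L.erase a, η l) * sg a Lᶜ * wsg (L.erase a) Lᶜ *
    sg a (L.erase a))) * h2

/-- Complementary minors of an orthogonal matrix of determinant one: the induced endomorphism of
the exterior algebra commutes with Hodge duality. -/
lemma minor_compl (η : ι → ℤ) (m : ι → ι → R)
    (hm : ∀ a b, ∑ c, η c • (m a c * m b c) = if a = b then ((η a : ℤ) : R) else 0)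
    (hdet : minor m Finset.univ Finset.univ = 1) (I K : Finset ι) :
    hsg η K • minor m I K = hsg η I • minor m Iᶜ Kᶜ := by
  induction I using Finset.induction_on_min generalizing K with
  | empty =>
    rw [minor_empty, Finset.compl_empty]
    by_cases hK : K = ∅
    · subst hK; rw [Finset.compl_empty, hdet, Pi.single_eq_same]
    · rw [Pi.single_eq_of_ne hK, minor_eq_zero, smul_zero, smul_zero]
      rw [Ne, Finset.card_compl, Finset.card_univ]
      have := Finset.card_pos.2 (Finset.nonempty_iff_ne_empty.2 hK)
      have := Finset.card_le_univ K
      omega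
  | insert a I ha ih =>
    have haI : a ∉ I := fun h' => lt_irrefl _ (ha a h')
    by_cases hcard : (insert a I).card = K.card
    swap
    · rw [minor_eq_zero m hcard, minor_eq_zero, smul_zero, smul_zero]
      rw [Finset.card_compl, Finset.card_compl]
      have := Finset.card_le_univ K
      have := Finset.card_le_univ (insert a I)
      omega
    have hcI : (insert a I)ᶜ = Iᶜ.erase a := Finset.compl_insert
    have hcon : con η (m a) (minor m Iᶜ) = (η a * sg a (insert a I)ᶜ) • minor m (insert a I)ᶜ := by
      rw [← extMap_con η m hm, con_single η a (by simpa using haI), extMap_smul, extMap_single,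
        one_smul, hcI]
    have hsign : hsg η (insert a I) = η a * sg a (insert a I)ᶜ * (-1) ^ I.card * hsg η I := by
      have h := hsg_erase η (Finset.mem_insert_self a I)
      rwa [Finset.erase_insert haI, sg_insert_min_self ha, mul_one] at h
    have hK : ∀ b ∈ K, (K.erase b).card = I.card := by
      intro b hb
      rw [Finset.card_insert_of_notMem haI] at hcard
      have := Finset.card_erase_add_one hb
      omega
    -- expanding the new row on the left is contracting the complementary minors on the right
    calc hsg η K • minor m (insert a I) K
        = ((-1) ^ I.card * hsg η I) • con η (m a) (minor m Iᶜ) Kᶜ := by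
          rw [minor_insert_min m ha, ext, con, compl_compl, Finset.smul_sum, Finset.smul_sum]
          refine Finset.sum_congr rfl fun b hb => ?_
          rw [smul_smul, hsg_erase η hb, hK b hb, mul_smul, smul_comm (hsg η (K.erase b)) (m a b),
            ih, ← Finset.compl_erase, smul_comm (m a b) (hsg η I), smul_smul, smul_smul]
          congr 1
          ring
      _ = hsg η (insert a I) • minor m (insert a I)ᶜ Kᶜ := by
          rw [hcon, Pi.smul_apply, smul_smul, hsign]
          congr 1
          ring

end Hodge

/-! ### The matrix of translations as a Lorentz transformation -/

section Lorentz

variable {R : Type*} [CommRing R]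

/-- The signs of the metric `diag(-1,1,1,1,1)`. -/
def etaZ (a : Fin 5) : ℤ := if a = 0 then -1 else 1

/-- The matrix `λ` over a commutative ring, with `h = 1/2`, `E = e^{P₀/κ}`, `E' = e^{-P₀/κ}` and
`p = κ⁻¹ P`. -/
def lorentz (h E E' : R) (p : Fin 3 → R) : Fin 5 → Fin 5 → R :=
  ![![h * (E + E') + h * (E * ∑ j, p j * p j), p 0, p 1, p 2,
      -(h * (E - E')) - h * (E * ∑ j, p j * p j)],
    ![E * p 0, 1, 0, 0, -(E * p 0)],
    ![E * p 1, 0, 1, 0, -(E * p 1)],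
    ![E * p 2, 0, 0, 1, -(E * p 2)],
    ![-(h * (E - E')) + h * (E * ∑ j, p j * p j), p 0, p 1, p 2,
      h * (E + E') - h * (E * ∑ j, p j * p j)]]

lemma lorentz_orthogonal {h E E' : R} (p : Fin 3 → R) (hh : h * 2 = 1) (hE : E * E' = 1)
    (a b : Fin 5) :
    ∑ c, etaZ c • (lorentz h E E' p a c * lorentz h E E' p b c) =
      if a = b then ((etaZ a : ℤ) : R) else 0 := by
  fin_cases a <;> fin_cases b <;>
    simp [lorentz, etaZ, Fin.sum_univ_five, Fin.sum_univ_three] <;> grind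

lemma lorentz_orthogonal' {h E E' : R} (p : Fin 3 → R) (hh : h * 2 = 1) (hE : E * E' = 1)
    (a c : Fin 5) :
    ∑ b, ((etaZ a * etaZ b : ℤ) : R) * lorentz h E E' p b a * lorentz h E E' p b c =
      (Pi.single a (1 : R) : Fin 5 → R) c := by
  fin_cases a <;> fin_cases c <;>
    simp [lorentz, etaZ, Fin.sum_univ_five, Fin.sum_univ_three] <;> grind

/-- Subtracting the last row from the first one leaves a multiple of a null vector, modulo which the
spatial rows are unit vectors. -/
lemma lorentz_det {h E E' : R} (p : Fin 3 → R) (hh : h * 2 = 1) (hE : E * E' = 1) :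
    minor (lorentz h E E' p) Finset.univ Finset.univ = 1 := by
  set m := lorentz h E E' p with hm
  set x : Finset (Fin 5) → R := Pi.single ∅ 1 with hx
  -- the rows are combinations of the null vector `n = e⁰ - e⁴`, of `e¹, e², e³` and of the last row
  set n : Fin 5 → R := ![1, 0, 0, 0, -1] with hn
  have hsort : minor m Finset.univ =
      ext (m 0) (ext (m 1) (ext (m 2) (ext (m 3) (ext (m 4) x)))) := by
    rw [show (Finset.univ : Finset (Fin 5)) = insert 0 (insert 1 (insert 2 (insert 3 (insert 4 ∅))))
      from by decide, minor_insert_min m (by decide), minor_insert_min m (by decide),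
      minor_insert_min m (by decide), minor_insert_min m (by decide),
      minor_insert_min m (by decide), minor_empty]
  have r0 : m 0 = m 4 + E • n := by
    funext c; fin_cases c <;> simp [hm, lorentz, hn] <;> grind
  have r : ∀ j : Fin 3, m j.succ.castSucc = Pi.single j.succ.castSucc 1 + (E * p j) • n := by
    intro j; funext c; fin_cases j <;> fin_cases c <;> simp [hm, lorentz, hn]
  have r1 : m 1 = Pi.single 1 1 + (E * p 0) • n := r 0
  have r2 : m 2 = Pi.single 2 1 + (E * p 1) • n := r 1
  have r3 : m 3 = Pi.single 3 1 + (E * p 2) • n := r 2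
  have k4 : ext (m 4) (ext (m 1) (ext (m 2) (ext (m 3) (ext (m 4) x)))) = 0 := by
    rw [ext_ext_comm (m 3), ext_neg, ext_ext_comm (m 2), neg_neg, ext_ext_comm (m 1), ext_neg,
      ext_ext_self, neg_zero]
  have kn : ∀ (v : Fin 5 → R) (c : R) (y y' : Finset (Fin 5) → R), ext n y = ext n y' →
      ext n (ext (v + c • n) y) = ext n (ext v y') := by
    intro v c y y' hy
    rw [ext_vec_add, ext_vec_smul, ext_add, ext_smul, ext_ext_self, smul_zero, add_zero,
      ext_ext_comm, hy, ext_ext_comm v, neg_neg]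
  have key : minor m Finset.univ = E • ext n (ext (Pi.single 1 (1 : R))
      (ext (Pi.single 2 (1 : R)) (ext (Pi.single 3 (1 : R)) (ext (m 4) x)))) := by
    rw [hsort]
    nth_rewrite 1 [r0]
    rw [ext_vec_add, k4, zero_add, ext_vec_smul, r1, r2, r3]
    rw [kn _ _ _ _ (kn _ _ _ _ (kn _ _ _ _ rfl))]
  have s1 : (((Finset.univ.erase (0 : Fin 5)).erase 1).erase 2).erase 3 = {4} := by decide
  have s2 : (((Finset.univ.erase (4 : Fin 5)).erase 1).erase 2).erase 3 = {0} := by decide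
  have g : ∀ (b : Fin 5) (K : Finset (Fin 5)), b ∈ K → ∀ (y : Finset (Fin 5) → R),
      ext (Pi.single b (1 : R)) y K = sg b (K.erase b) • y (K.erase b) := by
    intro b K hK y
    rw [ext, Finset.sum_eq_single b (fun c _ hc => by simp [hc]) (fun h => (h hK).elim)]
    simp
  rw [key, Pi.smul_apply, ext, Fin.sum_univ_five]
  rw [g 1 _ (by decide), g 2 _ (by decide), g 3 _ (by decide), s1,
    g 1 (Finset.univ.erase 4) (by decide), g 2 ((Finset.univ.erase 4).erase 1) (by decide),
    g 3 (((Finset.univ.erase 4).erase 1).erase 2) (by decide), s2,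
    show sg (0 : Fin 5) (Finset.univ.erase 0) = 1 by decide,
    show sg (1 : Fin 5) ((Finset.univ.erase 0).erase 1) = 1 by decide,
    show sg (2 : Fin 5) (((Finset.univ.erase 0).erase 1).erase 2) = 1 by decide,
    show sg (3 : Fin 5) {4} = 1 by decide,
    show sg (4 : Fin 5) (Finset.univ.erase 4) = 1 by decide,
    show sg (1 : Fin 5) ((Finset.univ.erase 4).erase 1) = -1 by decide,
    show sg (2 : Fin 5) (((Finset.univ.erase 4).erase 1).erase 2) = -1 by decide,
    show sg (3 : Fin 5) {0} = -1 by decide]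
  simp [ext, hx, hm, lorentz, hn, show sg (4 : Fin 5) ∅ = 1 by decide,
    show sg (0 : Fin 5) ∅ = 1 by decide]
  linear_combination h * 2 * hE + hh

/-- The sign in `*e^I = starSign I • e^{Iᶜ}`. In degrees above two it differs from `hsg`, since the
metric has determinant `-1` while `* ∘ *` is the identity. -/
def starSign (I : Finset (Fin 5)) : ℤ := if I.card ≤ 2 then hsg etaZ I else -hsg etaZ I

/-- The induced map of the exterior algebra commutes with the Hodge star. -/
lemma starSign_minor {m : Fin 5 → Fin 5 → R}
    (hm : ∀ a b, ∑ c, etaZ c • (m a c * m b c) = if a = b then ((etaZ a : ℤ) : R) else 0)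
    (hdet : minor m Finset.univ Finset.univ = 1) (I K : Finset (Fin 5)) :
    starSign K • minor m I K = starSign I • minor m Iᶜ Kᶜ := by
  by_cases hc : I.card = K.card
  · have h := minor_compl etaZ m hm hdet I K
    unfold starSign
    rw [hc]
    split_ifs
    · exact h
    · rw [neg_smul, neg_smul, h]
  · rw [minor_eq_zero m hc, minor_eq_zero, smul_zero, smul_zero]
    rw [Finset.card_compl, Finset.card_compl]
    have h1 := Finset.card_le_univ K
    have h2 := Finset.card_le_univ I
    omega

lemma starSign_mul_compl (I : Finset (Fin 5)) : starSign I * starSign Iᶜ = 1 := by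
  revert I; decide

lemma starSign_mul_self (I : Finset (Fin 5)) : starSign I * starSign I = 1 := by
  revert I; decide

end Lorentz

/-! ### Functions of exponential growth and Gaussians -/

section Oscillatory

open MeasureTheory Filter

/-- At most exponential growth on the line. -/
def ExpBdd (h : ℝ → ℂ) : Prop := ∃ C m : ℝ, 0 ≤ C ∧ 0 ≤ m ∧ ∀ v, ‖h v‖ ≤ C * Real.exp (m * |v|)

lemma ExpBdd.const (c : ℂ) : ExpBdd fun _ => c := ⟨‖c‖, 0, norm_nonneg _, le_rfl, by simp⟩

lemma ExpBdd.mul {f g : ℝ → ℂ} (hf : ExpBdd f) (hg : ExpBdd g) : ExpBdd fun v => f v * g v := by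
  obtain ⟨C, m, hC, hm, h⟩ := hf
  obtain ⟨C', m', hC', hm', h'⟩ := hg
  refine ⟨C * C', m + m', by positivity, by positivity, fun v => ?_⟩
  rw [norm_mul, add_mul, Real.exp_add]
  calc _ ≤ (C * Real.exp (m * |v|)) * (C' * Real.exp (m' * |v|)) := by
        gcongr
        · exact h v
        · exact h' v
    _ = _ := by ring

lemma ExpBdd.add {f g : ℝ → ℂ} (hf : ExpBdd f) (hg : ExpBdd g) : ExpBdd fun v => f v + g v := by
  obtain ⟨C, m, hC, hm, h⟩ := hf
  obtain ⟨C', m', hC', hm', h'⟩ := hg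
  refine ⟨C + C', m + m', by positivity, by positivity, fun v => ?_⟩
  have h0 := abs_nonneg v
  calc ‖f v + g v‖ ≤ C * Real.exp (m * |v|) + C' * Real.exp (m' * |v|) :=
        (norm_add_le _ _).trans (add_le_add (h v) (h' v))
    _ ≤ C * Real.exp ((m + m') * |v|) + C' * Real.exp ((m + m') * |v|) := by
        gcongr <;> linarith
    _ = _ := by ring

lemma ExpBdd.id : ExpBdd fun v => (v : ℂ) := by
  refine ⟨1, 1, zero_le_one, zero_le_one, fun v => ?_⟩
  rw [Complex.norm_real, Real.norm_eq_abs, one_mul, one_mul]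
  linarith [Real.add_one_le_exp |v|]

lemma ExpBdd.polynomial (p : Polynomial ℂ) : ExpBdd fun v => p.eval (v : ℂ) := by
  induction p using Polynomial.induction_on' with
  | add p q hp hq => simpa using hp.add hq
  | monomial n a =>
    induction n with
    | zero => simpa using ExpBdd.const a
    | succ n ih =>
      have := ih.mul ExpBdd.id
      simpa [pow_succ, mul_assoc] using this

lemma integrable_exp_abs_mul_gaussian (m : ℝ) {b : ℝ} (hb : 0 < b) :
    Integrable fun v : ℝ => Real.exp (m * |v|) * Real.exp (-b * v ^ 2) := by
  refine ((integrable_exp_neg_mul_sq (half_pos hb)).const_mul (Real.exp (m ^ 2 / (2 * b)))).mono'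
    (by fun_prop) (ae_of_all _ fun v => ?_)
  rw [Real.norm_of_nonneg (by positivity), ← Real.exp_add, ← Real.exp_add, Real.exp_le_exp]
  have h1 : 0 ≤ (m - b * |v|) ^ 2 / (2 * b) := by positivity
  have h2 : (m - b * |v|) ^ 2 / (2 * b) = m ^ 2 / (2 * b) - m * |v| + b / 2 * |v| ^ 2 := by
    field_simp; ring
  rw [h2, sq_abs] at h1
  linarith

lemma ExpBdd.integrable_mul_gaussian {h : ℝ → ℂ} (hh : ExpBdd h) (hc : Continuous h) {b : ℝ}
    (hb : 0 < b) : Integrable fun v : ℝ => h v * (Real.exp (-b * v ^ 2) : ℝ) := by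
  obtain ⟨C, m, hC, hm, h⟩ := hh
  refine ((integrable_exp_abs_mul_gaussian m hb).const_mul C).mono' (by fun_prop)
    (ae_of_all _ fun v => ?_)
  rw [norm_mul, Complex.norm_real, Real.norm_of_nonneg (Real.exp_pos _).le, ← mul_assoc]
  gcongr
  exact h v

/-- The Fourier transform of `e^{-ε u²}`. -/
def gz (ε v : ℝ) : ℝ := √(Real.pi / ε) * Real.exp (-(1 / (4 * ε)) * v ^ 2)

/-- The regularised plane wave `e^{-ε u²} e^{-iuv}`. -/
def wave (ε u v : ℝ) : ℂ :=
  Complex.exp (-((ε * u ^ 2 : ℝ) : ℂ)) * Complex.exp (-(Complex.I * ((u * v : ℝ) : ℂ)))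

lemma norm_wave (ε u v : ℝ) : ‖wave ε u v‖ = Real.exp (-ε * u ^ 2) := by
  rw [wave, norm_mul, Complex.norm_exp, Complex.norm_exp]
  simp [-Complex.ofReal_pow]

@[fun_prop]
lemma continuous_wave (ε : ℝ) {X : Type*} [TopologicalSpace X] {f g : X → ℝ} (hf : Continuous f)
    (hg : Continuous g) : Continuous fun x => wave ε (f x) (g x) := by
  unfold wave; fun_prop

lemma integral_wave {ε : ℝ} (hε : 0 < ε) (v : ℝ) : ∫ u, wave ε u v = gz ε v := by
  have h := fourierIntegral_gaussian (b := (ε : ℂ)) (by simpa using hε) (-(v : ℂ))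
  have e : ((Real.pi : ℂ) / ε) ^ (1 / 2 : ℂ) = (√(Real.pi / ε) : ℝ) := by
    rw [Real.sqrt_eq_rpow, Complex.ofReal_cpow (by positivity)]; simp
  rw [e] at h
  rw [gz]
  push_cast
  rw [show ((√(Real.pi / ε) : ℝ) : ℂ) * Complex.exp (-(1 / (4 * (ε : ℂ))) * (v : ℂ) ^ 2)
    = (√(Real.pi / ε) : ℝ) * Complex.exp (-(-(v : ℂ)) ^ 2 / (4 * ε)) by congr 2; ring, ← h]
  refine integral_congr_ae (ae_of_all _ fun u => ?_)
  simp only [wave]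
  rw [mul_comm]
  push_cast
  congr 2 <;> ring

lemma integrable_pow_mul_exp {ε : ℝ} (hε : 0 < ε) (k : ℕ) :
    Integrable fun u : ℝ => |u| ^ k * Real.exp (-ε * u ^ 2) := by
  have h := integrable_rpow_mul_exp_neg_mul_sq hε (s := (k : ℝ)) (by
    have : (0 : ℝ) ≤ k := k.cast_nonneg
    linarith)
  refine h.norm.congr (ae_of_all _ fun u => ?_)
  simp [Real.rpow_natCast]

lemma integrable_pow_mul_wave {ε : ℝ} (hε : 0 < ε) (k : ℕ) (v : ℝ) :
    Integrable fun u : ℝ => (u : ℂ) ^ k * wave ε u v := by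
  refine (integrable_pow_mul_exp hε k).mono' (by fun_prop) (ae_of_all _ fun u => ?_)
  rw [norm_mul, norm_wave, norm_pow, Complex.norm_real, Real.norm_eq_abs]

/-- The Fourier transform of `u^k e^{-ε u²}`. -/
def gmom (ε : ℝ) (k : ℕ) (v : ℝ) : ℂ := ∫ u : ℝ, (u : ℂ) ^ k * wave ε u v

lemma gmom_zero {ε : ℝ} (hε : 0 < ε) (v : ℝ) : gmom ε 0 v = gz ε v := by
  simp [gmom, integral_wave hε]

lemma hasDerivAt_gmom {ε : ℝ} (hε : 0 < ε) (k : ℕ) (v : ℝ) :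
    HasDerivAt (gmom ε k) (-Complex.I * gmom ε (k + 1) v) v := by
  have h := (hasDerivAt_integral_of_dominated_loc_of_deriv_le (μ := volume)
    (F := fun v (u : ℝ) => (u : ℂ) ^ k * wave ε u v)
    (F' := fun v (u : ℝ) => -Complex.I * ((u : ℂ) ^ (k + 1) * wave ε u v))
    (bound := fun u => |u| ^ (k + 1) * Real.exp (-ε * u ^ 2)) (x₀ := v) (s := Set.univ)
    Filter.univ_mem (Eventually.of_forall fun v => by fun_prop)
    (integrable_pow_mul_wave hε k v) (by fun_prop)
    (ae_of_all _ fun u v _ => by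
      rw [norm_mul, norm_mul, norm_wave, norm_pow, Complex.norm_real, Real.norm_eq_abs]; simp)
    (integrable_pow_mul_exp hε (k + 1)) (ae_of_all _ fun u v _ => ?_)).2
  · rwa [integral_const_mul] at h
  · have h1 : HasDerivAt (fun v : ℝ => -(Complex.I * ((u * v : ℝ) : ℂ))) (-(Complex.I * u)) v := by
      have := ((hasDerivAt_id v).const_mul u).ofReal_comp
      simpa using (this.const_mul Complex.I).fun_neg
    have h2 := (h1.cexp.const_mul (Complex.exp (-((ε * u ^ 2 : ℝ) : ℂ)))).const_mul ((u : ℂ) ^ k)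
    refine h2.congr_deriv ?_
    simp only [wave]; ring

lemma gmom_eq_polynomial {ε : ℝ} (hε : 0 < ε) (k : ℕ) :
    ∃ p : Polynomial ℂ, ∀ v : ℝ, gmom ε k v = p.eval (v : ℂ) *
      (Real.exp (-(1 / (4 * ε)) * v ^ 2) : ℝ) := by
  induction k with
  | zero =>
    refine ⟨Polynomial.C ((√(Real.pi / ε) : ℝ) : ℂ), fun v => ?_⟩
    rw [gmom_zero hε, gz, Polynomial.eval_C]; push_cast; rfl
  | succ k ih =>
    obtain ⟨p, hp⟩ := ih
    refine ⟨Polynomial.C Complex.I * (Polynomial.derivative p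
      - Polynomial.C ((1 / (2 * ε) : ℝ) : ℂ) * Polynomial.X * p), fun v => ?_⟩
    have h1 := hasDerivAt_gmom hε k v
    have h2 : HasDerivAt (gmom ε k) (p.derivative.eval (v : ℂ) *
        (Real.exp (-(1 / (4 * ε)) * v ^ 2) : ℝ) + p.eval (v : ℂ) *
        ((Real.exp (-(1 / (4 * ε)) * v ^ 2) * (-(1 / (4 * ε)) * (2 * v)) : ℝ) : ℂ)) v := by
      have e : gmom ε k = fun v : ℝ => p.eval (v : ℂ) *
          ((Real.exp (-(1 / (4 * ε)) * v ^ 2) : ℝ) : ℂ) := funext hp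
      rw [e]
      have a1 : HasDerivAt (fun v : ℝ => p.eval (v : ℂ)) (p.derivative.eval (v : ℂ)) v :=
        (p.hasDerivAt (v : ℂ)).comp_ofReal
      have a2 : HasDerivAt (fun v : ℝ => Real.exp (-(1 / (4 * ε)) * v ^ 2))
          (Real.exp (-(1 / (4 * ε)) * v ^ 2) * (-(1 / (4 * ε)) * (2 * v))) v := by
        have := ((hasDerivAt_pow 2 v).const_mul (-(1 / (4 * ε)))).exp
        simpa using this
      exact a1.mul a2.ofReal_comp
    have h3 := h1.unique h2
    have h4 : gmom ε (k + 1) v = Complex.I * (-Complex.I * gmom ε (k + 1) v) := by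
      rw [← mul_assoc]; simp
    rw [h4, h3]
    simp only [Polynomial.eval_mul, Polynomial.eval_sub, Polynomial.eval_C, Polynomial.eval_X]
    have : (ε : ℂ) ≠ 0 := by exact_mod_cast hε.ne'
    push_cast
    field_simp
    ring

lemma ExpBdd.integrable_mul_gmom {h : ℝ → ℂ} (hh : ExpBdd h) (hc : Continuous h) {ε : ℝ}
    (hε : 0 < ε) (k : ℕ) : Integrable fun v : ℝ => h v * gmom ε k v := by
  obtain ⟨p, hp⟩ := gmom_eq_polynomial hε k
  simp only [hp, ← mul_assoc]
  exact (hh.mul (ExpBdd.polynomial p)).integrable_mul_gaussian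
    (hc.mul (by fun_prop)) (by positivity)

/-- Smooth functions on the line with all derivatives of at most exponential growth, together with
their derivatives. -/
structure ExpSmooth (d : ℕ → ℝ → ℂ) : Prop where
  deriv : ∀ k v, HasDerivAt (d k) (d (k + 1) v) v
  bdd : ∀ k, ExpBdd (d k)

lemma ExpSmooth.continuous {d : ℕ → ℝ → ℂ} (hd : ExpSmooth d) (k : ℕ) : Continuous (d k) :=
  continuous_iff_continuousAt.2 fun v => (hd.deriv k v).continuousAt

/-- Integration by parts against the Fourier transform of `u^k e^{-ε u²}`. -/
lemma ExpSmooth.integral_mul_gmom {d : ℕ → ℝ → ℂ} (hd : ExpSmooth d) {ε : ℝ} (hε : 0 < ε)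
    (k j : ℕ) :
    ∫ v, d j v * gmom ε k v = (-Complex.I) ^ k * ∫ v, d (j + k) v * gmom ε 0 v := by
  induction k generalizing j with
  | zero => simp
  | succ k ih =>
    have h := integral_mul_deriv_eq_deriv_mul_of_integrable
      (u := d j) (u' := d (j + 1)) (v := gmom ε k) (v' := fun v => -Complex.I * gmom ε (k + 1) v)
      (fun v _ => hd.deriv j v) (fun v _ => hasDerivAt_gmom hε k v) ?_
      ((hd.bdd (j + 1)).integrable_mul_gmom (hd.continuous _) hε k)
      ((hd.bdd j).integrable_mul_gmom (hd.continuous _) hε k)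
    · have e : ∀ v, d j v * gmom ε (k + 1) v
          = Complex.I * (d j v * (-Complex.I * gmom ε (k + 1) v)) := by
        intro v
        linear_combination (d j v * gmom ε (k + 1) v) * Complex.I_mul_I
      simp_rw [e]
      rw [integral_const_mul, h, ih (j + 1), show j + 1 + k = j + (k + 1) by ring, pow_succ]
      ring
    · have := ((hd.bdd j).integrable_mul_gmom (hd.continuous _) hε (k + 1)).const_mul (-Complex.I)
      refine this.congr (ae_of_all _ fun v => ?_)
      simp only [Pi.mul_apply]; ring

/-- The Gaussians `(2π)⁻¹ gz ε` approximate the delta function. -/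
lemma ExpBdd.tendsto_integral_gz {h : ℝ → ℂ} (hh : ExpBdd h) (hc : Continuous h) :
    Tendsto (fun ε : ℝ => (1 / (2 * (Real.pi : ℂ))) * ∫ v, h v * (gz ε v : ℂ)) (𝓝[>] 0)
      (𝓝 (h 0)) := by
  have hpi := Real.pi_pos
  have e : ∀ ε : ℝ, 0 < ε → (1 / (2 * (Real.pi : ℂ))) * ∫ v, h v * (gz ε v : ℂ) =
      ((1 / √Real.pi : ℝ) : ℂ) * ∫ y, h (2 * √ε * y) * (Real.exp (-1 * y ^ 2) : ℝ) := by
    intro ε hε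
    have hs : 0 < √ε := Real.sqrt_pos.2 hε
    have hsub := Measure.integral_comp_mul_left (fun v => h v * (gz ε v : ℂ)) (2 * √ε)
    have hg : ∀ y, gz ε (2 * √ε * y) = √(Real.pi / ε) * Real.exp (-1 * y ^ 2) := by
      intro y
      rw [gz]
      congr 2
      rw [mul_pow, mul_pow, Real.sq_sqrt hε.le]
      field_simp; norm_num
    have h1 : ∫ y, h (2 * √ε * y) * (Real.exp (-1 * y ^ 2) : ℝ) =
        ((1 / √(Real.pi / ε) : ℝ) : ℂ) * ∫ y, h (2 * √ε * y) * (gz ε (2 * √ε * y) : ℂ) := by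
      rw [← integral_const_mul]
      refine integral_congr_ae (ae_of_all _ fun y => ?_)
      have : ((√(Real.pi / ε) : ℝ) : ℂ) ≠ 0 := by
        exact_mod_cast (Real.sqrt_pos.2 (by positivity)).ne'
      simp only [hg]
      push_cast
      field_simp
    rw [h1, hsub, abs_of_pos (by positivity), Complex.real_smul, ← mul_assoc, ← mul_assoc]
    congr 1
    rw [← Complex.ofReal_mul, ← Complex.ofReal_mul]
    have : 1 / √Real.pi * (1 / √(Real.pi / ε)) * (2 * √ε)⁻¹ = 1 / (2 * Real.pi) := by
      rw [Real.sqrt_div hpi.le]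
      have := Real.mul_self_sqrt hpi.le
      have hsp : 0 < √Real.pi := Real.sqrt_pos.2 hpi
      field_simp
      nlinarith
    rw [this]; push_cast; rfl
  have lim : Tendsto (fun ε : ℝ => ∫ y, h (2 * √ε * y) * (Real.exp (-1 * y ^ 2) : ℝ)) (𝓝[>] 0)
      (𝓝 (∫ y, h 0 * (Real.exp (-1 * y ^ 2) : ℝ))) := by
    obtain ⟨C, m, hC, hm, hb⟩ := hh
    refine tendsto_integral_filter_of_dominated_convergence
      (fun y => C * (Real.exp (2 * m * |y|) * Real.exp (-1 * y ^ 2)))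
      (Eventually.of_forall fun ε => by fun_prop) ?_
      ((integrable_exp_abs_mul_gaussian (2 * m) one_pos).const_mul C) (ae_of_all _ fun y => ?_)
    · filter_upwards [Ioo_mem_nhdsGT (zero_lt_one (α := ℝ))] with ε hε
      refine ae_of_all _ fun y => ?_
      rw [norm_mul, Complex.norm_real, Real.norm_of_nonneg (Real.exp_pos _).le, ← mul_assoc]
      gcongr
      refine (hb _).trans (mul_le_mul_of_nonneg_left (Real.exp_le_exp.2 ?_) hC)
      rw [abs_mul, abs_of_nonneg (by positivity)]
      have : √ε ≤ 1 := Real.sqrt_le_one.2 hε.2.le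
      have h0 := abs_nonneg y
      nlinarith [mul_nonneg hm h0]
    · have : Tendsto (fun ε : ℝ => h (2 * √ε * y)) (𝓝[>] 0) (𝓝 (h (2 * √0 * y))) := by
        have hcont : Continuous fun ε : ℝ => h (2 * √ε * y) := by fun_prop
        exact (hcont.tendsto 0).mono_left nhdsWithin_le_nhds
      rw [Real.sqrt_zero, mul_zero, zero_mul] at this
      exact this.mul_const _
  have hlim : ((1 / √Real.pi : ℝ) : ℂ) * ∫ y, h 0 * (Real.exp (-1 * y ^ 2) : ℝ) = h 0 := by
    have hg : ∫ y : ℝ, ((Real.exp (-1 * y ^ 2) : ℝ) : ℂ) = (√(Real.pi / 1) : ℝ) := by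
      rw [← integral_gaussian]; exact integral_ofReal
    rw [integral_const_mul, hg, div_one]
    have : ((√Real.pi : ℝ) : ℂ) ≠ 0 := by exact_mod_cast (Real.sqrt_pos.2 hpi).ne'
    push_cast
    field_simp
  have := lim.const_mul ((1 / √Real.pi : ℝ) : ℂ)
  rw [hlim] at this
  refine this.congr' ?_
  filter_upwards [self_mem_nhdsWithin] with ε hε using (e ε hε).symm

end Oscillatory

/-! ### Oscillatory integrals -/

section Oscillatory

open MeasureTheory Filter

/-- The oscillatory integral of `Φ` exists, with all regularised integrals absolutely convergent,
and equals `L`. Unlike `osc`, this is additive in `Φ`. -/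
structure HasOsc (Φ : ℝ → ℝ → ℂ) (L : ℂ) : Prop where
  inner : ∀ ε > 0, ∀ v, Integrable fun u => Φ u v * wave ε u v
  outer : ∀ ε > 0, Integrable fun v => ∫ u, Φ u v * wave ε u v
  lim : Tendsto (fun ε : ℝ => (1 / (2 * (Real.pi : ℂ))) * ∫ v, ∫ u, Φ u v * wave ε u v)
    (𝓝[>] 0) (𝓝 L)

lemma HasOsc.osc_eq {Φ : ℝ → ℝ → ℂ} {L : ℂ} (h : HasOsc Φ L) : osc Φ = L := by
  rw [← h.lim.limUnder_eq, osc]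
  congr 1
  funext ε
  congr 1
  refine integral_congr_ae (ae_of_all _ fun v => integral_congr_ae (ae_of_all _ fun u => ?_))
  simp only [wave]; ring

lemma HasOsc.add {Φ Ψ : ℝ → ℝ → ℂ} {L M : ℂ} (h : HasOsc Φ L) (h' : HasOsc Ψ M) :
    HasOsc (fun u v => Φ u v + Ψ u v) (L + M) := by
  have e : ∀ ε > 0, ∀ v, ∫ u, (Φ u v + Ψ u v) * wave ε u v =
      (∫ u, Φ u v * wave ε u v) + ∫ u, Ψ u v * wave ε u v := by
    intro ε hε v
    simp_rw [add_mul]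
    exact integral_add (h.inner ε hε v) (h'.inner ε hε v)
  refine ⟨fun ε hε v => ?_, fun ε hε => ?_, ?_⟩
  · simp_rw [add_mul]
    exact (h.inner ε hε v).add (h'.inner ε hε v)
  · simp_rw [e ε hε]
    exact (h.outer ε hε).add (h'.outer ε hε)
  · refine (h.lim.add h'.lim).congr' ?_
    filter_upwards [self_mem_nhdsWithin] with ε hε
    simp_rw [e ε hε]
    rw [integral_add (h.outer ε hε) (h'.outer ε hε), mul_add]

lemma HasOsc.const_mul {Φ : ℝ → ℝ → ℂ} {L : ℂ} (h : HasOsc Φ L) (c : ℂ) :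
    HasOsc (fun u v => c * Φ u v) (c * L) := by
  refine ⟨fun ε hε v => ?_, fun ε hε => ?_, ?_⟩
  · simp_rw [mul_assoc]
    exact (h.inner ε hε v).const_mul c
  · simp_rw [mul_assoc, integral_const_mul]
    exact (h.outer ε hε).const_mul c
  · simp_rw [mul_assoc, integral_const_mul]
    refine (h.lim.const_mul c).congr fun ε => ?_
    ring

lemma HasOsc.zero : HasOsc (fun _ _ => 0) 0 := ⟨by simp, by simp, by simp⟩

lemma HasOsc.sum {α : Type*} (s : Finset α) {Φ : α → ℝ → ℝ → ℂ} {L : α → ℂ}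
    (h : ∀ i ∈ s, HasOsc (Φ i) (L i)) :
    HasOsc (fun u v => ∑ i ∈ s, Φ i u v) (∑ i ∈ s, L i) := by
  classical
  induction s using Finset.induction_on with
  | empty => simpa using HasOsc.zero
  | insert a s ha ih =>
    simp_rw [Finset.sum_insert ha]
    exact (h a (Finset.mem_insert_self a s)).add
      (ih fun i hi => h i (Finset.mem_insert_of_mem hi))

lemma HasOsc.pow_mul {d : ℕ → ℝ → ℂ} (hd : ExpSmooth d) (k : ℕ) :
    HasOsc (fun u v => (u : ℂ) ^ k * d 0 v) ((-Complex.I) ^ k * d k 0) := by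
  have e : ∀ ε v, ∫ u : ℝ, (u : ℂ) ^ k * d 0 v * wave ε u v = d 0 v * gmom ε k v := by
    intro ε v
    rw [gmom, ← integral_const_mul]
    refine integral_congr_ae (ae_of_all _ fun u => ?_)
    ring
  refine ⟨fun ε hε v => ?_, fun ε hε => ?_, ?_⟩
  · refine ((integrable_pow_mul_wave hε k v).const_mul (d 0 v)).congr (ae_of_all _ fun u => ?_)
    ring
  · simp_rw [e]
    exact (hd.bdd 0).integrable_mul_gmom (hd.continuous 0) hε k
  · refine (((hd.bdd k).tendsto_integral_gz (hd.continuous k)).const_mul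
      ((-Complex.I) ^ k)).congr' ?_
    filter_upwards [self_mem_nhdsWithin] with ε hε
    have hε : 0 < ε := hε
    simp_rw [e, hd.integral_mul_gmom hε k 0, zero_add, gmom_zero hε]
    ring

lemma HasOsc.polynomial_mul {d : ℕ → ℝ → ℂ} (hd : ExpSmooth d) (q : Polynomial ℂ) :
    HasOsc (fun u v => q.eval (u : ℂ) * d 0 v)
      (∑ k ∈ Finset.range (q.natDegree + 1), q.coeff k * ((-Complex.I) ^ k * d k 0)) := by
  have h := HasOsc.sum (Finset.range (q.natDegree + 1))
    (fun k _ => (HasOsc.pow_mul hd k).const_mul (q.coeff k))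
  have e : (fun u v : ℝ => q.eval (u : ℂ) * d 0 v) = fun (u v : ℝ) =>
      ∑ k ∈ Finset.range (q.natDegree + 1), q.coeff k * ((u : ℂ) ^ k * d 0 v) := by
    funext u v
    rw [Polynomial.eval_eq_sum_range, Finset.sum_mul]
    refine Finset.sum_congr rfl fun k _ => ?_
    ring
  rw [e]
  exact h

/-- Amplitudes whose frequencies in `u` lie in a bounded interval. -/
structure BandLimited (H : ℝ → ℝ → ℂ) : Prop where
  continuous : Continuous (Function.uncurry H)
  bdd : ∃ R C m : ℝ, 0 ≤ R ∧ 0 ≤ C ∧ 0 ≤ m ∧ (∀ w v, R < |w| → H w v = 0) ∧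
    ∀ w v, ‖H w v‖ ≤ C * Real.exp (m * |v|)

lemma gz_nonneg (ε v : ℝ) : 0 ≤ gz ε v := by unfold gz; positivity

@[fun_prop]
lemma continuous_gz (ε : ℝ) : Continuous (gz ε) := by unfold gz; fun_prop

/-- `(2π)⁻¹ ∫ dv ∫ du (∫ dw H(w,v) e^{iuw}) e^{-iuv} = ∫ dw H(w,w)`. -/
lemma HasOsc.bandLimited {H : ℝ → ℝ → ℂ} (hH : BandLimited H) :
    HasOsc (fun u v => ∫ w : ℝ, H w v * Complex.exp (Complex.I * ((u * w : ℝ) : ℂ)))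
      (∫ w, H w w) := by
  obtain ⟨R, C, m, hR, hC, hm, hsupp, hbd⟩ := hH.bdd
  have hcont := hH.continuous
  set χ : ℝ → ℝ := Set.indicator (Set.Icc (-R) R) (fun _ => 1) with hχ
  have hχi : Integrable χ :=
    (integrableOn_const (by simp)).integrable_indicator measurableSet_Icc
  have hχ0 : ∀ w, 0 ≤ χ w := fun w => Set.indicator_nonneg (fun _ _ => zero_le_one) w
  have hHχ : ∀ w v, ‖H w v‖ ≤ χ w * (C * Real.exp (m * |v|)) := by
    intro w v
    by_cases hw : R < |w|
    · rw [hsupp w v hw, norm_zero]; exact mul_nonneg (hχ0 w) (by positivity)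
    · have : w ∈ Set.Icc (-R) R := abs_le.1 (not_lt.1 hw)
      rw [hχ, Set.indicator_of_mem this, one_mul]; exact hbd w v
  -- the inner integrals
  have hprod : ∀ ε > 0, ∀ v, Integrable (Function.uncurry fun u w : ℝ =>
      H w v * Complex.exp (Complex.I * ((u * w : ℝ) : ℂ)) * wave ε u v)
      (volume.prod volume) := by
    intro ε hε v
    have hm1 : Continuous (Function.uncurry fun u w : ℝ =>
        H w v * Complex.exp (Complex.I * ((u * w : ℝ) : ℂ)) * wave ε u v) := by
      have : Continuous fun p : ℝ × ℝ => H p.2 v :=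
        hcont.comp (by fun_prop : Continuous fun p : ℝ × ℝ => (p.2, v))
      unfold Function.uncurry; fun_prop
    refine (((integrable_exp_neg_mul_sq hε).mul_prod hχi).const_mul
      (C * Real.exp (m * |v|))).mono' hm1.aestronglyMeasurable (ae_of_all _ fun p => ?_)
    simp only [Function.uncurry]
    rw [norm_mul, norm_mul, norm_wave, Complex.norm_exp]
    have e0 : (Complex.I * ((p.1 * p.2 : ℝ) : ℂ)).re = 0 := by simp
    rw [e0, Real.exp_zero, mul_one]
    calc _ ≤ χ p.2 * (C * Real.exp (m * |v|)) * Real.exp (-ε * p.1 ^ 2) := by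
          gcongr; exact hHχ _ _
      _ = _ := by ring
  have hinner : ∀ ε > 0, ∀ v, ∫ u : ℝ, (∫ w : ℝ, H w v *
      Complex.exp (Complex.I * ((u * w : ℝ) : ℂ))) * wave ε u v =
      ∫ w, H w v * (gz ε (v - w) : ℂ) := by
    intro ε hε v
    simp_rw [← integral_mul_const]
    rw [integral_integral_swap (hprod ε hε v)]
    refine integral_congr_ae (ae_of_all _ fun w => ?_)
    simp only
    rw [← integral_wave hε, ← integral_const_mul]
    refine integral_congr_ae (ae_of_all _ fun u => ?_)
    simp only [wave]
    have : Complex.exp (-(Complex.I * ((u * (v - w) : ℝ) : ℂ))) =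
        Complex.exp (Complex.I * ((u * w : ℝ) : ℂ)) *
          Complex.exp (-(Complex.I * ((u * v : ℝ) : ℂ))) := by
      rw [← Complex.exp_add]; congr 1; push_cast; ring
    rw [this]; ring
  -- the outer integrals
  have hprod2 : ∀ ε > 0, Integrable (Function.uncurry fun v w : ℝ => H w v * (gz ε (v - w) : ℂ))
      (volume.prod volume) := by
    intro ε hε
    have hm1 : Continuous (Function.uncurry fun v w : ℝ => H w v * (gz ε (v - w) : ℂ)) := by
      have : Continuous fun p : ℝ × ℝ => H p.2 p.1 := hcont.comp continuous_swap
      unfold Function.uncurry; fun_prop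
    have hb : 0 < 1 / (8 * ε) := by positivity
    refine (((integrable_exp_abs_mul_gaussian m hb).mul_prod hχi).const_mul
      (C * √(Real.pi / ε) * Real.exp (1 / (4 * ε) * R ^ 2))).mono' hm1.aestronglyMeasurable
      (ae_of_all _ fun p => ?_)
    obtain ⟨v, w⟩ := p
    simp only [Function.uncurry]
    rw [norm_mul, Complex.norm_real, Real.norm_of_nonneg (gz_nonneg _ _)]
    by_cases hw : R < |w|
    · rw [hsupp w v hw, norm_zero, zero_mul]
      exact mul_nonneg (by positivity) (mul_nonneg (by positivity) (hχ0 w))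
    · have hw' : |w| ≤ R := not_lt.1 hw
      have hwm : w ∈ Set.Icc (-R) R := abs_le.1 hw'
      have h1 : χ w = 1 := by rw [hχ, Set.indicator_of_mem hwm]
      -- `(v - w)² ≥ v²/2 - w²`
      have h2 : gz ε (v - w) ≤ √(Real.pi / ε) * (Real.exp (1 / (4 * ε) * R ^ 2) *
          Real.exp (-(1 / (8 * ε)) * v ^ 2)) := by
        rw [gz, ← Real.exp_add]
        gcongr
        have h3 : w ^ 2 ≤ R ^ 2 := sq_le_sq' (abs_le.1 hw').1 (abs_le.1 hw').2
        have h4 : 0 ≤ 1 / (4 * ε) := by positivity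
        have h5 : 1 / (8 * ε) = 1 / (4 * ε) / 2 := by field_simp; norm_num
        rw [h5]
        nlinarith [sq_nonneg (v - 2 * w)]
      calc ‖H w v‖ * gz ε (v - w) ≤ (C * Real.exp (m * |v|)) * (√(Real.pi / ε) *
          (Real.exp (1 / (4 * ε) * R ^ 2) * Real.exp (-(1 / (8 * ε)) * v ^ 2))) := by
            gcongr
            · exact gz_nonneg _ _
            · exact hbd w v
        _ = _ := by rw [h1]; ring
  refine ⟨fun ε hε v => ?_, fun ε hε => ?_, ?_⟩
  · simp_rw [← integral_mul_const]
    exact (hprod ε hε v).integral_prod_left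
  · simp_rw [hinner ε hε]
    exact (hprod2 ε hε).integral_prod_left
  -- the limit
  have heq : ∀ ε > 0, (1 / (2 * (Real.pi : ℂ))) * ∫ v : ℝ, ∫ u : ℝ, (∫ w : ℝ, H w v *
      Complex.exp (Complex.I * ((u * w : ℝ) : ℂ))) * wave ε u v =
      ∫ w, (1 / (2 * (Real.pi : ℂ))) * ∫ v, H w (v + w) * (gz ε v : ℂ) := by
    intro ε hε
    simp_rw [hinner ε hε]
    rw [integral_integral_swap (hprod2 ε hε), integral_const_mul]
    congr 1
    refine integral_congr_ae (ae_of_all _ fun w => ?_)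
    have := integral_sub_right_eq_self (μ := volume) (fun v => H w (v + w) * (gz ε v : ℂ)) w
    simp only [sub_add_cancel] at this
    exact this
  have hexp : ExpBdd fun v => (Real.exp (m * |v|) : ℂ) :=
    ⟨1, m, zero_le_one, hm, fun v => by
      rw [Complex.norm_real, Real.norm_of_nonneg (Real.exp_pos _).le, one_mul]⟩
  have hexpc : Continuous fun v : ℝ => (Real.exp (m * |v|) : ℂ) := by fun_prop
  have hnear := (hexp.tendsto_integral_gz hexpc).norm.eventually_lt_const
    (show ‖((Real.exp (m * |(0 : ℝ)|) : ℝ) : ℂ)‖ < 2 by simp)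
  have hsh : ∀ w v, ‖H w (v + w)‖ ≤ χ w * (C * Real.exp (m * R)) * Real.exp (m * |v|) := by
    intro w v
    by_cases hw : R < |w|
    · rw [hsupp w _ hw, norm_zero]
      exact mul_nonneg (mul_nonneg (hχ0 w) (by positivity)) (by positivity)
    · refine (hHχ w (v + w)).trans ?_
      rw [mul_assoc, mul_assoc, ← Real.exp_add, ← mul_add]
      have h1 : |v + w| ≤ R + |v| := (abs_add_le v w).trans (by linarith [not_lt.1 hw])
      exact mul_le_mul_of_nonneg_left (mul_le_mul_of_nonneg_left (Real.exp_le_exp.2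
        (mul_le_mul_of_nonneg_left h1 hm)) hC) (hχ0 w)
  have hpt : ∀ w, Tendsto (fun ε : ℝ => (1 / (2 * (Real.pi : ℂ))) *
      ∫ v, H w (v + w) * (gz ε v : ℂ)) (𝓝[>] 0) (𝓝 (H w w)) := by
    intro w
    have h1 : ExpBdd fun v => H w (v + w) :=
      ⟨χ w * (C * Real.exp (m * R)), m, mul_nonneg (hχ0 w) (by positivity), hm, hsh w⟩
    have h2 : Continuous fun v => H w (v + w) :=
      hcont.comp (by fun_prop : Continuous fun v : ℝ => (w, v + w))
    simpa using h1.tendsto_integral_gz h2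
  have hDCT : Tendsto (fun ε : ℝ => ∫ w, (1 / (2 * (Real.pi : ℂ))) *
      ∫ v, H w (v + w) * (gz ε v : ℂ)) (𝓝[>] 0) (𝓝 (∫ w, H w w)) := by
    refine tendsto_integral_filter_of_dominated_convergence
      (fun w => 2 * (C * Real.exp (m * R)) * χ w) ?_ ?_ (hχi.const_mul _)
      (ae_of_all _ hpt)
    · refine Eventually.of_forall fun ε => ?_
      have : Continuous (Function.uncurry fun w v : ℝ => H w (v + w) * (gz ε v : ℂ)) := by
        have h1 : Continuous fun p : ℝ × ℝ => H p.1 (p.2 + p.1) :=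
          hcont.comp (by fun_prop : Continuous fun p : ℝ × ℝ => (p.1, p.2 + p.1))
        unfold Function.uncurry; fun_prop
      exact (this.aestronglyMeasurable.integral_prod_right' (μ := volume)).const_mul _
    · filter_upwards [hnear, self_mem_nhdsWithin] with ε h1 hε
      have hε : 0 < ε := hε
      refine ae_of_all _ fun w => ?_
      have hgi : Integrable fun v : ℝ => Real.exp (m * |v|) * gz ε v := by
        refine ((integrable_exp_abs_mul_gaussian m
          (show 0 < 1 / (4 * ε) by positivity)).const_mul √(Real.pi / ε)).congr
          (ae_of_all _ fun v => ?_)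
        simp only [gz]; ring
      have h2 : ‖∫ v, H w (v + w) * (gz ε v : ℂ)‖ ≤
          χ w * (C * Real.exp (m * R)) * ∫ v, Real.exp (m * |v|) * gz ε v := by
        rw [← integral_const_mul]
        refine norm_integral_le_of_norm_le (hgi.const_mul _) (ae_of_all _ fun v => ?_)
        rw [norm_mul, Complex.norm_real, Real.norm_of_nonneg (gz_nonneg _ _), ← mul_assoc]
        exact mul_le_mul_of_nonneg_right (hsh w v) (gz_nonneg _ _)
      have h3 : (∫ v, (Real.exp (m * |v|) : ℂ) * (gz ε v : ℂ)) =
          ((∫ v, Real.exp (m * |v|) * gz ε v : ℝ) : ℂ) := by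
        refine Eq.trans ?_ (integral_ofReal (𝕜 := ℂ) (μ := volume)
          (f := fun v => Real.exp (m * |v|) * gz ε v))
        refine integral_congr_ae (ae_of_all _ fun v => ?_)
        simp only [Complex.coe_algebraMap, Complex.ofReal_mul]
      have h4 : 0 ≤ ∫ v, Real.exp (m * |v|) * gz ε v :=
        integral_nonneg fun v => mul_nonneg (Real.exp_pos _).le (gz_nonneg _ _)
      rw [h3, norm_mul, Complex.norm_real, Real.norm_of_nonneg h4] at h1
      rw [norm_mul]
      have h5 := mul_nonneg (hχ0 w) (mul_nonneg hC (Real.exp_pos (m * R)).le)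
      calc _ ≤ ‖(1 / (2 * (Real.pi : ℂ)))‖ * (χ w * (C * Real.exp (m * R)) *
            ∫ v, Real.exp (m * |v|) * gz ε v) := by gcongr
        _ = (χ w * (C * Real.exp (m * R))) * (‖(1 / (2 * (Real.pi : ℂ)))‖ *
            ∫ v, Real.exp (m * |v|) * gz ε v) := by ring
        _ ≤ (χ w * (C * Real.exp (m * R))) * 2 := by gcongr
        _ = _ := by ring
  refine hDCT.congr' ?_
  filter_upwards [self_mem_nhdsWithin] with ε hε using (heq ε hε).symm

end Oscillatory

/-! ### Schwartz functions with compact support in the frequency -/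

section Band

open MeasureTheory Filter
open scoped ContDiff LineDeriv

/-- Schwartz functions `F(v,x)` with compact support in the frequency `v`. -/
def bandS : Submodule ℂ (SchwartzMap Pt ℂ) where
  carrier := {F | ∃ R : ℝ, ∀ (v : ℝ) (x : Fin 3 → ℝ), R < |v| → F (v, x) = 0}
  add_mem' := by
    rintro F G ⟨R, hR⟩ ⟨S, hS⟩
    refine ⟨max R S, fun v x hv => ?_⟩
    rw [add_apply, hR v x ((le_max_left _ _).trans_lt hv),
      hS v x ((le_max_right _ _).trans_lt hv), add_zero]
  zero_mem' := ⟨0, fun v x _ => rfl⟩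
  smul_mem' := by
    rintro c F ⟨R, hR⟩
    exact ⟨R, fun v x hv => by rw [smul_apply, hR v x hv, smul_zero]⟩

lemma bandS_ext {F G : bandS} (h : ∀ p, F.1 p = G.1 p) : F = G :=
  Subtype.ext (DFunLike.ext _ _ h)

/-- A linear operator on `bandS` from its values at the individual functions. -/
def bandS.mk (T : (Pt → ℂ) → Pt → ℂ) (hT : ∀ F : bandS, ∃ G : bandS, ∀ p, G.1 p = T F.1 p)
    (hadd : ∀ (F G : bandS) p, T (fun q => F.1 q + G.1 q) p = T F.1 p + T G.1 p)
    (hsmul : ∀ (c : ℂ) (F : bandS) p, T (fun q => c * F.1 q) p = c * T F.1 p) :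
    bandS →ₗ[ℂ] bandS where
  toFun F := (hT F).choose
  map_add' F G := bandS_ext fun p => by
    rw [(hT (F + G)).choose_spec]
    change _ = (hT F).choose.1 p + (hT G).choose.1 p
    rw [(hT F).choose_spec, (hT G).choose_spec, ← hadd]; rfl
  map_smul' c F := bandS_ext fun p => by
    rw [(hT (c • F)).choose_spec]
    change _ = c * (hT F).choose.1 p
    rw [(hT F).choose_spec, ← hsmul]; rfl

lemma bandS.mk_apply (T : (Pt → ℂ) → Pt → ℂ) (hT hadd hsmul) (F : bandS) (p : Pt) :
    (bandS.mk T hT hadd hsmul F).1 p = T F.1 p := (hT F).choose_spec p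

/-- A smooth function of compact support which is one on `[-R, R]`. -/
lemma exists_cutoff (R : ℝ) : ∃ χ : ℝ → ℝ, ContDiff ℝ ∞ χ ∧ HasCompactSupport χ ∧
    ∀ v, |v| ≤ R → χ v = 1 := by
  let b : ContDiffBump (0 : ℝ) := ⟨|R| + 1, |R| + 2, by positivity, by linarith⟩
  refine ⟨b, b.contDiff, b.hasCompactSupport, fun v hv => b.one_of_mem_closedBall ?_⟩
  rw [mem_closedBall_zero_iff, Real.norm_eq_abs]
  exact hv.trans ((le_abs_self R).trans (by simp [b]))

/-- Multiplication by a smooth function of the frequency, whose growth plays no role since it may be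
cut off outside the support of `F`. -/
lemma exists_freq_mul {φ : ℝ → ℂ} (hφ : ContDiff ℝ ∞ φ) (F : bandS) :
    ∃ G : bandS, ∀ p, G.1 p = φ p.1 * F.1 p := by
  obtain ⟨R, hR⟩ := F.2
  obtain ⟨χ, hχ, hχc, hχ1⟩ := exists_cutoff R
  have ht : Function.HasTemperateGrowth fun p : Pt => (χ p.1 : ℂ) * φ p.1 := by
    have h1 : Function.HasTemperateGrowth fun v : ℝ => (χ v : ℂ) * φ v := by
      refine HasCompactSupport.hasTemperateGrowth ?_ ?_
      · exact (hχc.comp_left Complex.ofReal_zero).mul_right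
      · exact (Complex.ofRealCLM.contDiff.comp hχ).mul hφ
    exact h1.comp (ContinuousLinearMap.fst ℝ ℝ (Fin 3 → ℝ)).hasTemperateGrowth
  refine ⟨⟨SchwartzMap.smulLeftCLM ℂ (fun p : Pt => (χ p.1 : ℂ) * φ p.1) F.1, R, ?_⟩, ?_⟩
  · intro v x hv
    rw [SchwartzMap.smulLeftCLM_apply_apply ht, hR v x hv, smul_zero]
  · rintro ⟨v, x⟩
    change SchwartzMap.smulLeftCLM ℂ (fun p : Pt => (χ p.1 : ℂ) * φ p.1) F.1 (v, x) = _
    rw [SchwartzMap.smulLeftCLM_apply_apply ht]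
    by_cases hv : |v| ≤ R
    · simp [hχ1 v hv]
    · rw [hR v x (not_le.1 hv)]; simp

/-- Multiplication by `e^{-cv}`, the action of `e^{cP₀}` on partial Fourier transforms. -/
def expMul (c : ℝ) : bandS →ₗ[ℂ] bandS :=
  bandS.mk (fun F p => (Real.exp (-(c * p.1)) : ℂ) * F p)
    (fun F => exists_freq_mul (φ := fun v => (Real.exp (-(c * v)) : ℂ))
      (Complex.ofRealCLM.contDiff.comp
        (by fun_prop : ContDiff ℝ ∞ fun v => Real.exp (-(c * v)))) F)
    (fun F G p => mul_add _ _ _) (fun c F p => mul_left_comm _ _ _)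

lemma expMul_apply (c : ℝ) (F : bandS) (p : Pt) :
    (expMul c F).1 p = (Real.exp (-(c * p.1)) : ℂ) * F.1 p := bandS.mk_apply _ _ _ _ _ _

/-- Directional derivatives. -/
def lineD (m : Pt) : bandS →ₗ[ℂ] bandS :=
  bandS.mk (fun F p => fderiv ℝ F p m)
    (fun F => by
      refine ⟨⟨∂_{m} F.1, ?_⟩, fun p => SchwartzMap.lineDerivOp_apply_eq_fderiv m F.1 p⟩
      obtain ⟨R, hR⟩ := F.2
      refine ⟨R, fun v x hv => ?_⟩
      rw [SchwartzMap.lineDerivOp_apply_eq_fderiv]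
      have : (F.1 : Pt → ℂ) =ᶠ[𝓝 (v, x)] fun _ => 0 := by
        have ho : IsOpen {p : Pt | R < |p.1|} :=
          isOpen_lt continuous_const (continuous_abs.comp continuous_fst)
        filter_upwards [ho.mem_nhds hv] with p hp using hR p.1 p.2 hp
      rw [this.fderiv_eq]; simp)
    (fun F G p => by
      rw [fderiv_fun_add F.1.differentiableAt G.1.differentiableAt]; rfl)
    (fun c F p => by
      rw [fderiv_const_mul F.1.differentiableAt]; rfl)

lemma lineD_apply (m : Pt) (F : bandS) (p : Pt) :
    (lineD m F).1 p = fderiv ℝ F.1 p m := bandS.mk_apply _ _ _ _ _ _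

/-- Multiplication by the spatial coordinate `x^j`. -/
def mulX (j : Fin 3) : bandS →ₗ[ℂ] bandS :=
  bandS.mk (fun F p => (p.2 j : ℂ) * F p)
    (fun F => by
      have ht : Function.HasTemperateGrowth fun p : Pt => (p.2 j : ℂ) :=
        (Complex.ofRealCLM ∘L (ContinuousLinearMap.proj (R := ℝ) (φ := fun _ : Fin 3 => ℝ) j) ∘L
          (ContinuousLinearMap.snd ℝ ℝ (Fin 3 → ℝ))).hasTemperateGrowth
      obtain ⟨R, hR⟩ := F.2
      refine ⟨⟨SchwartzMap.smulLeftCLM ℂ (fun p : Pt => (p.2 j : ℂ)) F.1, R, ?_⟩, ?_⟩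
      · intro v x hv
        rw [SchwartzMap.smulLeftCLM_apply_apply ht, hR v x hv, smul_zero]
      · intro p
        exact SchwartzMap.smulLeftCLM_apply_apply ht F.1 p)
    (fun F G p => mul_add _ _ _) (fun c F p => mul_left_comm _ _ _)

lemma mulX_apply (j : Fin 3) (F : bandS) (p : Pt) :
    (mulX j F).1 p = (p.2 j : ℂ) * F.1 p := bandS.mk_apply _ _ _ _ _ _

/-- The involution `(v, x) ↦ (-v, e^{v/κ} x)`. -/
def flipPt (κ : ℝ) (p : Pt) : Pt := (-p.1, Real.exp (p.1 / κ) • p.2)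

lemma flipPt_flipPt (κ : ℝ) (p : Pt) : flipPt κ (flipPt κ p) = p := by
  refine Prod.ext (by simp [flipPt]) ?_
  simp only [flipPt]
  rw [smul_smul, ← Real.exp_add, neg_div, neg_add_cancel, Real.exp_zero, one_smul]

/-- The map `flipPt` is not temperate, but it may be changed outside the support of `F`. -/
lemma exists_comp_flipPt (κ : ℝ) (F : bandS) : ∃ G : bandS, ∀ p, G.1 p = F.1 (flipPt κ p) := by
  obtain ⟨R, hR⟩ := F.2
  obtain ⟨χ, hχ, hχc, hχ1⟩ := exists_cutoff R
  -- cut off the exponent, so that the map becomes temperate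
  set s : ℝ → ℝ := fun w => χ w * (w / κ) with hs
  have hsd : ContDiff ℝ ∞ s := hχ.mul (by fun_prop)
  have hsc : HasCompactSupport s := hχc.mul_right
  obtain ⟨S, hS⟩ : ∃ S, ∀ w, ‖s w‖ ≤ S := hsc.exists_bound_of_continuous hsd.continuous
  have hexp : Function.HasTemperateGrowth fun w => Real.exp (s w) := by
    have h1 : Function.HasTemperateGrowth fun w => Real.exp (s w) - 1 := by
      refine HasCompactSupport.hasTemperateGrowth ?_ ?_
      · exact hsc.comp_left (g := fun y => Real.exp y - 1) (by simp)
      · exact (Real.contDiff_exp.comp hsd).sub contDiff_const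
    have h2 := h1.add (Function.HasTemperateGrowth.const (1 : ℝ))
    refine (funext fun w => ?_ : _ = fun w => Real.exp (s w)) ▸ h2
    simp
  set g : Pt → Pt := fun p => (-p.1, Real.exp (s p.1) • p.2) with hg
  have hgt : g.HasTemperateGrowth := by
    have e : g = (fun p : Pt => ((-p.1, 0) : Pt)) + fun p : Pt => Real.exp (s p.1) • ((0, p.2) : Pt) := by
      funext p; simp [hg]
    rw [e]
    refine Function.HasTemperateGrowth.add ?_ (Function.HasTemperateGrowth.smul
      (f := fun p : Pt => Real.exp (s p.1)) (g := fun p : Pt => ((0, p.2) : Pt)) ?_ ?_)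
    · exact ((-(ContinuousLinearMap.fst ℝ ℝ (Fin 3 → ℝ))).prod
        (0 : Pt →L[ℝ] (Fin 3 → ℝ))).hasTemperateGrowth
    · exact hexp.comp (ContinuousLinearMap.fst ℝ ℝ (Fin 3 → ℝ)).hasTemperateGrowth
    · exact ((0 : Pt →L[ℝ] ℝ).prod (ContinuousLinearMap.snd ℝ ℝ (Fin 3 → ℝ))).hasTemperateGrowth
  have hup : ∃ (k : ℕ) (C : ℝ), ∀ x, ‖x‖ ≤ C * (1 + ‖g x‖) ^ k := by
    refine ⟨1, 1 + Real.exp S, fun p => ?_⟩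
    have hS0 : 0 < Real.exp S := Real.exp_pos S
    have h0 : 0 ≤ ‖g p‖ := norm_nonneg _
    have h1 : ‖p.1‖ ≤ ‖g p‖ := by
      simpa only [hg, norm_neg] using norm_fst_le (g p)
    have h2 : ‖p.2‖ ≤ Real.exp S * ‖g p‖ := by
      have h3 := norm_snd_le (g p)
      simp only [hg, norm_smul, Real.norm_of_nonneg (Real.exp_pos _).le] at h3
      have h4 : 1 ≤ Real.exp S * Real.exp (s p.1) := by
        rw [← Real.exp_add]
        exact Real.one_le_exp (by linarith [(abs_le.1 (hS p.1)).1])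
      calc ‖p.2‖ ≤ (Real.exp S * Real.exp (s p.1)) * ‖p.2‖ :=
            le_mul_of_one_le_left (norm_nonneg _) h4
        _ = Real.exp S * (Real.exp (s p.1) * ‖p.2‖) := by ring
        _ ≤ _ := by gcongr
    rw [pow_one, Prod.norm_def]
    refine max_le ?_ ?_ <;> nlinarith [mul_nonneg hS0.le h0]
  refine ⟨⟨SchwartzMap.compCLM ℂ hgt hup F.1, R, ?_⟩, ?_⟩
  · intro v x hv
    exact hR _ _ (by simpa using hv)
  · rintro ⟨v, x⟩
    change F.1 (g (v, x)) = _
    by_cases hv : |v| ≤ R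
    · simp [hg, flipPt, hs, hχ1 v hv]
    · simp only [hg, flipPt]
      rw [hR _ _ (by simpa using hv), hR _ _ (by simpa using hv)]

/-- Composition with `flipPt`. -/
def flipS (κ : ℝ) : bandS →ₗ[ℂ] bandS :=
  bandS.mk (fun F p => F (flipPt κ p)) (exists_comp_flipPt κ) (fun _ _ _ => rfl) (fun _ _ _ => rfl)

lemma flipS_apply (κ : ℝ) (F : bandS) (p : Pt) : (flipS κ F).1 p = F.1 (flipPt κ p) :=
  bandS.mk_apply _ _ _ _ _ _

lemma exists_conj (F : bandS) : ∃ G : bandS, ∀ p, G.1 p = (starRingEnd ℂ) (F.1 p) := by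
  obtain ⟨R, hR⟩ := F.2
  refine ⟨⟨SchwartzMap.postcompCLM (𝕜 := ℝ) (Complex.conjCLE : ℂ →L[ℝ] ℂ) F.1, R, ?_⟩,
    fun p => rfl⟩
  intro v x hv
  change (starRingEnd ℂ) (F.1 (v, x)) = 0
  rw [hR v x hv, map_zero]

/-- The involution on partial Fourier transforms. -/
def dagS (κ : ℝ) (F : bandS) : bandS := (exists_conj (flipS κ F)).choose

lemma dagS_apply (κ : ℝ) (F : bandS) (p : Pt) :
    (dagS κ F).1 p = (starRingEnd ℂ) (F.1 (flipPt κ p)) := by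
  rw [dagS, (exists_conj (flipS κ F)).choose_spec, flipS_apply]

end Band

/-! ### The partial inverse Fourier transform -/

section BandFn

open MeasureTheory Filter
open scoped ContDiff LineDeriv

/-- The function with partial Fourier transform `F`. -/
def bandFn (F : bandS) (p : Pt) : ℂ :=
  ∫ v : ℝ, F.1 (v, p.2) * Complex.exp (Complex.I * ((p.1 * v : ℝ) : ℂ))

lemma mem_schwartzC {f : Fn} : f ∈ schwartzC ↔ ∃ F : bandS, f = bandFn F := by
  constructor
  · rintro ⟨F, hF, h⟩
    exact ⟨⟨F, hF⟩, funext fun p => h p.1 p.2⟩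
  · rintro ⟨F, rfl⟩
    exact ⟨F.1, F.2, fun t x => rfl⟩

/-- The indicator function of `[-R, R]`. -/
def ival (R : ℝ) : ℝ → ℝ := Set.indicator (Set.Icc (-R) R) fun _ => 1

lemma ival_nonneg (R v : ℝ) : 0 ≤ ival R v := Set.indicator_nonneg (fun _ _ => zero_le_one) v

lemma ival_eq_one {R v : ℝ} (h : ¬ R < |v|) : ival R v = 1 :=
  Set.indicator_of_mem (s := Set.Icc (-R) R) (abs_le.1 (not_lt.1 h)) _

lemma integrable_ival (R : ℝ) : Integrable (ival R) :=
  (integrableOn_const (by simp)).integrable_indicator measurableSet_Icc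

lemma norm_exp_I_mul (r : ℝ) : ‖Complex.exp (Complex.I * (r : ℂ))‖ = 1 := by
  rw [mul_comm, Complex.norm_exp_ofReal_mul_I]

@[fun_prop]
lemma continuous_bandS (F : bandS) : Continuous F.1 := F.1.continuous

lemma bandS_bound (F : bandS) : ∃ R C : ℝ, 0 ≤ R ∧ 0 ≤ C ∧
    (∀ (v : ℝ) (x : Fin 3 → ℝ), R < |v| → F.1 (v, x) = 0) ∧
    (∀ p : Pt, ‖F.1 p‖ ≤ C) ∧
    ∀ (v : ℝ) (x : Fin 3 → ℝ), ‖F.1 (v, x)‖ ≤ ival R v * C := by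
  obtain ⟨R, hR⟩ := F.2
  have hC := SchwartzMap.norm_le_seminorm ℂ F.1
  have hC0 : 0 ≤ SchwartzMap.seminorm ℂ 0 0 F.1 := (norm_nonneg _).trans (hC 0)
  have hR' : ∀ (v : ℝ) (x : Fin 3 → ℝ), |R| < |v| → F.1 (v, x) = 0 := fun v x hv =>
    hR v x ((le_abs_self R).trans_lt hv)
  refine ⟨|R|, _, abs_nonneg R, hC0, hR', hC, ?_⟩
  intro v x
  by_cases hv : |R| < |v|
  · rw [hR' v x hv, norm_zero]; exact mul_nonneg (ival_nonneg _ _) hC0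
  · rw [ival_eq_one hv, one_mul]; exact hC _

lemma bandS_decay (F : bandS) : ∃ R C : ℝ, 0 ≤ C ∧ ∀ (v : ℝ) (x : Fin 3 → ℝ),
    ‖F.1 (v, x)‖ ≤ ival R v * (C * (1 + ‖x‖) ^ (-4 : ℝ)) := by
  obtain ⟨R, hR⟩ := F.2
  obtain ⟨C, hC⟩ : ∃ C : ℝ, ∀ p : Pt, (1 + ‖p‖) ^ 4 * ‖F.1 p‖ ≤ C := by
    have h := SchwartzMap.one_add_le_sup_seminorm_apply (𝕜 := ℂ) (m := (4, 0)) (k := 4) (n := 0)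
      le_rfl le_rfl F.1
    simp_rw [norm_iteratedFDeriv_zero] at h
    exact ⟨_, h⟩
  have hC0 : 0 ≤ C := (by positivity : 0 ≤ (1 + ‖(0 : Pt)‖) ^ 4 * ‖F.1 0‖).trans (hC 0)
  refine ⟨R, C, hC0, fun v x => ?_⟩
  by_cases hv : R < |v|
  · rw [hR v x hv, norm_zero]
    exact mul_nonneg (ival_nonneg _ _) (by positivity)
  · rw [ival_eq_one hv, one_mul, Real.rpow_neg (by positivity), ← div_eq_mul_inv,
      le_div_iff₀ (by positivity)]
    refine le_trans ?_ (hC (v, x))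
    rw [mul_comm]
    have : ‖x‖ ≤ ‖((v, x) : Pt)‖ := norm_snd_le (v, x)
    norm_cast
    gcongr

lemma integrable_bandFn (F : bandS) (p : Pt) :
    Integrable fun v : ℝ => F.1 (v, p.2) * Complex.exp (Complex.I * ((p.1 * v : ℝ) : ℂ)) := by
  obtain ⟨R, C, -, -, -, -, h⟩ := bandS_bound F
  refine ((integrable_ival R).mul_const C).mono' (by fun_prop) (ae_of_all _ fun v => ?_)
  rw [norm_mul, norm_exp_I_mul, mul_one]
  exact h v _

lemma bandFn_add (F G : bandS) : bandFn (F + G) = bandFn F + bandFn G := by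
  funext p
  rw [Pi.add_apply, bandFn, bandFn, bandFn, ← integral_add (integrable_bandFn F p)
    (integrable_bandFn G p)]
  refine integral_congr_ae (ae_of_all _ fun v => ?_)
  change (F.1 _ + G.1 _) * _ = _
  ring

lemma bandFn_smul (c : ℂ) (F : bandS) : bandFn (c • F) = c • bandFn F := by
  funext p
  rw [Pi.smul_apply, bandFn, bandFn, smul_eq_mul, ← integral_const_mul]
  refine integral_congr_ae (ae_of_all _ fun v => ?_)
  change (c * F.1 _) * _ = _
  ring

lemma bandFn_bound (F : bandS) : ∃ C, ∀ p, ‖bandFn F p‖ ≤ C := by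
  obtain ⟨R, C, -, -, -, -, h⟩ := bandS_bound F
  refine ⟨∫ v, ival R v * C, fun p => ?_⟩
  refine norm_integral_le_of_norm_le ((integrable_ival R).mul_const C) (ae_of_all _ fun v => ?_)
  rw [norm_mul, norm_exp_I_mul, mul_one]
  exact h v _

@[fun_prop]
lemma continuous_bandFn (F : bandS) : Continuous (bandFn F) := by
  obtain ⟨R, C, -, -, -, -, h⟩ := bandS_bound F
  refine continuous_of_dominated (bound := fun v => ival R v * C) (fun p => by fun_prop)
    (fun p => ae_of_all _ fun v => ?_) ((integrable_ival R).mul_const C)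
    (ae_of_all _ fun v => by fun_prop)
  rw [norm_mul, norm_exp_I_mul, mul_one]
  exact h v _

lemma hasDerivAt_exp_I (t v : ℝ) :
    HasDerivAt (fun v : ℝ => Complex.exp (Complex.I * ((t * v : ℝ) : ℂ)))
      (Complex.I * t * Complex.exp (Complex.I * ((t * v : ℝ) : ℂ))) v := by
  have h1 : HasDerivAt (fun v : ℝ => Complex.I * ((t * v : ℝ) : ℂ)) (Complex.I * t) v := by
    have := ((hasDerivAt_id v).const_mul t).ofReal_comp
    simpa using this.const_mul Complex.I
  refine h1.cexp.congr_deriv ?_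
  ring

/-- Differentiation in the frequency corresponds to multiplication by the time. -/
lemma bandFn_lineD_freq (F : bandS) (p : Pt) :
    bandFn (lineD (1, 0) F) p = -(Complex.I * p.1) * bandFn F p := by
  have hd : ∀ v : ℝ, HasDerivAt (fun v : ℝ => F.1 (v, p.2)) ((lineD (1, 0) F).1 (v, p.2)) v := by
    intro v
    rw [lineD_apply]
    exact F.1.differentiableAt.hasFDerivAt.comp_hasDerivAt v
      ((hasDerivAt_id v).prodMk (hasDerivAt_const v p.2))
  have h := integral_mul_deriv_eq_deriv_mul_of_integrable
    (u := fun v : ℝ => F.1 (v, p.2)) (u' := fun v : ℝ => (lineD (1, 0) F).1 (v, p.2))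
    (v := fun v : ℝ => Complex.exp (Complex.I * ((p.1 * v : ℝ) : ℂ)))
    (v' := fun v : ℝ => Complex.I * p.1 * Complex.exp (Complex.I * ((p.1 * v : ℝ) : ℂ)))
    (fun v _ => hd v) (fun v _ => hasDerivAt_exp_I p.1 v) ?_
    (integrable_bandFn (lineD (1, 0) F) p) (integrable_bandFn F p)
  · rw [bandFn, bandFn, ← neg_eq_iff_eq_neg.2 h, neg_mul, ← integral_const_mul]
    congr 1
    refine integral_congr_ae (ae_of_all _ fun v => ?_)
    ring
  · refine ((integrable_bandFn F p).const_mul (Complex.I * p.1)).congr (ae_of_all _ fun v => ?_)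
    simp only [Pi.mul_apply]; ring

/-- Decay in the time direction. -/
lemma bandFn_decay (F : bandS) : ∃ C, ∀ p, ‖bandFn F p‖ ≤ C * (1 + p.1 ^ 2)⁻¹ := by
  obtain ⟨C, hC⟩ := bandFn_bound (F + (-1 : ℂ) • lineD (1, 0) (lineD (1, 0) F))
  refine ⟨C, fun p => ?_⟩
  have h1 : bandFn (F + (-1 : ℂ) • lineD (1, 0) (lineD (1, 0) F)) p =
      ((1 + p.1 ^ 2 : ℝ) : ℂ) * bandFn F p := by
    rw [bandFn_add, bandFn_smul, Pi.add_apply, Pi.smul_apply, bandFn_lineD_freq,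
      bandFn_lineD_freq, smul_eq_mul]
    push_cast
    linear_combination (-(p.1 : ℂ) ^ 2 * bandFn F p) * Complex.I_mul_I
  have h2 : (0 : ℝ) < 1 + p.1 ^ 2 := by positivity
  have h3 := hC p
  rw [h1, norm_mul, Complex.norm_real, Real.norm_of_nonneg h2.le] at h3
  rw [← div_eq_mul_inv, le_div_iff₀ h2]
  linarith

lemma fderiv_bandS_eq_zero {F : bandS} {R : ℝ}
    (hR : ∀ (v : ℝ) (x : Fin 3 → ℝ), R < |v| → F.1 (v, x) = 0) {p : Pt} (hp : R < |p.1|) :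
    fderiv ℝ F.1 p = 0 := by
  have : (F.1 : Pt → ℂ) =ᶠ[𝓝 p] fun _ => 0 := by
    have ho : IsOpen {p : Pt | R < |p.1|} :=
      isOpen_lt continuous_const (continuous_abs.comp continuous_fst)
    filter_upwards [ho.mem_nhds hp] with q hq using hR q.1 q.2 hq
  rw [this.fderiv_eq]; simp

/-- Differentiation under the integral along a curve in space. -/
lemma hasDerivAt_bandFn (F : bandS) (t : ℝ) {γ γ' : ℝ → Fin 3 → ℝ}
    (hγ : ∀ s, HasDerivAt γ (γ' s) s) (hγ' : Continuous γ') (s₀ : ℝ) :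
    HasDerivAt (fun s => bandFn F (t, γ s))
      (∫ v : ℝ, fderiv ℝ F.1 (v, γ s₀) (0, γ' s₀) *
        Complex.exp (Complex.I * ((t * v : ℝ) : ℂ))) s₀ := by
  obtain ⟨R, C, -, -, hR, -, -⟩ := bandS_bound F
  obtain ⟨M, hM⟩ : ∃ M, ∀ s ∈ Metric.closedBall s₀ 1, ‖γ' s‖ ≤ M :=
    (isCompact_closedBall s₀ 1).exists_bound_of_continuousOn hγ'.continuousOn
  have hM0 : 0 ≤ M := (norm_nonneg _).trans (hM s₀ (by simp))
  set C₁ := SchwartzMap.seminorm ℝ 0 0 (SchwartzMap.fderivCLM ℝ Pt ℂ F.1) with hC₁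
  have hfd : ∀ p, ‖fderiv ℝ F.1 p‖ ≤ C₁ := fun p =>
    SchwartzMap.norm_le_seminorm ℝ (SchwartzMap.fderivCLM ℝ Pt ℂ F.1) p
  have hC0 : 0 ≤ C₁ := (norm_nonneg _).trans (hfd 0)
  have hγc : Continuous γ := continuous_iff_continuousAt.2 fun s => (hγ s).continuousAt
  have hfdc : Continuous (fderiv ℝ F.1) := (F.1.smooth ⊤).continuous_fderiv (by simp)
  refine (hasDerivAt_integral_of_dominated_loc_of_deriv_le (μ := volume)
    (F := fun s (v : ℝ) => F.1 (v, γ s) * Complex.exp (Complex.I * ((t * v : ℝ) : ℂ)))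
    (F' := fun s (v : ℝ) => fderiv ℝ F.1 (v, γ s) (0, γ' s) *
      Complex.exp (Complex.I * ((t * v : ℝ) : ℂ)))
    (bound := fun v => ival R v * (C₁ * M)) (x₀ := s₀) (s := Metric.closedBall s₀ 1)
    (Metric.closedBall_mem_nhds s₀ one_pos)
    (Eventually.of_forall fun s => by fun_prop)
    (integrable_bandFn F (t, γ s₀)) ?_
    (ae_of_all _ fun v s hs => ?_)
    ((integrable_ival R).mul_const _) (ae_of_all _ fun v s _ => ?_)).2
  · have : Continuous fun v : ℝ => fderiv ℝ F.1 (v, γ s₀) (0, γ' s₀) :=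
      (hfdc.comp (by fun_prop : Continuous fun v : ℝ => ((v, γ s₀) : Pt))).clm_apply
        continuous_const
    exact (this.mul (by fun_prop)).aestronglyMeasurable
  · rw [norm_mul, norm_exp_I_mul, mul_one]
    by_cases hv : R < |v|
    · rw [fderiv_bandS_eq_zero hR hv]
      simpa using mul_nonneg (ival_nonneg R v) (mul_nonneg hC0 hM0)
    · rw [ival_eq_one hv, one_mul]
      refine ((fderiv ℝ F.1 (v, γ s)).le_opNorm _).trans ?_
      have : ‖((0, γ' s) : Pt)‖ ≤ M := by
        rw [Prod.norm_def]
        exact max_le (by simpa using hM0) (hM s hs)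
      exact mul_le_mul (hfd _) this (norm_nonneg _) hC0
  · exact (F.1.differentiableAt.hasFDerivAt.comp_hasDerivAt s
      ((hasDerivAt_const s v).prodMk (hγ s))).mul_const _

lemma bandLimited_bandFn (F : bandS) (t : ℝ) (x : Fin 3 → ℝ) {h : ℝ → ℂ} (hh : ExpBdd h)
    (hc : Continuous h) :
    BandLimited fun w v => F.1 (w, x) * Complex.exp (Complex.I * ((t * w : ℝ) : ℂ)) * h v := by
  obtain ⟨R, C, hR0, hC0, hR, hC, -⟩ := bandS_bound F
  obtain ⟨C', m, hC', hm, hb⟩ := hh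
  refine ⟨by unfold Function.uncurry; fun_prop, R, C * C', m, hR0, by positivity, hm,
    fun w v hw => by rw [hR w x hw]; simp, fun w v => ?_⟩
  rw [norm_mul, norm_mul, norm_exp_I_mul, mul_one, mul_assoc]
  exact mul_le_mul (hC _) (hb v) (norm_nonneg _) hC0

lemma hasOsc_bandFn (F : bandS) (t : ℝ) (x : Fin 3 → ℝ) {h : ℝ → ℂ} (hh : ExpBdd h)
    (hc : Continuous h) :
    HasOsc (fun u v => bandFn F (t + u, x) * h v)
      (∫ w : ℝ, F.1 (w, x) * Complex.exp (Complex.I * ((t * w : ℝ) : ℂ)) * h w) := by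
  have e : (fun u v : ℝ => bandFn F (t + u, x) * h v) = fun u v : ℝ => ∫ w : ℝ,
      F.1 (w, x) * Complex.exp (Complex.I * ((t * w : ℝ) : ℂ)) * h v *
        Complex.exp (Complex.I * ((u * w : ℝ) : ℂ)) := by
    funext u v
    rw [bandFn, ← integral_mul_const]
    refine integral_congr_ae (ae_of_all _ fun w => ?_)
    have : Complex.exp (Complex.I * (((t + u) * w : ℝ) : ℂ)) =
        Complex.exp (Complex.I * ((t * w : ℝ) : ℂ)) *
          Complex.exp (Complex.I * ((u * w : ℝ) : ℂ)) := by
      rw [← Complex.exp_add]; congr 1; push_cast; ring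
    simp only [this]; ring
  rw [e]
  exact HasOsc.bandLimited (bandLimited_bandFn F t x hh hc)

lemma expBdd_of_bound {h : ℝ → ℂ} {C : ℝ} (hC : ∀ v, ‖h v‖ ≤ C) : ExpBdd h :=
  ⟨C, 0, (norm_nonneg _).trans (hC 0), le_rfl, fun v => by simpa using hC v⟩

/-- The involution in terms of partial Fourier transforms. -/
lemma dagFn_bandFn (κ : ℝ) (F : bandS) : dagFn κ (bandFn F) = bandFn (dagS κ F) := by
  obtain ⟨R, C, hR0, hC0, hR, hC, -⟩ := bandS_bound F
  funext ⟨t, x⟩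
  have hb : BandLimited fun w v => (starRingEnd ℂ) (F.1 (-w, Real.exp (v / κ) • x)) *
      Complex.exp (Complex.I * ((t * w : ℝ) : ℂ)) := by
    refine ⟨?_, R, C, 0, hR0, hC0, le_rfl, fun w v hw => ?_, fun w v => ?_⟩
    · unfold Function.uncurry
      exact (Complex.continuous_conj.comp (by fun_prop)).mul (by fun_prop)
    · rw [hR _ _ (by simpa using hw)]; simp
    · rw [norm_mul, norm_exp_I_mul, mul_one, RCLike.norm_conj]; simpa using hC _
  have h := (HasOsc.bandLimited hb).osc_eq
  rw [dagFn, bandFn]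
  simp_rw [dagS_apply, flipPt]
  refine Eq.trans ?_ h
  congr 1
  funext u v
  rw [bandFn, ← integral_conj, ← integral_neg_eq_self]
  refine integral_congr_ae (ae_of_all _ fun w => ?_)
  simp only [map_mul, ← Complex.exp_conj, Complex.conj_I, Complex.conj_ofReal]
  rw [mul_assoc, ← Complex.exp_add]
  congr 2
  push_cast; ring

lemma starProd_bandFn (κ : ℝ) (F G : bandS) (p : Pt) :
    starProd κ (bandFn F) (bandFn G) p = ∫ w : ℝ, F.1 (w, p.2) *
      Complex.exp (Complex.I * ((p.1 * w : ℝ) : ℂ)) *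
        bandFn G (p.1, Real.exp (w / κ) • p.2) := by
  obtain ⟨C, hC⟩ := bandFn_bound G
  exact (hasOsc_bandFn F p.1 p.2 (h := fun v => bandFn G (p.1, Real.exp (v / κ) • p.2))
    (expBdd_of_bound fun v => hC _) (by fun_prop)).osc_eq

/-- Fourier inversion in the time variable. -/
lemma integral_exp_mul_bandFn (G : bandS) (w : ℝ) (y : Fin 3 → ℝ) :
    ∫ t : ℝ, Complex.exp (Complex.I * ((t * w : ℝ) : ℂ)) * bandFn G (t, y) =
      2 * Real.pi * G.1 (-w, y) := by
  obtain ⟨C, hC⟩ := bandFn_decay G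
  have hpi := Real.pi_pos
  set g : ℝ → ℂ := fun v => G.1 (v, y) with hg
  have hgc : Continuous g := by rw [hg]; fun_prop
  have hgi : Integrable g := by
    have := integrable_bandFn G (0, y)
    simpa using this
  have hinv : ∀ s, FourierTransformInv.fourierInv g s = bandFn G (2 * Real.pi * s, y) := by
    intro s
    rw [Real.fourierInv_eq', bandFn]
    refine integral_congr_ae (ae_of_all _ fun v => ?_)
    simp only [hg, smul_eq_mul, RCLike.inner_apply, conj_trivial]
    rw [mul_comm]
    congr 2
    push_cast; ring
  have hfi : Integrable (FourierTransform.fourier g) := by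
    have e : FourierTransform.fourier g = fun s => bandFn G (-(2 * Real.pi * s), y) := by
      funext s
      have h1 := hinv (-s)
      rw [Real.fourierInv_eq_fourier_neg, neg_neg] at h1
      rw [h1]; congr 2; ring
    rw [e]
    have hcomp : Integrable fun s : ℝ => C * (1 + (2 * Real.pi * s) ^ 2)⁻¹ := by
      have := integrable_inv_one_add_sq.comp_mul_left' (show (2 * Real.pi) ≠ 0 by positivity)
      exact this.const_mul C
    refine hcomp.mono' ((by fun_prop : Continuous fun s : ℝ =>
      bandFn G (-(2 * Real.pi * s), y)).aestronglyMeasurable) (ae_of_all _ fun s => ?_)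
    simpa using hC (-(2 * Real.pi * s), y)
  have h := congrFun (hgc.fourier_fourierInv_eq hgi hfi) (-w)
  rw [Real.fourier_eq'] at h
  have hsub := Measure.integral_comp_mul_left
    (fun t : ℝ => Complex.exp (Complex.I * ((t * w : ℝ) : ℂ)) * bandFn G (t, y)) (2 * Real.pi)
  rw [abs_of_pos (by positivity)] at hsub
  have h2 : ∫ s : ℝ, Complex.exp (Complex.I * ((2 * Real.pi * s * w : ℝ) : ℂ)) *
      bandFn G (2 * Real.pi * s, y) = G.1 (-w, y) := by
    change _ = g (-w)
    rw [← h]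
    refine integral_congr_ae (ae_of_all _ fun s => ?_)
    simp only [hinv, smul_eq_mul, RCLike.inner_apply, conj_trivial]
    congr 2
    push_cast; ring
  rw [h2, Complex.real_smul] at hsub
  rw [hsub]
  push_cast
  rw [← mul_assoc, mul_inv_cancel₀ (by simp), one_mul]

/-- The pairing `(2π)⁻¹ ∫ f ⋆ g` in terms of partial Fourier transforms. -/
def beta (κ : ℝ) (F G : bandS) : ℂ := ∫ p : Pt, F.1 p * (flipS κ G).1 p

instance : (volume : Measure Pt).IsAddHaarMeasure := by
  rw [Measure.volume_eq_prod]; infer_instance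

lemma integrable_mul_bandS (F G : bandS) : Integrable fun p : Pt => F.1 p * G.1 p := by
  obtain ⟨-, C, -, -, -, hC, -⟩ := bandS_bound F
  exact G.1.integrable.bdd_mul (by fun_prop) (ae_of_all _ hC)

lemma integral_starProd (κ : ℝ) (F G : bandS) :
    Integrable (starProd κ (bandFn F) (bandFn G)) ∧
      ∫ p, starProd κ (bandFn F) (bandFn G) p = 2 * Real.pi * beta κ F G := by
  obtain ⟨R, C, hC0, hF⟩ := bandS_decay F
  obtain ⟨C', hG⟩ := bandFn_decay G
  set K : Pt → ℝ → ℂ := fun p w => F.1 (w, p.2) *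
      Complex.exp (Complex.I * ((p.1 * w : ℝ) : ℂ)) *
        bandFn G (p.1, Real.exp (w / κ) • p.2) with hK
  have hKc : Continuous (Function.uncurry K) := by
    rw [hK]; unfold Function.uncurry; fun_prop
  have hdec : Integrable fun x : Fin 3 → ℝ => C * (1 + ‖x‖) ^ (-4 : ℝ) :=
    (integrable_one_add_norm (by simp; norm_num)).const_mul C
  have hinv : Integrable fun t : ℝ => C' * (1 + t ^ 2)⁻¹ := integrable_inv_one_add_sq.const_mul C'
  have hbd : ∀ (t : ℝ) (x : Fin 3 → ℝ) (w : ℝ), ‖K (t, x) w‖ ≤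
      (C' * (1 + t ^ 2)⁻¹) * (C * (1 + ‖x‖) ^ (-4 : ℝ)) * ival R w := by
    intro t x w
    simp only [hK]
    rw [norm_mul, norm_mul, norm_exp_I_mul, mul_one]
    calc _ ≤ (ival R w * (C * (1 + ‖x‖) ^ (-4 : ℝ))) * (C' * (1 + t ^ 2)⁻¹) :=
          mul_le_mul (hF w x) (hG _) (norm_nonneg _)
            (mul_nonneg (ival_nonneg _ _) (by positivity))
      _ = _ := by ring
  have hKi : Integrable (Function.uncurry K) ((volume : Measure Pt).prod volume) := by
    refine ((hinv.mul_prod hdec).mul_prod (integrable_ival R)).mono' hKc.aestronglyMeasurable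
      (ae_of_all _ fun q => ?_)
    exact hbd q.1.1 q.1.2 q.2
  have hst : starProd κ (bandFn F) (bandFn G) = fun p => ∫ w, K p w :=
    funext fun p => starProd_bandFn κ F G p
  rw [hst]
  refine ⟨hKi.integral_prod_left, ?_⟩
  rw [integral_integral_swap hKi]
  have hw : ∀ w, ∫ p : Pt, K p w = ∫ x : Fin 3 → ℝ, 2 * Real.pi *
      (F.1 (w, x) * (flipS κ G).1 (w, x)) := by
    intro w
    have hi : Integrable (fun p : Pt => K p w) (volume.prod volume) := by
      refine ((hinv.mul_prod hdec).mul_const (ival R w)).mono'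
        (hKc.comp (by fun_prop : Continuous fun p : Pt => (p, w))).aestronglyMeasurable
        (ae_of_all _ fun p => hbd p.1 p.2 w)
    have := integral_prod_symm _ hi
    rw [Measure.volume_eq_prod, this]
    refine integral_congr_ae (ae_of_all _ fun x => ?_)
    simp only [hK, mul_assoc, flipS_apply, flipPt]
    rw [integral_const_mul, integral_exp_mul_bandFn]
    ring
  simp_rw [hw, integral_const_mul]
  congr 1
  rw [beta, Measure.volume_eq_prod,
    integral_prod _ (integrable_mul_bandS F (flipS κ G))]

end BandFn

/-! ### Translations on partial Fourier transforms -/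

section Translations

open MeasureTheory Filter
open scoped ContDiff

lemma beta_add_left (κ : ℝ) (F F' G : bandS) :
    beta κ (F + F') G = beta κ F G + beta κ F' G := by
  rw [beta, beta, beta, ← integral_add (integrable_mul_bandS _ _) (integrable_mul_bandS _ _)]
  exact integral_congr_ae (ae_of_all _ fun p => add_mul _ _ _)

lemma beta_smul_left (κ : ℝ) (c : ℂ) (F G : bandS) : beta κ (c • F) G = c * beta κ F G := by
  rw [beta, beta, ← integral_const_mul]
  exact integral_congr_ae (ae_of_all _ fun p => mul_assoc _ _ _)

lemma beta_add_right (κ : ℝ) (F G G' : bandS) :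
    beta κ F (G + G') = beta κ F G + beta κ F G' := by
  rw [beta, beta, beta, ← integral_add (integrable_mul_bandS _ _) (integrable_mul_bandS _ _),
    map_add]
  exact integral_congr_ae (ae_of_all _ fun p => mul_add _ _ _)

lemma beta_smul_right (κ : ℝ) (c : ℂ) (F G : bandS) : beta κ F (c • G) = c * beta κ F G := by
  rw [beta, beta, ← integral_const_mul, map_smul]
  exact integral_congr_ae (ae_of_all _ fun p => mul_left_comm _ _ _)

/-- `beta` as a bilinear form. -/
def betaL (κ : ℝ) : bandS →ₗ[ℂ] bandS →ₗ[ℂ] ℂ :=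
  LinearMap.mk₂ ℂ (beta κ) (beta_add_left κ) (beta_smul_left κ) (beta_add_right κ)
    (beta_smul_right κ)

/-- `flipPt` reverses the frequency. -/
lemma beta_expMul (κ c : ℝ) (F G : bandS) :
    beta κ (expMul c F) G = beta κ F (expMul (-c) G) := by
  rw [beta, beta]
  refine integral_congr_ae (ae_of_all _ fun p => ?_)
  simp only [flipS_apply, expMul_apply, flipPt, neg_mul_neg]
  ring

/-- The unit vector in the direction `x^j`. -/
def dirX (j : Fin 3) : Pt := (0, Pi.single j 1)

/-- The chain rule: the spatial derivative of `flipPt` is the dilation by `e^{v/κ}`. -/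
lemma fderiv_flipS (κ : ℝ) (G : bandS) (j : Fin 3) (p : Pt) :
    fderiv ℝ (flipS κ G).1 p (dirX j) =
      (flipS κ (expMul (1 / κ) (lineD (dirX j) G))).1 p := by
  have hline : HasDerivAt (fun s : ℝ => p + s • dirX j) (dirX j) 0 := by
    simpa using ((hasDerivAt_id (0 : ℝ)).smul_const (dirX j)).const_add p
  have h1 : HasDerivAt (fun s : ℝ => (flipS κ G).1 (p + s • dirX j))
      (fderiv ℝ (flipS κ G).1 p (dirX j)) 0 := by
    have := (flipS κ G).1.differentiableAt (x := p + (0 : ℝ) • dirX j)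
    have h := this.hasFDerivAt.comp_hasDerivAt 0 hline
    simpa [Function.comp_def] using h
  have hflip : ∀ s : ℝ, flipPt κ (p + s • dirX j) = flipPt κ p + s • Real.exp (p.1 / κ) • dirX j := by
    intro s
    simp only [flipPt, dirX]
    refine Prod.ext (by simp) ?_
    simp only [Prod.snd_add, Prod.fst_add, Prod.smul_fst, Prod.smul_snd, smul_zero, add_zero,
      smul_add]
    rw [smul_comm]
  have h2 : HasDerivAt (fun s : ℝ => (flipS κ G).1 (p + s • dirX j))
      (fderiv ℝ G.1 (flipPt κ p) (Real.exp (p.1 / κ) • dirX j)) 0 := by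
    simp_rw [flipS_apply, hflip]
    have hl : HasDerivAt (fun s : ℝ => flipPt κ p + s • Real.exp (p.1 / κ) • dirX j)
        (Real.exp (p.1 / κ) • dirX j) 0 := by
      simpa using ((hasDerivAt_id (0 : ℝ)).smul_const
        (Real.exp (p.1 / κ) • dirX j)).const_add (flipPt κ p)
    have := G.1.differentiableAt (x := flipPt κ p + (0 : ℝ) • Real.exp (p.1 / κ) • dirX j)
    have h := this.hasFDerivAt.comp_hasDerivAt 0 hl
    simpa [Function.comp_def] using h
  rw [h1.unique h2, flipS_apply, expMul_apply, lineD_apply, map_smul, Complex.real_smul]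
  congr 3
  simp only [flipPt]
  ring

/-- Integration by parts; the factor `e^{P₀/κ}` comes from the dilation in `flipPt`. -/
lemma beta_lineD (κ : ℝ) (j : Fin 3) (F G : bandS) :
    beta κ (lineD (dirX j) F) G = -beta κ F (expMul (1 / κ) (lineD (dirX j) G)) := by
  have h := integral_mul_fderiv_eq_neg_fderiv_mul_of_integrable (μ := (volume : Measure Pt))
    (f := F.1) (g := (flipS κ G).1) (v := dirX j) ?_ ?_ (integrable_mul_bandS F (flipS κ G))
    (fun p _ => F.1.differentiableAt) (fun p _ => (flipS κ G).1.differentiableAt)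
  · simp_rw [fderiv_flipS, ← lineD_apply] at h
    rw [beta, beta, h, neg_neg]
  · simp_rw [← lineD_apply]
    exact integrable_mul_bandS _ _
  · simp_rw [fderiv_flipS]
    exact integrable_mul_bandS _ _

lemma expMul_expMul (c d : ℝ) (F : bandS) : expMul c (expMul d F) = expMul (c + d) F := by
  refine bandS_ext fun p => ?_
  rw [expMul_apply, expMul_apply, expMul_apply, ← mul_assoc, ← Complex.ofReal_mul, ← Real.exp_add]
  congr 3
  ring

lemma expMul_zero (F : bandS) : expMul 0 F = F := by
  refine bandS_ext fun p => ?_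
  simp [expMul_apply]

lemma lineD_comm (m m' : Pt) (F : bandS) : lineD m (lineD m' F) = lineD m' (lineD m F) := by
  refine bandS_ext fun p => ?_
  have hd : Differentiable ℝ (fderiv ℝ F.1) :=
    ((F.1.smooth ⊤).fderiv_right (m := 1) (by norm_cast)).differentiable (by simp)
  have e : ∀ m : Pt, ((lineD m F).1 : Pt → ℂ) = fun p => fderiv ℝ F.1 p m :=
    fun m => funext fun p => lineD_apply m F p
  have hs : IsSymmSndFDerivAt ℝ F.1 p :=
    (F.1.smooth ⊤).contDiffAt.isSymmSndFDerivAt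
      (by simpa using WithTop.coe_le_coe.2 (le_top : (2 : ℕ∞) ≤ ⊤))
  rw [lineD_apply, lineD_apply, e, e, fderiv_clm_apply (hd p) (by fun_prop),
    fderiv_clm_apply (hd p) (by fun_prop)]
  simpa using hs m m'

lemma expMul_lineD (c : ℝ) (j : Fin 3) (F : bandS) :
    expMul c (lineD (dirX j) F) = lineD (dirX j) (expMul c F) := by
  refine bandS_ext fun p => ?_
  have e : ((expMul c F).1 : Pt → ℂ) = fun p => (Real.exp (-(c * p.1)) : ℂ) * F.1 p :=
    funext fun p => expMul_apply c F p
  have hline : HasDerivAt (fun s : ℝ => p + s • dirX j) (dirX j) 0 := by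
    simpa using ((hasDerivAt_id (0 : ℝ)).smul_const (dirX j)).const_add p
  have key : ∀ H : bandS, HasDerivAt (fun s : ℝ => H.1 (p + s • dirX j))
      (fderiv ℝ H.1 p (dirX j)) 0 := by
    intro H
    have := H.1.differentiableAt (x := p + (0 : ℝ) • dirX j)
    have h := this.hasFDerivAt.comp_hasDerivAt 0 hline
    simpa [Function.comp_def] using h
  rw [expMul_apply, lineD_apply, lineD_apply]
  refine ((key F).const_mul (Real.exp (-(c * p.1)) : ℂ)).unique ?_
  refine (key (expMul c F)).congr_of_eventuallyEq (Eventually.of_forall fun s => ?_)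
  simp [expMul_apply, dirX]

end Translations

/-! ### Polynomials plus Schwartz functions, and the ring of translations -/

section Rep

/-- Pairs of a polynomial in the coordinates and a partial Fourier transform, representing the
elements of `algA`. -/
abbrev Rep : Type := MvPolynomial (Fin 4) ℂ × bandS

/-- The translation `x⁰ ↦ x⁰ + ic` on polynomials. -/
def shiftP (c : ℝ) : MvPolynomial (Fin 4) ℂ →ₐ[ℂ] MvPolynomial (Fin 4) ℂ :=
  MvPolynomial.aeval fun μ => MvPolynomial.X μ + if μ = 0 then MvPolynomial.C (Complex.I * c) else 0

lemma shiftP_shiftP (c d : ℝ) (q : MvPolynomial (Fin 4) ℂ) :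
    shiftP c (shiftP d q) = shiftP (c + d) q := by
  rw [← AlgHom.comp_apply]
  congr 1
  refine MvPolynomial.algHom_ext fun μ => ?_
  by_cases hμ : μ = 0
  · simp [shiftP, hμ, mul_add, add_assoc]
  · simp [shiftP, hμ]

lemma shiftP_zero (q : MvPolynomial (Fin 4) ℂ) : shiftP 0 q = q := by
  have : shiftP 0 = AlgHom.id ℂ _ := by
    refine MvPolynomial.algHom_ext fun μ => ?_
    simp [shiftP]
  rw [this]; rfl

lemma pderiv_comm (i j : Fin 4) (q : MvPolynomial (Fin 4) ℂ) :
    MvPolynomial.pderiv i (MvPolynomial.pderiv j q) =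
      MvPolynomial.pderiv j (MvPolynomial.pderiv i q) := by
  have h : ⁅MvPolynomial.pderiv (R := ℂ) i, MvPolynomial.pderiv (R := ℂ) j⁆ = 0 := by
    refine MvPolynomial.derivation_ext fun μ => ?_
    rw [Derivation.commutator_apply, MvPolynomial.pderiv_X, MvPolynomial.pderiv_X,
      Pi.single_apply, Pi.single_apply]
    split_ifs <;> simp
  have := congrArg (fun D => D q) h
  simp only [Derivation.commutator_apply] at this
  exact sub_eq_zero.1 this

lemma shiftP_pderiv (c : ℝ) (j : Fin 3) (q : MvPolynomial (Fin 4) ℂ) :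
    shiftP c (MvPolynomial.pderiv j.succ q) = MvPolynomial.pderiv j.succ (shiftP c q) := by
  induction q using MvPolynomial.induction_on with
  | C a => simp [shiftP]
  | add p q hp hq => simp [hp, hq]
  | mul_X p μ hp =>
    have h1 : MvPolynomial.pderiv j.succ (shiftP c (MvPolynomial.X μ)) =
        shiftP c (MvPolynomial.pderiv j.succ (MvPolynomial.X μ)) := by
      by_cases hμ : μ = 0
      · subst hμ
        simp [shiftP, MvPolynomial.pderiv_X, (Fin.succ_ne_zero j).symm]
      · by_cases hj : μ = j.succ <;> simp [shiftP, MvPolynomial.pderiv_X, hμ, hj]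
    rw [MvPolynomial.pderiv_mul, map_add, map_mul, map_mul, map_mul, MvPolynomial.pderiv_mul, hp, h1]

/-- The operator `e^{cP₀}`: since `P₀ = i ∂₀`, it translates `x⁰` by `ic`. -/
def expR (c : ℝ) : Module.End ℂ Rep := LinearMap.prodMap (shiftP c).toLinearMap (expMul c)

/-- The operator `P_j`. -/
def momR (j : Fin 3) : Module.End ℂ Rep :=
  (-Complex.I) • LinearMap.prodMap (MvPolynomial.pderiv j.succ).toLinearMap (lineD (dirX j))

lemma expR_mul (c d : ℝ) : expR c * expR d = expR (c + d) := by
  refine LinearMap.ext fun x => Prod.ext ?_ ?_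
  · exact shiftP_shiftP c d x.1
  · exact expMul_expMul c d x.2

lemma expR_zero : expR 0 = 1 := by
  refine LinearMap.ext fun x => Prod.ext ?_ ?_
  · exact shiftP_zero x.1
  · exact expMul_zero x.2

lemma expR_apply (c : ℝ) (x : Rep) : expR c x = (shiftP c x.1, expMul c x.2) := rfl

lemma momR_apply (j : Fin 3) (x : Rep) : momR j x =
    ((-Complex.I) • MvPolynomial.pderiv j.succ x.1, (-Complex.I) • lineD (dirX j) x.2) := rfl

lemma expR_momR (c : ℝ) (j : Fin 3) : expR c * momR j = momR j * expR c := by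
  refine LinearMap.ext fun x => ?_
  rw [Module.End.mul_apply, Module.End.mul_apply, expR_apply, momR_apply, momR_apply, expR_apply]
  refine Prod.ext ?_ ?_
  · simp only [map_smul, shiftP_pderiv]
  · simp only [map_smul, expMul_lineD]

lemma momR_comm (j k : Fin 3) : momR j * momR k = momR k * momR j := by
  refine LinearMap.ext fun x => ?_
  simp only [Module.End.mul_apply, momR_apply]
  refine Prod.ext ?_ ?_
  · simp only [Derivation.map_smul, pderiv_comm j.succ k.succ]
  · simp only [map_smul, lineD_comm (dirX j) (dirX k)]

/-- The operators `e^{cP₀}` and `P_j`. -/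
def opGen : Set (Module.End ℂ Rep) := Set.range expR ∪ Set.range momR

lemma opGen_comm : ∀ a ∈ opGen, ∀ b ∈ opGen, a * b = b * a := by
  rintro _ (⟨c, rfl⟩ | ⟨j, rfl⟩) _ (⟨d, rfl⟩ | ⟨k, rfl⟩)
  · rw [expR_mul, expR_mul, add_comm]
  · exact expR_momR c k
  · exact (expR_momR d j).symm
  · exact momR_comm j k

instance : IsMulCommutative (Algebra.adjoin ℂ opGen) :=
  Algebra.isMulCommutative_adjoin ℂ opGen_comm

/-- The commutative ring of translation operators. -/
def OpRing : Type := Algebra.adjoin ℂ opGen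

open scoped IsMulCommutative in
instance : CommRing OpRing := inferInstanceAs (CommRing (Algebra.adjoin ℂ opGen))

instance : Algebra ℂ OpRing := inferInstanceAs (Algebra ℂ (Algebra.adjoin ℂ opGen))

instance : Module OpRing Rep := inferInstanceAs (Module (Algebra.adjoin ℂ opGen) Rep)

/-- `e^{cP₀}` in the ring of translations. -/
def opE (c : ℝ) : OpRing := ⟨expR c, Algebra.subset_adjoin (Or.inl ⟨c, rfl⟩)⟩

/-- `P_j` in the ring of translations. -/
def opP (j : Fin 3) : OpRing := ⟨momR j, Algebra.subset_adjoin (Or.inr ⟨j, rfl⟩)⟩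

lemma opE_mul (c d : ℝ) : opE c * opE d = opE (c + d) := Subtype.ext (expR_mul c d)

lemma opE_zero : opE 0 = 1 := Subtype.ext expR_zero

lemma opE_smul (c : ℝ) (x : Rep) : opE c • x = expR c x := rfl

lemma opP_smul (j : Fin 3) (x : Rep) : opP j • x = momR j x := rfl

lemma algebraMap_opRing_smul (c : ℂ) (x : Rep) : algebraMap ℂ OpRing c • x = c • x := rfl

end Rep

/-! ### The functions in the algebra, and the star product on them -/

section EvalRep

open MeasureTheory Filter

/-- The function represented by a polynomial and a partial Fourier transform. -/
def evalRep : Rep →ₗ[ℂ] Fn where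
  toFun x p := MvPolynomial.eval (fun μ => coord μ p) x.1 + bandFn x.2 p
  map_add' x y := by
    funext p
    simp only [Prod.fst_add, Prod.snd_add, map_add, bandFn_add, Pi.add_apply]
    ring
  map_smul' c x := by
    funext p
    simp only [Prod.smul_fst, Prod.smul_snd, MvPolynomial.smul_eval, bandFn_smul, Pi.smul_apply,
      smul_eq_mul, RingHom.id_apply]
    ring

lemma evalRep_apply (x : Rep) (p : Pt) :
    evalRep x p = MvPolynomial.eval (fun μ => coord μ p) x.1 + bandFn x.2 p := rfl

lemma evalRep_band (F : bandS) : evalRep (0, F) = bandFn F := by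
  funext p
  simp [evalRep_apply]

lemma bandFn_zero : bandFn 0 = 0 := by
  funext p
  simp [bandFn]

lemma mem_algA {f : Fn} : f ∈ algA ↔ ∃ x : Rep, f = evalRep x := by
  constructor
  · rintro ⟨q, s, hs, h⟩
    obtain ⟨F, rfl⟩ := mem_schwartzC.1 hs
    exact ⟨(q, F), funext h⟩
  · rintro ⟨x, rfl⟩
    exact ⟨x.1, bandFn x.2, mem_schwartzC.2 ⟨x.2, rfl⟩, fun p => rfl⟩

/-- The constant `c`. -/
def constRep (c : ℂ) : Rep := (MvPolynomial.C c, 0)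

/-- The coordinate `x^μ`. -/
def coordRep (μ : Fin 4) : Rep := (MvPolynomial.X μ, 0)

lemma evalRep_constRep (c : ℂ) : evalRep (constRep c) = c • (1 : Fn) := by
  funext p
  simp [evalRep_apply, constRep, bandFn_zero]

lemma evalRep_one : evalRep (constRep 1) = 1 := by rw [evalRep_constRep, one_smul]

lemma evalRep_coordRep (μ : Fin 4) : evalRep (coordRep μ) = coord μ := by
  funext p
  simp [evalRep_apply, coordRep, bandFn_zero]

lemma coord_zero (p : Pt) : coord 0 p = (p.1 : ℂ) := rfl

lemma coord_succ (j : Fin 3) (p : Pt) : coord j.succ p = (p.2 j : ℂ) := rfl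

/-- The chain rule for polynomials. -/
lemma hasDerivAt_eval {c c' : ℝ → Fin 4 → ℂ} {s : ℝ} (hc : ∀ μ, HasDerivAt (fun s => c s μ) (c' s μ) s)
    (q : MvPolynomial (Fin 4) ℂ) :
    HasDerivAt (fun s => MvPolynomial.eval (c s) q)
      (∑ μ, c' s μ * MvPolynomial.eval (c s) (MvPolynomial.pderiv μ q)) s := by
  induction q using MvPolynomial.induction_on with
  | C a => simpa using hasDerivAt_const s a
  | add p q hp hq =>
    simp only [map_add, mul_add, Finset.sum_add_distrib]
    exact hp.add hq
  | mul_X p ν hp =>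
    simp only [map_mul, MvPolynomial.eval_X]
    refine (hp.mul (hc ν)).congr_deriv ?_
    simp only [MvPolynomial.pderiv_mul, map_add, map_mul, MvPolynomial.eval_X, mul_add,
      Finset.sum_add_distrib, MvPolynomial.pderiv_X, Pi.single_apply]
    rw [Finset.sum_mul]
    congr 1
    · exact Finset.sum_congr rfl fun μ _ => by ring
    · simp [mul_comm]

/-- The spatial derivative in the direction `x^j`. -/
def gradR (j : Fin 3) : Module.End ℂ Rep :=
  LinearMap.prodMap (MvPolynomial.pderiv j.succ).toLinearMap (lineD (dirX j))

lemma gradR_apply (j : Fin 3) (x : Rep) :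
    gradR j x = (MvPolynomial.pderiv j.succ x.1, lineD (dirX j) x.2) := rfl

/-- Derivative along a curve in space. -/
lemma hasDerivAt_evalRep (x : Rep) (t : ℝ) {γ γ' : ℝ → Fin 3 → ℝ}
    (hγ : ∀ s, HasDerivAt γ (γ' s) s) (hγ' : Continuous γ') (s : ℝ) :
    HasDerivAt (fun s => evalRep x (t, γ s))
      (∑ j, (γ' s j : ℂ) * evalRep (gradR j x) (t, γ s)) s := by
  have h1 : HasDerivAt (fun s => MvPolynomial.eval (fun μ => coord μ (t, γ s)) x.1)
      (∑ j : Fin 3, (γ' s j : ℂ) *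
        MvPolynomial.eval (fun μ => coord μ (t, γ s)) (MvPolynomial.pderiv j.succ x.1)) s := by
    refine (hasDerivAt_eval (c := fun s μ => coord μ (t, γ s))
      (c' := fun s => Fin.cons 0 fun j => ((γ' s j : ℝ) : ℂ)) (fun μ => ?_) x.1).congr_deriv ?_
    · refine Fin.cases ?_ (fun j => ?_) μ
      · simpa [coord_zero] using hasDerivAt_const s (t : ℂ)
      · simpa [coord_succ] using ((hasDerivAt_pi.1 (hγ s)) j).ofReal_comp
    · rw [Fin.sum_univ_succ]; simp
  refine (h1.add (hasDerivAt_bandFn x.2 t hγ hγ' s)).congr_deriv ?_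
  simp only [evalRep_apply, gradR_apply, mul_add, Finset.sum_add_distrib]
  congr 1
  simp only [bandFn, ← integral_const_mul]
  rw [← integral_finsetSum _ fun j _ => (integrable_bandFn (lineD (dirX j) x.2) (t, γ s)).const_mul _]
  refine integral_congr_ae (ae_of_all _ fun v => ?_)
  have e : ((0, γ' s) : Pt) = ∑ j, γ' s j • dirX j := by
    refine Prod.ext (by simp [dirX, Prod.fst_sum]) ?_
    rw [Prod.snd_sum]
    funext i
    simp [dirX, Finset.sum_apply, Pi.single_apply]
  simp only [e, map_sum, map_smul, Finset.sum_mul, lineD_apply, Complex.real_smul, mul_assoc]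

/-- Multiplication by `x^j`. -/
def coordMul (j : Fin 3) : Module.End ℂ Rep :=
  LinearMap.prodMap (LinearMap.mulLeft ℂ (MvPolynomial.X j.succ)) (mulX j)

lemma evalRep_coordMul (j : Fin 3) (x : Rep) (p : Pt) :
    evalRep (coordMul j x) p = p.2 j * evalRep x p := by
  have h : bandFn (mulX j x.2) p = p.2 j * bandFn x.2 p := by
    rw [bandFn, bandFn, ← integral_const_mul]
    refine integral_congr_ae (ae_of_all _ fun v => ?_)
    simp only [mulX_apply, mul_assoc]
  simp only [evalRep_apply, coordMul, LinearMap.prodMap_apply, LinearMap.mulLeft_apply, map_mul,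
    MvPolynomial.eval_X, h, coord_succ, mul_add]

/-- `κ⁻¹ Σ_j x^j ∂_j`, the generator of the dilations `x ↦ e^{v/κ} x`. -/
def dilR (κ : ℝ) : Module.End ℂ Rep := ((κ : ℂ)⁻¹) • ∑ j, coordMul j * gradR j

lemma evalRep_dilR (κ : ℝ) (x : Rep) (p : Pt) :
    evalRep (dilR κ x) p = (κ : ℂ)⁻¹ * ∑ j, p.2 j * evalRep (gradR j x) p := by
  simp only [dilR, LinearMap.smul_apply, LinearMap.sum_apply, map_smul, map_sum, Pi.smul_apply,
    Finset.sum_apply, smul_eq_mul, Module.End.mul_apply, evalRep_coordMul]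

lemma hasDerivAt_dilation (κ : ℝ) (x : Rep) (p : Pt) (v : ℝ) :
    HasDerivAt (fun v => evalRep x (p.1, Real.exp (v / κ) • p.2))
      (evalRep (dilR κ x) (p.1, Real.exp (v / κ) • p.2)) v := by
  have h1 : ∀ s, HasDerivAt (fun s => Real.exp (s / κ) • p.2) ((Real.exp (s / κ) * (1 / κ)) • p.2) s :=
    fun s => (((hasDerivAt_id s).div_const κ).exp).smul_const p.2
  refine (hasDerivAt_evalRep x p.1 h1 (by fun_prop) v).congr_deriv ?_
  rw [evalRep_dilR, Finset.mul_sum]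
  refine Finset.sum_congr rfl fun j _ => ?_
  simp only [Pi.smul_apply, smul_eq_mul]
  push_cast
  ring

lemma expBdd_exp (c : ℝ) : ExpBdd fun v => ((Real.exp (c * v) : ℝ) : ℂ) :=
  ⟨1, |c|, zero_le_one, abs_nonneg c, fun v => by
    rw [Complex.norm_real, Real.norm_of_nonneg (Real.exp_pos _).le, one_mul, ← abs_mul]
    exact Real.exp_le_exp.2 (le_abs_self _)⟩

lemma expBdd_dilation (κ : ℝ) (x : Rep) (p : Pt) :
    ExpBdd fun v => evalRep x (p.1, Real.exp (v / κ) • p.2) := by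
  obtain ⟨C, hC⟩ := bandFn_bound x.2
  refine ExpBdd.add ?_ (expBdd_of_bound fun v => hC _)
  induction x.1 using MvPolynomial.induction_on with
  | C a => simpa using ExpBdd.const a
  | add p q hp hq => simpa using hp.add hq
  | mul_X q μ hq =>
    simp only [map_mul, MvPolynomial.eval_X]
    refine hq.mul ?_
    refine Fin.cases ?_ (fun j => ?_) μ
    · exact ExpBdd.const (p.1 : ℂ)
    · have := (expBdd_exp κ⁻¹).mul (ExpBdd.const (p.2 j))
      refine (congrArg ExpBdd (funext fun v => ?_)).mp this
      rw [← div_eq_inv_mul, ← Complex.ofReal_mul]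
      rfl

lemma expSmooth_dilation (κ : ℝ) (x : Rep) (p : Pt) :
    ExpSmooth fun k v => evalRep ((dilR κ ^ k) x) (p.1, Real.exp (v / κ) • p.2) where
  deriv k v := by
    rw [pow_succ', Module.End.mul_apply]
    exact hasDerivAt_dilation κ _ p v
  bdd k := expBdd_dilation κ _ p

lemma expSmooth_exp (c : ℝ) :
    ExpSmooth fun k v => (c : ℂ) ^ k * ((Real.exp (c * v) : ℝ) : ℂ) where
  deriv k v := by
    have h : HasDerivAt (fun v => Real.exp (c * v)) (Real.exp (c * v) * c) v := by
      simpa using ((hasDerivAt_id v).const_mul c).exp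
    refine (h.ofReal_comp.const_mul ((c : ℂ) ^ k)).congr_deriv ?_
    push_cast; ring
  bdd k := (ExpBdd.const _).mul (expBdd_exp c)

/-- The polynomial `u ↦ q(t + u, x)`. -/
def timePoly (p : Pt) : MvPolynomial (Fin 4) ℂ →ₐ[ℂ] Polynomial ℂ :=
  MvPolynomial.aeval fun μ => Polynomial.C (coord μ p) + if μ = 0 then Polynomial.X else 0

lemma eval_timePoly (p : Pt) (q : MvPolynomial (Fin 4) ℂ) (u : ℝ) :
    (timePoly p q).eval (u : ℂ) = MvPolynomial.eval (fun μ => coord μ (p.1 + u, p.2)) q := by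
  induction q using MvPolynomial.induction_on with
  | C a => simp [timePoly]
  | add p q hp hq => simp [hp, hq]
  | mul_X q μ hq =>
    simp only [map_mul, Polynomial.eval_mul, hq, MvPolynomial.eval_X]
    congr 1
    refine Fin.cases ?_ (fun j => ?_) μ <;> simp [timePoly, coord_zero, coord_succ]

/-- `timePoly` at the complex time `ic`. -/
lemma eval_shiftP (c : ℝ) (p : Pt) (q : MvPolynomial (Fin 4) ℂ) :
    MvPolynomial.eval (fun μ => coord μ p) (shiftP c q) = (timePoly p q).eval (Complex.I * c) := by
  induction q using MvPolynomial.induction_on with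
  | C a => simp [timePoly, shiftP]
  | add p q hp hq => simp [hp, hq]
  | mul_X q μ hq =>
    simp only [map_mul, Polynomial.eval_mul, hq]
    congr 1
    refine Fin.cases ?_ (fun j => ?_) μ <;> simp [timePoly, shiftP, coord_zero, coord_succ]

/-- The oscillatory integral of `f(t+u, x) h(v)`. -/
lemma hasOsc_evalRep (x : Rep) (p : Pt) {d : ℕ → ℝ → ℂ} (hd : ExpSmooth d) :
    HasOsc (fun u v => evalRep x (p.1 + u, p.2) * d 0 v)
      ((∑ k ∈ Finset.range ((timePoly p x.1).natDegree + 1),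
          (timePoly p x.1).coeff k * ((-Complex.I) ^ k * d k 0)) +
        ∫ w : ℝ, x.2.1 (w, p.2) * Complex.exp (Complex.I * ((p.1 * w : ℝ) : ℂ)) * d 0 w) := by
  have h := (HasOsc.polynomial_mul hd (timePoly p x.1)).add
    (hasOsc_bandFn x.2 p.1 p.2 (hd.bdd 0) (hd.continuous 0))
  simpa only [eval_timePoly, ← add_mul, ← evalRep_apply] using h

/-- The integral defining the star product converges on `algA`. -/
lemma hasOsc_starProd (κ : ℝ) (x y : Rep) (p : Pt) :
    HasOsc (fun u v => evalRep x (p.1 + u, p.2) * evalRep y (p.1, Real.exp (v / κ) • p.2))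
      (starProd κ (evalRep x) (evalRep y) p) := by
  have h := hasOsc_evalRep x p (expSmooth_dilation κ y p)
  have e := h.osc_eq
  rw [← e] at h
  exact h

lemma starProd_add_left (κ : ℝ) (x x' y : Rep) : starProd κ (evalRep (x + x')) (evalRep y) =
    starProd κ (evalRep x) (evalRep y) + starProd κ (evalRep x') (evalRep y) := by
  funext p
  refine Eq.trans ?_ ((hasOsc_starProd κ x y p).add (hasOsc_starProd κ x' y p)).osc_eq
  simp only [starProd, map_add, Pi.add_apply, add_mul]

lemma starProd_smul_left (κ : ℝ) (c : ℂ) (x y : Rep) : starProd κ (evalRep (c • x)) (evalRep y) =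
    c • starProd κ (evalRep x) (evalRep y) := by
  funext p
  refine Eq.trans ?_ ((hasOsc_starProd κ x y p).const_mul c).osc_eq
  simp only [starProd, map_smul, Pi.smul_apply, smul_eq_mul, mul_assoc]

lemma starProd_add_right (κ : ℝ) (x y y' : Rep) : starProd κ (evalRep x) (evalRep (y + y')) =
    starProd κ (evalRep x) (evalRep y) + starProd κ (evalRep x) (evalRep y') := by
  funext p
  refine Eq.trans ?_ ((hasOsc_starProd κ x y p).add (hasOsc_starProd κ x y' p)).osc_eq
  simp only [starProd, map_add, Pi.add_apply, mul_add]

lemma starProd_smul_right (κ : ℝ) (c : ℂ) (x y : Rep) : starProd κ (evalRep x) (evalRep (c • y)) =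
    c • starProd κ (evalRep x) (evalRep y) := by
  funext p
  refine Eq.trans ?_ ((hasOsc_starProd κ x y p).const_mul c).osc_eq
  simp only [starProd, map_smul, Pi.smul_apply, smul_eq_mul, mul_left_comm]

/-- The star product as a bilinear map. -/
def starL (κ : ℝ) : Rep →ₗ[ℂ] Rep →ₗ[ℂ] Fn :=
  LinearMap.mk₂ ℂ (fun x y => starProd κ (evalRep x) (evalRep y)) (starProd_add_left κ)
    (starProd_smul_left κ) (starProd_add_right κ) (starProd_smul_right κ)

lemma starL_apply (κ : ℝ) (x y : Rep) : starL κ x y = starProd κ (evalRep x) (evalRep y) := rfl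

/-- On the polynomial part, `∑_k c_k (-i)^k (-c)^k` is the value of `∑_k c_k u^k` at `u = ic`. -/
lemma expP0_evalRep (c : ℝ) (x : Rep) : expP0 c (evalRep x) = evalRep (expR c x) := by
  funext p
  have h := (hasOsc_evalRep x p (expSmooth_exp (-c))).osc_eq
  simp only [pow_zero, one_mul] at h
  have e : expP0 c (evalRep x) p =
      osc fun u v => evalRep x (p.1 + u, p.2) * ((Real.exp (-c * v) : ℝ) : ℂ) := by
    simp only [expP0, neg_mul]
  rw [e, h, evalRep_apply, expR_apply, eval_shiftP, Polynomial.eval_eq_sum_range, bandFn]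
  congr 1
  · refine Finset.sum_congr rfl fun k _ => ?_
    rw [mul_zero, Real.exp_zero, Complex.ofReal_one, mul_one, ← mul_pow]
    push_cast
    rw [neg_mul_neg]
  · refine integral_congr_ae (ae_of_all _ fun w => ?_)
    simp only [expMul_apply, neg_mul]
    ring

/-- The oscillatory integral is that of `e^{0 P₀}`. -/
lemma starProd_one_right (κ : ℝ) (x : Rep) : starProd κ (evalRep x) 1 = evalRep x := by
  have h := expP0_evalRep 0 x
  rw [expR_zero] at h
  refine Eq.trans ?_ h
  funext p
  simp [starProd, expP0]

/-- The star product with a time-independent function on the left is pointwise. -/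
lemma starProd_spatial_left (κ : ℝ) {f : Fn} (hf : ∀ t t' y, f (t, y) = f (t', y)) (x : Rep) :
    starProd κ f (evalRep x) = f * evalRep x := by
  funext p
  have h := ((HasOsc.pow_mul (expSmooth_dilation κ x p) 0).const_mul (f p)).osc_eq
  simp only [pow_zero, one_mul, Module.End.one_apply, zero_div, Real.exp_zero, one_smul] at h
  refine Eq.trans ?_ h
  simp only [starProd, hf (p.1 + _) p.1 p.2]

lemma starProd_one_left (κ : ℝ) (x : Rep) : starProd κ 1 (evalRep x) = evalRep x := by
  rw [starProd_spatial_left κ (fun _ _ _ => rfl), one_mul]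

lemma starProd_coord_succ (κ : ℝ) (j : Fin 3) (x : Rep) :
    starProd κ (coord j.succ) (evalRep x) = coord j.succ * evalRep x :=
  starProd_spatial_left κ (fun _ _ _ => rfl) x

lemma starProd_coord_zero (κ : ℝ) (x : Rep) :
    starProd κ (coord 0) (evalRep x) = coord 0 * evalRep x - Complex.I • evalRep (dilR κ x) := by
  funext p
  have h := (((HasOsc.pow_mul (expSmooth_dilation κ x p) 0).const_mul (p.1 : ℂ)).add
    (HasOsc.pow_mul (expSmooth_dilation κ x p) 1)).osc_eq
  simp only [pow_zero, pow_one, one_mul, Module.End.one_apply, zero_div, Real.exp_zero,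
    one_smul, ← add_mul] at h
  refine Eq.trans ?_ (h.trans ?_)
  · simp only [starProd, coord_zero]
    push_cast
    rfl
  · simp only [Pi.sub_apply, Pi.mul_apply, Pi.smul_apply, coord_zero, smul_eq_mul]
    ring

lemma momP_evalRep (j : Fin 3) (x : Rep) : momP j (evalRep x) = evalRep (momR j x) := by
  funext p
  have h1 : ∀ s : ℝ, HasDerivAt (fun s : ℝ => p.2 + s • (Pi.single j (1 : ℝ) : Fin 3 → ℝ))
      (Pi.single j (1 : ℝ)) s := fun s => by
    simpa using ((hasDerivAt_id s).smul_const (Pi.single j (1 : ℝ) : Fin 3 → ℝ)).const_add p.2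
  have h := hasDerivAt_evalRep x p.1 h1 continuous_const 0
  have e : lineDeriv ℝ (evalRep x) p (0, Pi.single j 1) = evalRep (gradR j x) p := by
    rw [lineDeriv]
    have e2 : (fun s : ℝ => evalRep x (p + s • ((0, Pi.single j 1) : Pt))) =
        fun s : ℝ => evalRep x (p.1, p.2 + s • (Pi.single j (1 : ℝ) : Fin 3 → ℝ)) := by
      funext s
      refine congrArg (evalRep x) (Prod.ext ?_ rfl)
      change p.1 + s * 0 = p.1
      ring
    rw [e2, h.deriv, Finset.sum_eq_single j (fun i _ hi => by simp [hi]) (by simp)]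
    simp
  rw [momP, e]
  change _ = evalRep ((-Complex.I) • gradR j x) p
  rw [map_smul, Pi.smul_apply, smul_eq_mul]

end EvalRep

/-! ### Forms with coefficients in the algebra, and the Hodge star -/

section Forms

/-- The matrix `λ` in the ring of translations. -/
def lamR (κ : ℝ) : Fin 5 → Fin 5 → OpRing :=
  lorentz (algebraMap ℂ OpRing (1 / 2)) (opE (1 / κ)) (opE (-(1 / κ)))
    fun j => algebraMap ℂ OpRing (1 / κ) * opP j

lemma half_mul_two : algebraMap ℂ OpRing (1 / 2) * 2 = 1 := by
  rw [← map_ofNat (algebraMap ℂ OpRing) 2, ← map_mul]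
  norm_num

lemma opE_mul_neg (c : ℝ) : opE c * opE (-c) = 1 := by rw [opE_mul, add_neg_cancel, opE_zero]

/-- On representatives the operators `λ^a_b` are the entries of `lamR`. -/
lemma lam_evalRep (κ : ℝ) (a b : Fin 5) (x : Rep) :
    lam κ a b (evalRep x) = evalRep (lamR κ a b • x) := by
  have hE : ∀ (c : ℝ) (x : Rep), evalRep (opE c • x) = expP0 c (evalRep x) :=
    fun c x => (expP0_evalRep c x).symm
  have hP : ∀ (j : Fin 3) (x : Rep), evalRep (opP j • x) = momP j (evalRep x) :=
    fun j x => (momP_evalRep j x).symm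
  have hcosh : coshP0 κ (evalRep x) =
      evalRep ((algebraMap ℂ OpRing (1 / 2) * (opE (1 / κ) + opE (-(1 / κ)))) • x) := by
    rw [mul_smul, algebraMap_opRing_smul, map_smul, add_smul, map_add, hE, hE]; rfl
  have hsinh : sinhP0 κ (evalRep x) =
      evalRep ((algebraMap ℂ OpRing (1 / 2) * (opE (1 / κ) - opE (-(1 / κ)))) • x) := by
    rw [mul_smul, algebraMap_opRing_smul, map_smul, sub_smul, map_sub, hE, hE]; rfl
  have hsc : ∀ j, scaledP κ j (evalRep x) =
      evalRep ((algebraMap ℂ OpRing (1 / κ) * opP j) • x) := by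
    intro j
    rw [mul_smul, algebraMap_opRing_smul, map_smul, hP]; rfl
  have htw : ∀ j, twistP κ j (evalRep x) =
      evalRep ((opE (1 / κ) * (algebraMap ℂ OpRing (1 / κ) * opP j)) • x) := by
    intro j
    rw [mul_left_comm, mul_smul, algebraMap_opRing_smul, map_smul, mul_smul, hE, hP]; rfl
  have hhalf : halfPsq κ (evalRep x) = evalRep ((algebraMap ℂ OpRing (1 / 2) * (opE (1 / κ) *
      ∑ j, algebraMap ℂ OpRing (1 / κ) * opP j * (algebraMap ℂ OpRing (1 / κ) * opP j))) • x) := by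
    have e : algebraMap ℂ OpRing (1 / 2) * (opE (1 / κ) *
        ∑ j, algebraMap ℂ OpRing (1 / κ) * opP j * (algebraMap ℂ OpRing (1 / κ) * opP j)) =
        algebraMap ℂ OpRing (1 / (2 * (κ : ℂ) ^ 2)) * (opE (1 / κ) * ∑ j, opP j * opP j) := by
      have h1 : (1 / (2 * (κ : ℂ) ^ 2)) = 1 / 2 * (1 / κ * (1 / κ)) := by
        field_simp
      have h2 : ∀ j, algebraMap ℂ OpRing (1 / κ) * opP j * (algebraMap ℂ OpRing (1 / κ) * opP j) =
          algebraMap ℂ OpRing (1 / κ) * algebraMap ℂ OpRing (1 / κ) * (opP j * opP j) :=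
        fun j => by ring
      rw [h1, map_mul, map_mul, Finset.sum_congr rfl fun j _ => h2 j, ← Finset.mul_sum]
      ring
    rw [e, mul_smul, algebraMap_opRing_smul, map_smul, mul_smul, hE, Finset.sum_smul, map_sum]
    simp only [mul_smul, hP]
    rfl
  have hid : evalRep x = evalRep ((1 : OpRing) • x) := by rw [one_smul]
  have hz : (0 : Fn) = evalRep ((0 : OpRing) • x) := by rw [zero_smul, map_zero]
  have hntw : ∀ j, -twistP κ j (evalRep x) =
      evalRep ((-(opE (1 / κ) * (algebraMap ℂ OpRing (1 / κ) * opP j))) • x) := by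
    intro j
    rw [neg_smul, map_neg, htw]
  fin_cases a
  · fin_cases b
    exacts [(congrArg₂ (· + ·) hcosh hhalf).trans (by rw [← map_add, ← add_smul]; rfl),
      hsc 0, hsc 1, hsc 2, (congrArg₂ (fun f g => -f - g) hsinh hhalf).trans
        (by rw [← map_neg, ← map_sub, ← neg_smul, ← sub_smul]; rfl)]
  · fin_cases b
    exacts [htw 0, hid, hz, hz, hntw 0]
  · fin_cases b
    exacts [htw 1, hz, hid, hz, hntw 1]
  · fin_cases b
    exacts [htw 2, hz, hz, hid, hntw 2]
  · fin_cases b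
    exacts [(congrArg₂ (fun f g => -f + g) hsinh hhalf).trans
        (by rw [← map_neg, ← map_add, ← neg_smul, ← add_smul]; rfl),
      hsc 0, hsc 1, hsc 2, (congrArg₂ (· - ·) hcosh hhalf).trans
        (by rw [← map_sub, ← sub_smul]; rfl)]

/-- Forms with represented coefficients. -/
abbrev RForm : Type := Finset (Fin 5) → Rep

/-- The form represented by a family of coefficients. -/
def toForm : RForm →ₗ[ℂ] Form := evalRep.compLeft (Finset (Fin 5))

lemma toForm_apply (ω : RForm) (I : Finset (Fin 5)) : toForm ω I = evalRep (ω I) := rfl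

lemma mem_GamTotal {ω : Form} : ω ∈ GamTotal ↔ ∃ x : RForm, ω = toForm x := by
  constructor
  · intro h
    choose x hx using fun I => mem_algA.1 (h I)
    exact ⟨x, funext hx⟩
  · rintro ⟨x, rfl⟩ I
    exact mem_algA.2 ⟨x I, rfl⟩

lemma toForm_single (I : Finset (Fin 5)) (x : Rep) :
    toForm (Pi.single I x) = Pi.single I (evalRep x) := by
  funext J
  rw [toForm_apply]
  by_cases h : J = I
  · subst h; simp
  · simp [h]

lemma basisForm_eq (I : Finset (Fin 5)) : basisForm I = toForm (Pi.single I (constRep 1)) := by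
  rw [toForm_single, evalRep_one, basisForm]

lemma zeroForm_evalRep (x : Rep) : zeroForm (evalRep x) = toForm (Pi.single ∅ x) := by
  rw [toForm_single, zeroForm]

lemma oneFormMul_toForm (κ : ℝ) (a : Fin 5) (ω : RForm) :
    oneFormMul κ a (toForm ω) = toForm (ext (lamR κ a) ω) := by
  funext K
  rw [toForm_apply, ext, map_sum, oneFormMul]
  refine Finset.sum_congr rfl fun b _ => ?_
  rw [toForm_apply, lam_evalRep, map_zsmul, sg, ← Int.cast_smul_eq_zsmul ℂ]
  push_cast
  rfl

/-- `e^{i₁} ∧ (⋯ ∧ (e^{iₙ} ∧ ω))` as a product of rows of `λ`. -/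
lemma foldr_toForm (κ : ℝ) (I : Finset (Fin 5)) (ω : RForm) :
    (I.sort (· ≤ ·)).foldr (oneFormMul κ) (toForm ω) = toForm (extProd (lamR κ) I ω) := by
  rw [extProd]
  generalize I.sort (· ≤ ·) = l
  induction l with
  | nil => rfl
  | cons a l ih => rw [List.foldr_cons, ih, oneFormMul_toForm, List.foldr_cons]

lemma wedge_toForm (κ : ℝ) (ω ρ : RForm) (K : Finset (Fin 5)) :
    wedge κ (toForm ω) (toForm ρ) K = ∑ I, starL κ (ω I) (extProd (lamR κ) I ρ K) := by
  simp only [wedge, foldr_toForm, Finset.sum_apply]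
  rfl

lemma rmul_toForm (κ : ℝ) (ω : RForm) (x : Rep) (K : Finset (Fin 5)) :
    rmul κ (toForm ω) (evalRep x) K = ∑ I, starL κ (ω I) (minor (lamR κ) I K • x) := by
  simp only [rmul, zeroForm_evalRep, wedge_toForm, extProd_single_empty]

lemma lmul_toForm (κ : ℝ) (x : Rep) (ω : RForm) (K : Finset (Fin 5)) :
    lmul κ (evalRep x) (toForm ω) K = starL κ x (ω K) := rfl

lemma starL_one_left (κ : ℝ) (x : Rep) : starL κ (constRep 1) x = evalRep x := by
  rw [starL_apply, evalRep_one, starProd_one_left]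

lemma starL_one_right (κ : ℝ) (x : Rep) : starL κ x (constRep 1) = evalRep x := by
  rw [starL_apply, evalRep_one, starProd_one_right]

lemma wedge_basisForm (κ : ℝ) (I : Finset (Fin 5)) (ρ : RForm) :
    wedge κ (basisForm I) (toForm ρ) = toForm (extProd (lamR κ) I ρ) := by
  funext K
  rw [basisForm_eq, wedge_toForm, Finset.sum_eq_single I
    (fun J _ hJ => by rw [Pi.single_eq_of_ne hJ, map_zero, LinearMap.zero_apply]) (by simp),
    Pi.single_eq_same, starL_one_left, toForm_apply]

lemma rmul_basisForm (κ : ℝ) (I : Finset (Fin 5)) (x : Rep) :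
    rmul κ (basisForm I) (evalRep x) = toForm fun K => minor (lamR κ) I K • x := by
  rw [rmul, zeroForm_evalRep, wedge_basisForm]
  congr 1
  funext K
  rw [extProd_single_empty]

/-- The Hodge star `e^I ↦ starSign I • e^{Iᶜ}`, left linear. -/
def hodge (ω : Form) : Form := fun J => starSign Jᶜ • ω Jᶜ

/-- The Hodge star on represented coefficients. -/
def hodgeR (ω : RForm) : RForm := fun J => starSign Jᶜ • ω Jᶜ

lemma hodge_toForm (ω : RForm) : hodge (toForm ω) = toForm (hodgeR ω) := by
  funext J
  simp only [hodge, hodgeR, toForm_apply, map_zsmul]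

lemma hodge_add (ω ρ : Form) : hodge (ω + ρ) = hodge ω + hodge ρ := by
  funext J; simp only [hodge, Pi.add_apply, smul_add]

lemma hodge_smul (c : ℂ) (ω : Form) : hodge (c • ω) = c • hodge ω := by
  funext J; simp only [hodge, Pi.smul_apply, smul_comm c]

lemma hodge_basisForm (I : Finset (Fin 5)) : hodge (basisForm I) = starSign I • basisForm Iᶜ := by
  funext J
  simp only [hodge, basisForm, Pi.smul_apply]
  by_cases h : J = Iᶜ
  · subst h; simp
  · have h' : Jᶜ ≠ I := fun h' => h (by rw [← h', compl_compl])
    rw [Pi.single_eq_of_ne h, Pi.single_eq_of_ne h', smul_zero, smul_zero]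

lemma hodge_hodge (ω : Form) : hodge (hodge ω) = ω := by
  funext J
  simp only [hodge, compl_compl, smul_smul]
  rw [mul_comm, starSign_mul_compl, one_smul]

lemma hodge_lmul (κ : ℝ) {f : Fn} (hf : f ∈ algA) {ω : Form} (hω : ω ∈ GamTotal) :
    hodge (lmul κ f ω) = lmul κ f (hodge ω) := by
  obtain ⟨x, rfl⟩ := mem_algA.1 hf
  obtain ⟨ω, rfl⟩ := mem_GamTotal.1 hω
  funext J
  rw [hodge_toForm, lmul_toForm, hodge, lmul_toForm, hodgeR, map_zsmul]

lemma lamR_orthogonal (κ : ℝ) (a b : Fin 5) :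
    ∑ c, etaZ c • (lamR κ a c * lamR κ b c) = if a = b then ((etaZ a : ℤ) : OpRing) else 0 :=
  lorentz_orthogonal _ half_mul_two (opE_mul_neg _) a b

/-- Right linearity: the minors of `λ` commute with complementation of indices up to `starSign`. -/
lemma hodge_rmul (κ : ℝ) {f : Fn} (hf : f ∈ algA) {ω : Form} (hω : ω ∈ GamTotal) :
    hodge (rmul κ ω f) = rmul κ (hodge ω) f := by
  obtain ⟨x, rfl⟩ := mem_algA.1 hf
  obtain ⟨ω, rfl⟩ := mem_GamTotal.1 hω
  funext J
  rw [hodge_toForm, rmul_toForm, hodge, rmul_toForm, Finset.smul_sum,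
    ← Equiv.sum_comp compl_involutive.toPerm]
  refine Finset.sum_congr rfl fun I _ => ?_
  have h := starSign_minor (lamR_orthogonal κ)
    (lorentz_det _ half_mul_two (opE_mul_neg _)) Iᶜ Jᶜ
  rw [compl_compl, compl_compl] at h
  rw [Function.Involutive.coe_toPerm, hodgeR, ← map_zsmul, ← smul_assoc, h, map_zsmul, LinearMap.smul_apply,
    ← map_zsmul, smul_assoc]

lemma Gam_algA_subset (n : ℕ) : Gam algA n ⊆ GamTotal := fun _ h => h.1

lemma zsmul_mem_algA {f : Fn} (n : ℤ) (hf : f ∈ algA) : n • f ∈ algA := by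
  obtain ⟨x, rfl⟩ := mem_algA.1 hf
  exact mem_algA.2 ⟨n • x, (map_zsmul _ _ _).symm⟩

lemma zsmul_mem_schwartzC {f : Fn} (n : ℤ) (hf : f ∈ schwartzC) : n • f ∈ schwartzC := by
  obtain ⟨F, rfl⟩ := mem_schwartzC.1 hf
  refine mem_schwartzC.2 ⟨n • F, ?_⟩
  rw [← evalRep_band, ← evalRep_band, ← map_zsmul]
  congr 1
  exact Prod.ext (smul_zero _) rfl

lemma hodge_mem_Gam {C : Set Fn} (hC : ∀ (n : ℤ), ∀ f ∈ C, n • f ∈ C) {n : ℕ} (hn : n ≤ 5)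
    {ω : Form} (hω : ω ∈ Gam C n) : hodge ω ∈ Gam C (5 - n) := by
  refine ⟨fun I => hC _ _ (hω.1 _), fun I hI => ?_⟩
  rw [hodge, hω.2, smul_zero]
  rw [Finset.card_compl, Fintype.card_fin]
  have := Finset.card_le_univ I
  rw [Fintype.card_fin] at this
  omega

end Forms

/-! ### The pairing of forms -/

section Pairing

open MeasureTheory

/-- The translations preserve the space of band-limited functions. -/
lemma fst_smul (r : OpRing) {x : Rep} (hx : x.1 = 0) : (r • x).1 = 0 := by
  obtain ⟨r, hr⟩ := r
  change (r x).1 = 0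
  induction hr using Algebra.adjoin_induction generalizing x with
  | mem r hr =>
    rcases hr with ⟨c, rfl⟩ | ⟨j, rfl⟩
    · rw [expR_apply, hx, map_zero]
    · rw [momR_apply, hx, map_zero, smul_zero]
  | algebraMap c => rw [Module.algebraMap_end_apply, Prod.smul_fst, hx, smul_zero]
  | add r s _ _ hr hs => rw [LinearMap.add_apply, Prod.fst_add, hr hx, hs hx, add_zero]
  | mul r s _ _ hr hs => exact hr (hs hx)

lemma evalRep_of_fst {x : Rep} (hx : x.1 = 0) : evalRep x = bandFn x.2 := by
  rw [← evalRep_band, ← hx]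

/-- The form `beta` on representatives. -/
def betaR (κ : ℝ) : Rep →ₗ[ℂ] Rep →ₗ[ℂ] ℂ :=
  (betaL κ).compl₁₂ (LinearMap.snd ℂ _ _) (LinearMap.snd ℂ _ _)

lemma betaR_apply (κ : ℝ) (x y : Rep) : betaR κ x y = beta κ x.2 y.2 := rfl

/-- `r'` is the adjoint of the translation operator `r` with respect to `beta`. -/
def Adj (κ : ℝ) (r r' : OpRing) : Prop := ∀ x y : Rep, betaR κ (r • x) y = betaR κ x (r' • y)

namespace Adj

variable {κ : ℝ} {r r' s s' : OpRing}

lemma add (hr : Adj κ r r') (hs : Adj κ s s') : Adj κ (r + s) (r' + s') := fun x y => by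
  rw [add_smul, add_smul, map_add, map_add, LinearMap.add_apply, hr, hs]

lemma neg (hr : Adj κ r r') : Adj κ (-r) (-r') := fun x y => by
  rw [neg_smul, neg_smul, map_neg, map_neg, LinearMap.neg_apply, hr]

lemma sub (hr : Adj κ r r') (hs : Adj κ s s') : Adj κ (r - s) (r' - s') := by
  rw [sub_eq_add_neg, sub_eq_add_neg]
  exact hr.add hs.neg

lemma mul (hr : Adj κ r r') (hs : Adj κ s s') : Adj κ (r * s) (r' * s') := fun x y => by
  rw [mul_smul, hr, hs, smul_smul, mul_comm s']

lemma zero : Adj κ 0 0 := fun x y => by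
  rw [zero_smul, zero_smul, map_zero, map_zero, LinearMap.zero_apply]

lemma one : Adj κ 1 1 := fun x y => by rw [one_smul, one_smul]

lemma zsmul (n : ℤ) (hr : Adj κ r r') : Adj κ (n • r) (n • r') := fun x y => by
  rw [smul_assoc, smul_assoc, map_zsmul, map_zsmul, LinearMap.smul_apply, hr]

lemma sum {α : Type*} (t : Finset α) {f f' : α → OpRing} (h : ∀ i ∈ t, Adj κ (f i) (f' i)) :
    Adj κ (∑ i ∈ t, f i) (∑ i ∈ t, f' i) := fun x y => by
  rw [Finset.sum_smul, Finset.sum_smul, map_sum, map_sum, LinearMap.sum_apply]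
  exact Finset.sum_congr rfl fun i hi => h i hi x y

lemma const (c : ℂ) : Adj κ (algebraMap ℂ OpRing c) (algebraMap ℂ OpRing c) := fun x y => by
  rw [algebraMap_opRing_smul, algebraMap_opRing_smul, map_smul, map_smul, LinearMap.smul_apply]

lemma opE (c : ℝ) : Adj κ (opE c) (KappaMinkowski.opE (-c)) := fun x y => by
  rw [opE_smul, opE_smul, betaR_apply, betaR_apply, expR_apply, expR_apply, beta_expMul]

/-- Integration by parts; the exponential comes from the dilation in the star product. -/
lemma opP (j : Fin 3) : Adj κ (opP j) (-(KappaMinkowski.opE (1 / κ) * KappaMinkowski.opP j)) :=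
  fun x y => by
    rw [neg_smul, mul_smul, opE_smul, opP_smul, opP_smul, map_neg, betaR_apply, betaR_apply,
      expR_apply, momR_apply, momR_apply, beta_smul_left, beta_lineD]
    change _ = -beta κ x.2 (expMul (1 / κ) ((-Complex.I) • lineD (dirX j) y.2))
    rw [map_smul, beta_smul_right]
    ring

lemma minor {m m' : Fin 5 → Fin 5 → OpRing} (h : ∀ a b, Adj κ (m a b) (m' a b))
    (I K : Finset (Fin 5)) :
    Adj κ (KappaMinkowski.minor m I K) (KappaMinkowski.minor m' I K) := by
  induction I using Finset.induction_on_min generalizing K with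
  | empty =>
    rw [minor_empty, minor_empty]
    by_cases hK : K = ∅
    · subst hK; rw [Pi.single_eq_same]; exact one
    · rw [Pi.single_eq_of_ne hK]; exact zero
  | insert a I ha ih =>
    rw [minor_insert_min m ha, minor_insert_min m' ha]
    exact sum _ fun b _ => ((h a b).mul (ih _)).zsmul _

end Adj

/-- The adjoint of `λ`, which is also its inverse. -/
def lamAdj (κ : ℝ) (a b : Fin 5) : OpRing := ((etaZ a * etaZ b : ℤ) : OpRing) * lamR κ b a

/-- Replacing the generators by their adjoints turns `λ` into `η λᵀ η`. -/
lemma lorentz_adj {R : Type*} [CommRing R] (h E E' : R) (p : Fin 3 → R) (hE : E * E' = 1)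
    (a b : Fin 5) : lorentz h E' E (fun j => -(E * p j)) a b =
      ((etaZ a * etaZ b : ℤ) : R) * lorentz h E E' p b a := by
  fin_cases a <;> fin_cases b <;> simp [lorentz, etaZ, Fin.sum_univ_three] <;> grind

/-- Adjoints of the matrix entries, from those of the generators. -/
lemma adj_lorentz {κ : ℝ} {h E E' F F' : OpRing} {p q : Fin 3 → OpRing} (hh : Adj κ h h)
    (hE : Adj κ E F) (hE' : Adj κ E' F') (hp : ∀ j, Adj κ (p j) (q j)) (a b : Fin 5) :
    Adj κ (lorentz h E E' p a b) (lorentz h F F' q a b) := by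
  have hs : Adj κ (h * (E * ∑ j, p j * p j)) (h * (F * ∑ j, q j * q j)) :=
    hh.mul (hE.mul (Adj.sum _ fun j _ => (hp j).mul (hp j)))
  fin_cases a
  · fin_cases b
    exacts [(hh.mul (hE.add hE')).add hs, hp 0, hp 1, hp 2, (hh.mul (hE.sub hE')).neg.sub hs]
  · fin_cases b
    exacts [hE.mul (hp 0), Adj.one, Adj.zero, Adj.zero, (hE.mul (hp 0)).neg]
  · fin_cases b
    exacts [hE.mul (hp 1), Adj.zero, Adj.one, Adj.zero, (hE.mul (hp 1)).neg]
  · fin_cases b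
    exacts [hE.mul (hp 2), Adj.zero, Adj.zero, Adj.one, (hE.mul (hp 2)).neg]
  · fin_cases b
    exacts [(hh.mul (hE.sub hE')).neg.add hs, hp 0, hp 1, hp 2, (hh.mul (hE.add hE')).sub hs]

lemma adj_lamR (κ : ℝ) (a b : Fin 5) : Adj κ (lamR κ a b) (lamAdj κ a b) := by
  rw [lamAdj, lamR, ← lorentz_adj _ _ _ _ (opE_mul_neg _)]
  refine adj_lorentz (Adj.const _) (Adj.opE _) ?_ (fun j => ?_) a b
  · have := Adj.opE (κ := κ) (-(1 / κ))
    rwa [neg_neg] at this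
  · have := (Adj.const (κ := κ) (1 / κ)).mul (Adj.opP (κ := κ) j)
    refine (congrArg (Adj κ _) ?_).mp this
    ring

/-- The map induced by `λ` on the exterior algebra is an isometry for `beta`, by the Cauchy–Binet
formula. -/
lemma sum_betaR_minor (κ : ℝ) (I J : Finset (Fin 5)) (x y : Rep) :
    ∑ K, betaR κ (minor (lamR κ) I K • x) (minor (lamR κ) K J • y) =
      if I = J then betaR κ x y else 0 := by
  have h := minor_mul (lamAdj κ) (lamR κ) I J
  have e : (fun a c => ∑ b, lamAdj κ a b * lamR κ b c) = fun a => Pi.single a 1 := by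
    funext a c
    exact lorentz_orthogonal' _ half_mul_two (opE_mul_neg _) a c
  rw [e, minor_one] at h
  simp_rw [fun K => Adj.minor (adj_lamR κ) I K x, smul_smul]
  rw [← map_sum, ← Finset.sum_smul, ← h]
  split_ifs with hIJ
  · subst hIJ; rw [Pi.single_eq_same, one_smul]
  · rw [Pi.single_eq_of_ne (Ne.symm hIJ), zero_smul, map_zero]

/-- The form with partial Fourier transforms `F`. -/
def bandForm (F : Finset (Fin 5) → bandS) : Form := fun I => bandFn (F I)

/-- Representatives of the coefficients of `bandForm F`. -/
def bandR (F : Finset (Fin 5) → bandS) : RForm := fun I => (0, F I)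

lemma toForm_bandR (F : Finset (Fin 5) → bandS) : toForm (bandR F) = bandForm F :=
  funext fun I => evalRep_band (F I)

/-- The sign in `(e^I)† = dagSign I • e^I`. -/
def dagSign (I : Finset (Fin 5)) : ℂ := (-1) ^ (I.card * (I.card - 1) / 2)

/-- Representatives of the coefficients of `(bandForm F)†`. -/
def dagR (κ : ℝ) (F : Finset (Fin 5) → bandS) : RForm := fun K =>
  ∑ I, dagSign I • minor (lamR κ) I K • ((0, dagS κ (F I)) : Rep)

lemma dag_bandForm (κ : ℝ) (F : Finset (Fin 5) → bandS) :
    dag κ (bandForm F) = toForm (dagR κ F) := by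
  funext K
  rw [dag, Finset.sum_apply, toForm_apply, dagR, map_sum]
  refine Finset.sum_congr rfl fun I _ => ?_
  rw [map_smul, bandForm, dagFn_bandFn, ← evalRep_band, rmul_basisForm]
  rfl

lemma dagR_fst (κ : ℝ) (F : Finset (Fin 5) → bandS) (K : Finset (Fin 5)) : (dagR κ F K).1 = 0 := by
  rw [dagR, Prod.fst_sum]
  refine Finset.sum_eq_zero fun I _ => ?_
  rw [Prod.smul_fst, fst_smul _ rfl, smul_zero]

/-- The sign of the `e^J`-component in the pairing. -/
def topSign (J : Finset (Fin 5)) : ℤ := starSign J * wsg J Jᶜ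

lemma topSign_mul_self (J : Finset (Fin 5)) : topSign J * topSign J = 1 := by
  rw [topSign, mul_mul_mul_comm, starSign_mul_self, wsg_mul_self, one_mul]

/-- The top coefficient of `e^K ∧ *ω`. -/
lemma extProd_hodgeR (m : Fin 5 → Fin 5 → OpRing) (ω : RForm) (K : Finset (Fin 5)) :
    extProd m K (hodgeR ω) Finset.univ = ∑ J, topSign J • minor m K J • ω J := by
  have h : hodgeR ω = ∑ J, Pi.single Jᶜ (starSign J • ω J) := by
    rw [sum_single_smul (hodgeR ω), ← Equiv.sum_comp compl_involutive.toPerm]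
    refine Finset.sum_congr rfl fun J _ => ?_
    simp only [Function.Involutive.coe_toPerm, hodgeR, compl_compl]
  rw [h, extProd_sum, Finset.sum_apply]
  refine Finset.sum_congr rfl fun J _ => ?_
  rw [extProd_single, if_pos (Finset.subset_univ _), ← Finset.compl_eq_univ_sdiff, compl_compl,
    topSign, mul_comm, mul_smul, smul_comm (minor m K J)]

lemma integral_starL (κ : ℝ) {x y : Rep} (hx : x.1 = 0) (hy : y.1 = 0) :
    Integrable (starL κ x y) ∧ ∫ p, starL κ x y p = 2 * Real.pi * betaR κ x y := by
  rw [starL_apply, evalRep_of_fst hx, evalRep_of_fst hy]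
  exact integral_starProd κ x.2 y.2

/-- The sesquilinear form `(2π)⁻¹ ∫ f† ⋆ g` in terms of partial Fourier transforms. -/
def herm (κ : ℝ) (F G : bandS) : ℂ := beta κ (dagS κ F) G

/-- The pairing is diagonal in the basis `e^I`. -/
lemma pairing_bandForm (κ : ℝ) (F G : Finset (Fin 5) → bandS) :
    Integrable (wedge κ (dag κ (bandForm F)) (hodge (bandForm G)) Finset.univ) ∧
      pairing κ hodge (bandForm F) (bandForm G) =
        ∑ I, 2 * Real.pi * (dagSign I * topSign I) * herm κ (F I) (G I) := by
  have hw : wedge κ (dag κ (bandForm F)) (hodge (bandForm G)) Finset.univ =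
      fun p => ∑ K, ∑ J, ((topSign J : ℤ) : ℂ) *
        starL κ (dagR κ F K) (minor (lamR κ) K J • ((0, G J) : Rep)) p := by
    rw [dag_bandForm, ← toForm_bandR, hodge_toForm, wedge_toForm]
    funext p
    rw [Finset.sum_apply]
    refine Finset.sum_congr rfl fun K _ => ?_
    rw [extProd_hodgeR, map_sum, Finset.sum_apply]
    refine Finset.sum_congr rfl fun J _ => ?_
    rw [map_zsmul, ← Int.cast_smul_eq_zsmul ℂ, Pi.smul_apply, smul_eq_mul]
    rfl
  have hi : ∀ K J, Integrable fun p => ((topSign J : ℤ) : ℂ) *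
        starL κ (dagR κ F K) (minor (lamR κ) K J • ((0, G J) : Rep)) p := fun K J =>
    (integral_starL κ (dagR_fst κ F K) (fst_smul _ rfl)).1.const_mul _
  rw [pairing, integral5, hw]
  refine ⟨integrable_finsetSum _ fun K _ => integrable_finsetSum _ fun J _ => hi K J, ?_⟩
  rw [integral_finsetSum _ fun K _ => integrable_finsetSum _ fun J _ => hi K J]
  simp_rw [integral_finsetSum _ fun J _ => hi _ J, integral_const_mul,
    fun K J => (integral_starL κ (dagR_fst κ F K)
      (fst_smul (minor (lamR κ) K J) (x := (0, G J)) rfl)).2]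
  rw [Finset.sum_comm]
  have key : ∀ J, ∑ K, betaR κ (dagR κ F K) (minor (lamR κ) K J • ((0, G J) : Rep)) =
      dagSign J * herm κ (F J) (G J) := by
    intro J
    simp only [dagR, map_sum, LinearMap.sum_apply, map_smul, LinearMap.smul_apply, smul_eq_mul]
    rw [Finset.sum_comm]
    simp_rw [← Finset.mul_sum, sum_betaR_minor]
    rw [Finset.sum_eq_single J (fun I _ hI => by rw [if_neg hI, mul_zero]) (by simp), if_pos rfl]
    rfl
  refine Finset.sum_congr rfl fun J _ => ?_
  rw [← Finset.mul_sum, ← Finset.mul_sum, key]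
  ring

/-- `herm` is the `L²` inner product, transported by `flipS`. -/
lemma herm_eq (κ : ℝ) (F G : bandS) :
    herm κ F G = ∫ p, (starRingEnd ℂ) ((flipS κ F).1 p) * (flipS κ G).1 p := by
  rw [herm, beta]
  refine integral_congr_ae (ae_of_all _ fun p => ?_)
  simp only [dagS_apply, flipS_apply]

lemma conj_herm (κ : ℝ) (F G : bandS) : (starRingEnd ℂ) (herm κ F G) = herm κ G F := by
  rw [herm_eq, herm_eq, ← integral_conj]
  refine integral_congr_ae (ae_of_all _ fun p => ?_)
  simp only [map_mul, Complex.conj_conj]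
  ring

lemma herm_add_smul_right (κ : ℝ) (c : ℂ) (F G G' : bandS) :
    herm κ F (c • G + G') = c * herm κ F G + herm κ F G' := by
  rw [herm, beta_add_right, beta_smul_right]; rfl

lemma herm_add_smul_left (κ : ℝ) (c : ℂ) (F F' G : bandS) :
    herm κ (c • F + F') G = (starRingEnd ℂ) c * herm κ F G + herm κ F' G := by
  rw [← conj_herm, herm_add_smul_right, map_add, map_mul, conj_herm, conj_herm]

lemma herm_zero_left (κ : ℝ) (G : bandS) : herm κ 0 G = 0 := by
  have h := herm_add_smul_left κ 1 0 0 G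
  simpa using h

lemma herm_zero_right (κ : ℝ) (F : bandS) : herm κ F 0 = 0 := by
  rw [← conj_herm, herm_zero_left, map_zero]

lemma herm_self_eq_zero {κ : ℝ} {F : bandS} (h : herm κ F F = 0) : F = 0 := by
  set G := flipS κ F with hG
  have e : herm κ F F = ((∫ p, ‖G.1 p‖ ^ 2 : ℝ) : ℂ) := by
    rw [herm_eq]
    refine Eq.trans ?_ (integral_ofReal (𝕜 := ℂ) (μ := volume) (f := fun p => ‖G.1 p‖ ^ 2))
    refine integral_congr_ae (ae_of_all _ fun p => ?_)
    simp only [← hG, Complex.conj_mul', Complex.coe_algebraMap, Complex.ofReal_pow]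
  have hc : Continuous fun p => ‖G.1 p‖ ^ 2 := by fun_prop
  have hi : Integrable fun p => ‖G.1 p‖ ^ 2 := by
    refine (integrable_mul_bandS G G).norm.congr (ae_of_all _ fun p => ?_)
    simp only [norm_mul, sq]
  rw [h] at e
  have h0 : ∫ p, ‖G.1 p‖ ^ 2 = 0 := by exact_mod_cast e.symm
  rw [integral_eq_zero_iff_of_nonneg (fun p => by positivity) hi] at h0
  have h1 := (Continuous.ae_eq_iff_eq volume hc continuous_const).1 h0
  refine bandS_ext fun p => ?_
  have h2 := congrFun h1 (flipPt κ p)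
  have h3 : G.1 (flipPt κ p) = 0 := norm_eq_zero.1 (pow_eq_zero_iff two_ne_zero |>.1 h2)
  rw [hG, flipS_apply, flipPt_flipPt] at h3
  exact h3

end Pairing

/-! ### Constant forms and the rules for the Hodge star -/

section Rules

open MeasureTheory

/-- The action of `λ` on a vector killed by products of momenta, on which `e^{± P₀/κ}` is the
translation by `± u`. -/
lemma lorentz_smul {R M : Type*} [CommRing R] [AddCommGroup M] [Module R M] {h E E' : R}
    {p : Fin 3 → R} {x u : M} {w : Fin 3 → M} (hh : h * 2 = 1) (hE : E • x = x + u)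
    (hE' : E' • x = x - u) (hp : ∀ j, p j • x = w j) (hw : ∀ j, E • w j = w j)
    (hpw : ∀ j, p j • w j = 0) (a b : Fin 5) :
    lorentz h E E' p a b • x = (![![x, w 0, w 1, w 2, -u], ![w 0, x, 0, 0, -w 0],
      ![w 1, 0, x, 0, -w 1], ![w 2, 0, 0, x, -w 2], ![-u, w 0, w 1, w 2, x]] :
        Fin 5 → Fin 5 → M) a b := by
  have h2 : ∀ y : M, h • (y + y) = y := fun y => by
    rw [← two_smul R y, smul_smul, hh, one_smul]
  have hcosh : (h * (E + E')) • x = x := by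
    rw [mul_smul, add_smul, hE, hE', add_add_sub_cancel, h2]
  have hsinh : (h * (E - E')) • x = u := by
    rw [mul_smul, sub_smul, hE, hE', add_sub_sub_cancel, h2]
  have hsq : (h * (E * ∑ j, p j * p j)) • x = 0 := by
    rw [mul_smul, mul_smul, Finset.sum_smul, Finset.sum_eq_zero fun j _ => by
      rw [mul_smul, hp, hpw], smul_zero, smul_zero]
  have htw : ∀ j, (E * p j) • x = w j := fun j => by rw [mul_smul, hp, hw]
  fin_cases a <;> fin_cases b <;>
    simp [lorentz, add_smul _ _ x, sub_smul, neg_smul, hcosh, hsinh, hsq, htw, hp]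

lemma opE_constRep (s : ℝ) (c : ℂ) : opE s • constRep c = constRep c := by
  rw [opE_smul, expR_apply]
  exact Prod.ext (by simp [constRep, shiftP]) (by simp [constRep])

lemma opP_constRep (j : Fin 3) (c : ℂ) : opP j • constRep c = 0 := by
  rw [opP_smul, momR_apply]
  exact Prod.ext (by simp [constRep]) (by simp [constRep])

/-- `e^a c = c e^a` for constants `c`. -/
lemma lamR_constRep (κ : ℝ) (a b : Fin 5) (c : ℂ) :
    lamR κ a b • constRep c = (Pi.single a 1 : Fin 5 → OpRing) b • constRep c := by
  rw [lamR, lorentz_smul (u := 0) (w := 0) half_mul_two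
    (by rw [opE_constRep, add_zero]) (by rw [opE_constRep, sub_zero])
    (fun j => by rw [mul_smul, opP_constRep, smul_zero]; rfl) (fun j => smul_zero _)
    (fun j => smul_zero _)]
  fin_cases a <;> fin_cases b <;> simp

lemma ext_lamR_const (κ : ℝ) (a : Fin 5) (K : Finset (Fin 5)) (c : ℂ) :
    ext (lamR κ a) (Pi.single K (constRep c) : RForm) =
      if a ∈ K then 0 else sg a K • Pi.single (insert a K) (constRep c) := by
  have h : ext (lamR κ a) (Pi.single K (constRep c) : RForm) =
      ext (Pi.single a (1 : OpRing)) (Pi.single K (constRep c) : RForm) := by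
    funext L
    refine Finset.sum_congr rfl fun b _ => ?_
    by_cases hL : L.erase b = K
    · rw [hL, Pi.single_eq_same, lamR_constRep]
    · simp only [Pi.single_eq_of_ne hL, smul_zero]
  rw [h]
  split_ifs with ha
  · exact ext_single_single_mem a ha _
  · exact ext_single_single a ha _

lemma wedge_e (κ : ℝ) (a : Fin 5) (ρ : RForm) :
    wedge κ (e a) (toForm ρ) = toForm (ext (lamR κ a) ρ) := by
  have h : extProd (lamR κ) {a} ρ = ext (lamR κ a) ρ := by
    have := extProd_insert_min (lamR κ) (a := a) (I := ∅) (by simp) ρ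
    rwa [extProd_empty, insert_empty_eq] at this
  rw [e, wedge_basisForm, h]

/-- The sign relating `e^{i₁} ∧ ⋯ ∧ e^{iₙ}` to the basis form, zero if an index is repeated. -/
def sgnZ : List (Fin 5) → ℤ
  | [] => 1
  | a :: l => if a ∈ l then 0 else sg a l.toFinset * sgnZ l

/-- The product `e^{i₁} ∧ ⋯ ∧ e^{iₙ}` in terms of basis forms. -/
def listForm (l : List (Fin 5)) : Form := sgnZ l • basisForm l.toFinset

lemma wedge_e_listForm (κ : ℝ) (a : Fin 5) (l : List (Fin 5)) :
    wedge κ (e a) (listForm l) = listForm (a :: l) := by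
  rw [listForm, listForm, basisForm_eq, ← map_zsmul, wedge_e, ext_smul, ext_lamR_const, sgnZ,
    List.toFinset_cons]
  simp only [List.mem_toFinset]
  split_ifs with ha
  · rw [smul_zero, map_zero, zero_smul]
  · rw [smul_smul, map_zsmul, ← basisForm_eq, mul_comm]

lemma e_eq_listForm (a : Fin 5) : e a = listForm [a] := by
  simp [listForm, sgnZ, e, sg]

lemma listForm_eq_vol : listForm [0, 1, 2, 3, 4] = basisForm Finset.univ := by
  have h1 : sgnZ [0, 1, 2, 3, 4] = 1 := by decide
  have h2 : [0, 1, 2, 3, 4].toFinset = (Finset.univ : Finset (Fin 5)) := by decide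
  rw [listForm, h1, h2, one_smul]

lemma vol5_eq (κ : ℝ) : vol5 κ = basisForm Finset.univ := by
  rw [vol5, e_eq_listForm 4]
  simp only [wedge_e_listForm, listForm_eq_vol]

lemma nodup_of_sgnZ {l : List (Fin 5)} (h : sgnZ l ≠ 0) : l.Nodup := by
  induction l with
  | nil => exact List.nodup_nil
  | cons a l ih =>
    rw [sgnZ] at h
    split_ifs at h with ha
    · exact (h rfl).elim
    · exact List.nodup_cons.2 ⟨ha, ih (right_ne_zero_of_mul h)⟩

lemma sign_eq_sgnZ : ∀ σ : Equiv.Perm (Fin 5), (Equiv.Perm.sign σ : ℤ) = sgnZ (List.ofFn σ) := by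
  decide +kernel

/-- The Levi-Civita symbol is the sign of a product of five one-forms. -/
lemma eps_eq (i : Fin 5 → Fin 5) : eps i = (sgnZ (List.ofFn i) : ℂ) := by
  by_cases hi : Function.Injective i
  · obtain ⟨σ, rfl⟩ : ∃ σ : Equiv.Perm (Fin 5), i = σ :=
      ⟨Equiv.ofBijective i (Finite.injective_iff_bijective.1 hi), rfl⟩
    rw [← sign_eq_sgnZ, eps]
    have h : (Matrix.of fun r c : Fin 5 => if σ r = c then (1 : ℂ) else 0) =
        (Equiv.toPEquiv σ).toMatrix := by
      ext r c
      simp [PEquiv.toMatrix_apply, Equiv.toPEquiv_apply, eq_comm]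
    rw [h, Matrix.det_permutation]
  · have h0 : sgnZ (List.ofFn i) = 0 := by
      by_contra h
      exact hi (List.nodup_ofFn.1 (nodup_of_sgnZ h))
    rw [h0, Int.cast_zero, eps]
    obtain ⟨r, s, hrs, hne⟩ : ∃ r s, i r = i s ∧ r ≠ s := by
      simpa [Function.Injective] using hi
    exact Matrix.det_zero_of_row_eq hne (by funext c; simp [hrs])

lemma eps_apply (a b c d r : Fin 5) : eps ![a, b, c, d, r] = (sgnZ [a, b, c, d, r] : ℂ) :=
  eps_eq _

lemma sgnZ_cons_mul (a : Fin 5) (l : List (Fin 5)) :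
    sgnZ (a :: l) * sgnZ l = sgnZ (a :: l) ^ 2 * sg a l.toFinset := by
  rw [sgnZ]
  split_ifs
  · simp
  · linear_combination (-(sg a l.toFinset * sgnZ l ^ 2)) * sg_mul_self a l.toFinset

lemma toFinset_eq_univ {l : List (Fin 5)} (hl : l.length = 5) (h : sgnZ l ≠ 0) :
    l.toFinset = Finset.univ := by
  rw [← Finset.card_eq_iff_eq_univ, List.toFinset_card_of_nodup (nodup_of_sgnZ h), hl,
    Fintype.card_fin]

/-- The contraction of the Levi-Civita symbol with four one-forms, term by term. -/
lemma sgnZ_smul_listForm_four (a c d r s : Fin 5) :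
    sgnZ [a, c, d, r, s] • listForm [c, d, r, s] =
      (sgnZ [a, c, d, r, s] ^ 2 * sg a {a}ᶜ) • basisForm {a}ᶜ := by
  by_cases h : sgnZ [a, c, d, r, s] = 0
  · simp [h]
  · have h1 := toFinset_eq_univ rfl h
    have h2 := (List.nodup_cons.1 (nodup_of_sgnZ h)).1
    have h3 : [c, d, r, s].toFinset = {a}ᶜ := by
      rw [List.toFinset_cons] at h1
      rw [← Finset.erase_insert (s := [c, d, r, s].toFinset) (a := a) (by simpa using h2), h1,
        ← Finset.compl_singleton]
    rw [listForm, smul_smul, sgnZ_cons_mul, h3]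

/-- The contraction of the Levi-Civita symbol with three one-forms, term by term. -/
lemma sgnZ_smul_listForm_three (a b r s t : Fin 5) :
    sgnZ [a, b, r, s, t] • listForm [r, s, t] =
      (sgnZ [a, b, r, s, t] ^ 2 * (sg a {a}ᶜ * sg b {a, b}ᶜ)) • basisForm {a, b}ᶜ := by
  by_cases h : sgnZ [a, b, r, s, t] = 0
  · simp [h]
  · have h1 := toFinset_eq_univ rfl h
    have h2 := nodup_of_sgnZ h
    have h3 : [b, r, s, t].toFinset = {a}ᶜ := by
      rw [List.toFinset_cons] at h1
      rw [← Finset.erase_insert (s := [b, r, s, t].toFinset) (a := a)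
        (by simpa using (List.nodup_cons.1 h2).1), h1, ← Finset.compl_singleton]
    have h4 : [r, s, t].toFinset = {a, b}ᶜ := by
      have h5 := (List.nodup_cons.1 (List.nodup_cons.1 h2).2).1
      rw [List.toFinset_cons] at h3
      rw [← Finset.erase_insert (s := [r, s, t].toFinset) (a := b) (by simpa using h5), h3,
        Finset.insert_eq, Finset.compl_union, Finset.erase_eq, Finset.sdiff_eq_inter_compl]
    have e1 : sgnZ [a, b, r, s, t] * sgnZ [r, s, t] =
        sgnZ [a, b, r, s, t] ^ 2 * (sg a {a}ᶜ * sg b {a, b}ᶜ) := by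
      have h6 : a ∉ [b, r, s, t] := (List.nodup_cons.1 h2).1
      have h7 : b ∉ [r, s, t] := (List.nodup_cons.1 (List.nodup_cons.1 h2).2).1
      have k1 : sgnZ [a, b, r, s, t] = sg a {a}ᶜ * (sg b {a, b}ᶜ * sgnZ [r, s, t]) := by
        rw [sgnZ, if_neg h6, sgnZ, if_neg h7, h3, h4]
      rw [k1]
      have k2 := sg_mul_self a {a}ᶜ
      have k3 := sg_mul_self b {a, b}ᶜ
      linear_combination (-(sg a {a}ᶜ * sg b {a, b}ᶜ * sgnZ [r, s, t] ^ 2) *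
        (sg b {a, b}ᶜ * sg b {a, b}ᶜ)) * k2 - sg a {a}ᶜ * sg b {a, b}ᶜ * sgnZ [r, s, t] ^ 2 * k3
    rw [listForm, smul_smul, e1, h4]

/-- The permutations of four indices are counted by the square of the Levi-Civita symbol. -/
lemma sum_sgnZ_four : ∀ a : Fin 5, ∑ c, ∑ d, ∑ r, ∑ s, sgnZ [a, c, d, r, s] ^ 2 = 24 := by
  decide +kernel

lemma sum_sgnZ_three : ∀ a b : Fin 5, a ≠ b → ∑ r, ∑ s, ∑ t, sgnZ [a, b, r, s, t] ^ 2 = 6 := by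
  decide +kernel

lemma eta_eq (a b : Fin 5) : eta a b = if a = b then ((etaZ a : ℤ) : ℂ) else 0 := by
  rw [eta, etaZ]
  split_ifs <;> simp

/-- The sign in `*(e^a)`, computed in the basis and by the rule. -/
lemma starSign_singleton : ∀ a : Fin 5, starSign {a} = etaZ a * sg a {a}ᶜ := by decide +kernel

/-- The sign in `*(e^a ∧ e^b)`, computed in the basis and by the rule. -/
lemma starSign_pair : ∀ a b : Fin 5, a ≠ b →
    sg a {b} * starSign {a, b} = etaZ a * etaZ b * (sg a {a}ᶜ * sg b {a, b}ᶜ) := by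
  decide +kernel

lemma hodge_zsmul (n : ℤ) (ω : Form) : hodge (n • ω) = n • hodge ω := by
  rw [← Int.cast_smul_eq_zsmul ℂ, hodge_smul, Int.cast_smul_eq_zsmul]

lemma hodgeRules_hodge (κ : ℝ) : HodgeRules κ hodge where
  rule_zero := by
    have h : zeroForm 1 = basisForm ∅ := rfl
    have h1 : starSign ∅ = 1 := by decide
    rw [h, hodge_basisForm, h1, one_smul, Finset.compl_empty, vol5_eq]
  rule_one a := by
    have h : ∀ c d r s : Fin 5, wedge κ (e c) (wedge κ (e d) (wedge κ (e r) (e s))) =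
        listForm [c, d, r, s] := fun c d r s => by
      rw [e_eq_listForm s, wedge_e_listForm, wedge_e_listForm, wedge_e_listForm]
    -- all nonzero terms are equal, so that the sum only counts permutations
    have hz : ∀ b c d r s : Fin 5, (eta a b * eps ![b, c, d, r, s]) • listForm [c, d, r, s] =
        if a = b then ((etaZ a * (sgnZ [a, c, d, r, s] ^ 2 * sg a {a}ᶜ) : ℤ) : ℂ) •
          basisForm {a}ᶜ else 0 := fun b c d r s => by
      rw [eta_eq]
      split_ifs with hab
      · subst hab
        rw [eps_apply, mul_smul, Int.cast_smul_eq_zsmul, Int.cast_smul_eq_zsmul,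
          Int.cast_smul_eq_zsmul, sgnZ_smul_listForm_four, smul_smul]
      · simp
    simp only [h, hz, Finset.sum_ite_irrel, Finset.sum_const_zero, Finset.sum_ite_eq,
      Finset.mem_univ, if_true, ← Finset.sum_smul, ← Int.cast_sum, ← Finset.mul_sum,
      ← Finset.sum_mul, sum_sgnZ_four]
    rw [e, hodge_basisForm, starSign_singleton, ← Int.cast_smul_eq_zsmul ℂ, smul_smul]
    congr 1
    push_cast [Nat.factorial]
    ring
  rule_two a b := by
    have h : ∀ r s t : Fin 5, wedge κ (e r) (wedge κ (e s) (e t)) = listForm [r, s, t] :=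
      fun r s t => by rw [e_eq_listForm t, wedge_e_listForm, wedge_e_listForm]
    have hz : ∀ c d r s t : Fin 5, (eta a c * eta b d * eps ![c, d, r, s, t]) •
        listForm [r, s, t] = if a = c then if b = d then ((etaZ a * etaZ b *
          (sgnZ [a, b, r, s, t] ^ 2 * (sg a {a}ᶜ * sg b {a, b}ᶜ)) : ℤ) : ℂ) •
          basisForm {a, b}ᶜ else 0 else 0 := fun c d r s t => by
      rw [eta_eq, eta_eq]
      split_ifs with hac hbd
      · subst hac hbd
        rw [eps_apply, mul_smul, ← Int.cast_mul, Int.cast_smul_eq_zsmul, Int.cast_smul_eq_zsmul,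
          Int.cast_smul_eq_zsmul, sgnZ_smul_listForm_three, smul_smul]
      all_goals simp
    rw [e_eq_listForm b, wedge_e_listForm]
    simp only [h, hz, Finset.sum_ite_irrel, Finset.sum_const_zero, Finset.sum_ite_eq,
      Finset.mem_univ, if_true, ← Finset.sum_smul, ← Int.cast_sum, ← Finset.mul_sum,
      ← Finset.sum_mul]
    rw [listForm, hodge_zsmul, hodge_basisForm]
    by_cases hab : a = b
    · subst hab
      have h1 : sgnZ [a, a] = 0 := by simp [sgnZ]
      have h2 : ∀ r s t, sgnZ [a, a, r, s, t] = 0 := by simp [sgnZ]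
      simp [h1, h2]
    · have h1 : sgnZ [a, b] = sg a {b} := by simp [sgnZ, hab, sg]
      have h2 : [a, b].toFinset = {a, b} := by simp
      rw [sum_sgnZ_three a b hab, h1, h2, smul_smul, starSign_pair a b hab,
        ← Int.cast_smul_eq_zsmul ℂ, smul_smul]
      congr 1
      push_cast [Nat.factorial]
      ring

end Rules

/-! ### Existence and uniqueness of the Hodge star -/

section HodgeStar

open MeasureTheory

lemma neg_one_pow_mul_sub {n : ℕ} (hn : n ≤ 5) : (-1 : ℂ) ^ (n * (5 - n)) = 1 := by
  interval_cases n <;> norm_num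

lemma exists_bandForm {n : ℕ} {ω : Form} (hω : ω ∈ Gam schwartzC n) : ∃ F, ω = bandForm F := by
  choose F hF using fun I => mem_schwartzC.1 (hω.1 I)
  exact ⟨F, funext hF⟩

lemma bandForm_single_mem {F : bandS} {n : ℕ} {I : Finset (Fin 5)} (hI : I.card = n) :
    bandForm (Pi.single I F) ∈ Gam schwartzC n := by
  refine ⟨fun J => mem_schwartzC.2 ⟨_, rfl⟩, fun J hJ => ?_⟩
  have : J ≠ I := fun h => hJ (h ▸ hI)
  rw [bandForm, Pi.single_eq_of_ne this, bandFn_zero]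

lemma bandForm_smul_add (c : ℂ) (F G : Finset (Fin 5) → bandS) :
    c • bandForm F + bandForm G = bandForm (c • F + G) := by
  funext I
  simp only [bandForm, Pi.add_apply, Pi.smul_apply, bandFn_add, bandFn_smul]

lemma dagSign_mul_topSign_real (I : Finset (Fin 5)) :
    (starRingEnd ℂ) (2 * Real.pi * (dagSign I * topSign I)) =
      2 * Real.pi * (dagSign I * topSign I) := by
  have h : (starRingEnd ℂ) 2 = 2 := Complex.conj_ofNat 2
  simp [dagSign, h]

lemma dagSign_mul_topSign_ne_zero (I : Finset (Fin 5)) :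
    2 * Real.pi * (dagSign I * topSign I) ≠ 0 := by
  have h1 : dagSign I ≠ 0 := pow_ne_zero _ (by norm_num)
  have h2 : (topSign I : ℂ) ≠ 0 := by
    exact_mod_cast left_ne_zero_of_mul_eq_one (topSign_mul_self I)
  have h3 : (Real.pi : ℂ) ≠ 0 := by exact_mod_cast Real.pi_ne_zero
  exact mul_ne_zero (mul_ne_zero two_ne_zero h3) (mul_ne_zero h1 h2)

lemma isHodgeStar_hodge (κ : ℝ) : IsHodgeStar κ hodge where
  degree n hn ω hω := hodge_mem_Gam (fun n _ hf => zsmul_mem_algA n hf) hn hω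
  degree_schwartz n hn ω hω := hodge_mem_Gam (fun n _ hf => zsmul_mem_schwartzC n hf) hn hω
  involutive n hn ω _ := by rw [hodge_hodge, neg_one_pow_mul_sub hn, one_smul]
  map_add ω _ ρ _ := hodge_add ω ρ
  map_lmul f hf ω hω := hodge_lmul κ hf hω
  map_rmul f hf ω hω := hodge_rmul κ hf hω
  integrable n hn ω hω ρ hρ := by
    obtain ⟨F, rfl⟩ := exists_bandForm hω
    obtain ⟨G, rfl⟩ := exists_bandForm hρ
    exact (pairing_bandForm κ F G).1
  sesq_left n hn c ω hω ω' hω' ρ hρ := by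
    obtain ⟨F, rfl⟩ := exists_bandForm hω
    obtain ⟨F', rfl⟩ := exists_bandForm hω'
    obtain ⟨G, rfl⟩ := exists_bandForm hρ
    rw [bandForm_smul_add, (pairing_bandForm κ _ G).2, (pairing_bandForm κ F G).2,
      (pairing_bandForm κ F' G).2, Finset.mul_sum, ← Finset.sum_add_distrib]
    refine Finset.sum_congr rfl fun I _ => ?_
    rw [Pi.add_apply, Pi.smul_apply, herm_add_smul_left]
    ring
  sesq_right n hn c ω hω ρ hρ ρ' hρ' := by
    obtain ⟨F, rfl⟩ := exists_bandForm hω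
    obtain ⟨G, rfl⟩ := exists_bandForm hρ
    obtain ⟨G', rfl⟩ := exists_bandForm hρ'
    rw [bandForm_smul_add, (pairing_bandForm κ F _).2, (pairing_bandForm κ F G).2,
      (pairing_bandForm κ F G').2, Finset.mul_sum, ← Finset.sum_add_distrib]
    refine Finset.sum_congr rfl fun I _ => ?_
    rw [Pi.add_apply, Pi.smul_apply, herm_add_smul_right]
    ring
  hermitian n hn ω hω ρ hρ := by
    obtain ⟨F, rfl⟩ := exists_bandForm hω
    obtain ⟨G, rfl⟩ := exists_bandForm hρ
    rw [(pairing_bandForm κ F G).2, (pairing_bandForm κ G F).2, map_sum]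
    refine Finset.sum_congr rfl fun I _ => ?_
    rw [map_mul, conj_herm, dagSign_mul_topSign_real]
  nondegenerate n hn ω hω := by
    obtain ⟨F, rfl⟩ := exists_bandForm hω
    constructor
    · intro h
      funext I
      by_cases hI : I.card = n
      · have h1 := h _ (bandForm_single_mem (F := F I) hI)
        rw [(pairing_bandForm κ F _).2, Finset.sum_eq_single I
          (fun J _ hJ => by rw [Pi.single_eq_of_ne hJ, herm_zero_right, mul_zero]) (by simp),
          Pi.single_eq_same] at h1
        have h2 := herm_self_eq_zero
          ((mul_eq_zero.1 h1).resolve_left (dagSign_mul_topSign_ne_zero I))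
        rw [bandForm, h2, bandFn_zero, Pi.zero_apply]
      · exact hω.2 I hI
    · intro h ρ hρ
      obtain ⟨G, rfl⟩ := exists_bandForm hρ
      have h0 : bandForm F = bandForm 0 := by
        rw [h]; funext I; rw [bandForm, Pi.zero_apply, Pi.zero_apply, bandFn_zero]
      rw [h0, (pairing_bandForm κ 0 G).2]
      exact Finset.sum_eq_zero fun I _ => by rw [Pi.zero_apply, herm_zero_left, mul_zero]

lemma basisForm_mem_Gam (I : Finset (Fin 5)) : basisForm I ∈ Gam algA I.card := by
  refine ⟨fun J => ?_, fun J hJ => ?_⟩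
  · rw [basisForm_eq]; exact mem_algA.2 ⟨_, rfl⟩
  · rw [basisForm, Pi.single_eq_of_ne]
    rintro rfl; exact hJ rfl

lemma lmul_const (κ : ℝ) (c : ℂ) {ω : Form} (hω : ω ∈ GamTotal) :
    lmul κ (evalRep (constRep c)) ω = c • ω := by
  obtain ⟨x, rfl⟩ := mem_GamTotal.1 hω
  have h : constRep c = c • constRep 1 := by
    refine Prod.ext ?_ (smul_zero c).symm
    simp [constRep, MvPolynomial.smul_eq_C_mul]
  funext I
  rw [lmul_toForm, h, map_smul, LinearMap.smul_apply, starL_one_left]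
  rfl

lemma evalRep_mem_algA (x : Rep) : evalRep x ∈ algA := mem_algA.2 ⟨x, rfl⟩

lemma toForm_mem_GamTotal (x : RForm) : toForm x ∈ GamTotal := mem_GamTotal.2 ⟨x, rfl⟩

/-- Agreement with `hodge` on basis forms. In degrees above two, `e^I` is up to a sign the image of
`e^{Iᶜ}`, and its own image is determined by `* ∘ * = 1`. -/
lemma IsHodgeStar.basisForm_eq {κ : ℝ} {S : Form → Form} (hS : HodgeRules κ S)
    (hS' : IsHodgeStar κ S) (I : Finset (Fin 5)) : S (basisForm I) = hodge (basisForm I) := by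
  have hR := hodgeRules_hodge κ
  have low : ∀ I : Finset (Fin 5), I.card ≤ 2 → S (basisForm I) = hodge (basisForm I) := by
    intro I hI
    obtain h0 | h1 | h2 : I.card = 0 ∨ I.card = 1 ∨ I.card = 2 := by omega
    · rw [Finset.card_eq_zero.1 h0]
      exact hS.rule_zero.trans hR.rule_zero.symm
    · obtain ⟨a, rfl⟩ := Finset.card_eq_one.1 h1
      exact (hS.rule_one a).trans (hR.rule_one a).symm
    · have key : ∀ a b : Fin 5, a < b → S (basisForm {a, b}) = hodge (basisForm {a, b}) := by
        intro a b hab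
        have h : wedge κ (e a) (e b) = basisForm {a, b} := by
          rw [e_eq_listForm b, wedge_e_listForm, listForm]
          have hs : sgnZ [a, b] = 1 := by simp [sgnZ, hab.ne, sg_insert_min_self (a := a) (I := {b}) (by simpa using hab),
              sg_insert_min_self (a := b) (I := ∅) (by simp)]
          rw [hs, one_smul]
          simp
        rw [← h]
        exact (hS.rule_two a b).trans (hR.rule_two a b).symm
      obtain ⟨a, b, hab, rfl⟩ := Finset.card_eq_two.1 h2
      rcases lt_or_gt_of_ne hab with h | h
      · exact key a b h
      · rw [Finset.pair_comm]; exact key b a h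
  by_cases hI : I.card ≤ 2
  · exact low I hI
  · have hle : I.card ≤ 5 := by simpa using Finset.card_le_univ I
    have hc : Iᶜ.card ≤ 2 := by rw [Finset.card_compl, Fintype.card_fin]; omega
    have h1 := hS'.involutive _ (hc.trans (by norm_num)) _ (basisForm_mem_Gam Iᶜ)
    have hT := Gam_algA_subset _ (basisForm_mem_Gam I)
    have hT' := Gam_algA_subset _ (hS'.degree _ hle _ (basisForm_mem_Gam I))
    rw [neg_one_pow_mul_sub (hc.trans (by norm_num)), one_smul, low _ hc, hodge_basisForm,
      compl_compl, ← Int.cast_smul_eq_zsmul ℂ, ← lmul_const κ _ hT,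
      hS'.map_lmul _ (evalRep_mem_algA _) _ hT, lmul_const κ _ hT'] at h1
    rw [hodge_basisForm, ← h1, Int.cast_smul_eq_zsmul, smul_smul, starSign_mul_compl, one_smul]

/-- Uniqueness, by left linearity. -/
lemma IsHodgeStar.eq_hodge {κ : ℝ} {S : Form → Form} (hS : HodgeRules κ S)
    (hS' : IsHodgeStar κ S) {ω : Form} (hω : ω ∈ GamTotal) : S ω = hodge ω := by
  obtain ⟨x, rfl⟩ := mem_GamTotal.1 hω
  have hsingle : ∀ I y, S (toForm (Pi.single I y)) = hodge (toForm (Pi.single I y)) := by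
    intro I y
    have h : toForm (Pi.single I y) = lmul κ (evalRep y) (basisForm I) := by
      funext J
      rw [KappaMinkowski.basisForm_eq, lmul_toForm, toForm_apply]
      by_cases hJ : J = I
      · subst hJ; rw [Pi.single_eq_same, Pi.single_eq_same, starL_one_right]
      · rw [Pi.single_eq_of_ne hJ, Pi.single_eq_of_ne hJ, map_zero, map_zero]
    have hT := Gam_algA_subset _ (basisForm_mem_Gam I)
    rw [h, hS'.map_lmul _ (evalRep_mem_algA y) _ hT, hS'.basisForm_eq hS,
      hodge_lmul κ (evalRep_mem_algA y) hT]
  have hsum : ∀ s : Finset (Finset (Fin 5)),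
      S (toForm (∑ I ∈ s, Pi.single I (x I))) = hodge (toForm (∑ I ∈ s, Pi.single I (x I))) := by
    intro s
    induction s using Finset.induction_on with
    | empty =>
      -- `0` is also a form with a single coefficient, so `hsingle` covers it
      have h1 := hsingle ∅ 0
      rwa [Pi.single_zero] at h1
    | insert I s hI ih =>
      rw [Finset.sum_insert hI, LinearMap.map_add, hS'.map_add _ (toForm_mem_GamTotal _) _
        (toForm_mem_GamTotal _), hsingle, ih, hodge_add]
  have h := hsum Finset.univ
  rwa [← sum_single_smul] at h

/-- `∫ f† ⋆ f = 0` only for `f = 0`. -/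
lemma integral_dagFn_starProd_eq_zero (κ : ℝ) {f : Fn} (hf : f ∈ schwartzC) :
    (∫ p : Pt, starProd κ (dagFn κ f) f p) = 0 ↔ f = 0 := by
  have key : ∀ F : bandS, ∫ p : Pt, starProd κ (dagFn κ (bandFn F)) (bandFn F) p =
      2 * Real.pi * herm κ F F := fun F => by
    rw [dagFn_bandFn, (integral_starProd κ _ F).2, herm]
  constructor
  · obtain ⟨F, rfl⟩ := mem_schwartzC.1 hf
    intro h
    rw [key] at h
    have h3 : (Real.pi : ℂ) ≠ 0 := by exact_mod_cast Real.pi_ne_zero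
    rw [herm_self_eq_zero ((mul_eq_zero.1 h).resolve_left (mul_ne_zero two_ne_zero h3)),
      bandFn_zero]
  · rintro rfl
    rw [← bandFn_zero, key, herm_zero_left, mul_zero]

/-! ### The commutation relations -/

lemma opE_coordRep (s : ℝ) (μ : Fin 4) :
    opE s • coordRep μ = coordRep μ + if μ = 0 then constRep (Complex.I * s) else 0 := by
  rw [opE_smul, expR_apply]
  by_cases hμ : μ = 0
  · exact Prod.ext (by simp [coordRep, constRep, shiftP, hμ])
      (by simp [coordRep, constRep, hμ])
  · exact Prod.ext (by simp [coordRep, shiftP, hμ]) (by simp [coordRep, hμ])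

lemma opP_coordRep (j : Fin 3) (μ : Fin 4) :
    opP j • coordRep μ = if μ = j.succ then constRep (-Complex.I) else 0 := by
  rw [opP_smul, momR_apply]
  by_cases hμ : μ = j.succ
  · subst hμ
    exact Prod.ext (by simp [coordRep, constRep, MvPolynomial.smul_eq_C_mul])
      (by simp [coordRep, constRep])
  · exact Prod.ext (by simp [coordRep, MvPolynomial.pderiv_X, hμ])
      (by simp [coordRep, hμ])

lemma smul_constRep (c d : ℂ) : c • constRep d = constRep (c * d) :=
  Prod.ext (by simp [constRep, MvPolynomial.smul_eq_C_mul]) (by simp [constRep])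

lemma constRep_neg (c : ℂ) : constRep (-c) = -constRep c := by
  rw [← neg_one_mul, ← smul_constRep, neg_one_smul]

/-- The action of `λ` on the coordinates. -/
lemma lamR_coordRep (κ : ℝ) (μ : Fin 4) (ν b : Fin 5) :
    lamR κ ν b • coordRep μ = (Pi.single ν (coordRep μ) : Fin 5 → Rep) b -
      (Complex.I / κ * (eta μ.castSucc ν * (Pi.single 0 1 : Fin 5 → ℂ) b
        - eta 0 ν * (Pi.single μ.castSucc 1 : Fin 5 → ℂ) b
        - eta μ.castSucc ν * (Pi.single 4 1 : Fin 5 → ℂ) b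
        + (if ν = 4 then 1 else 0) * (Pi.single μ.castSucc 1 : Fin 5 → ℂ) b)) • constRep 1 := by
  rw [lamR, lorentz_smul (u := if μ = 0 then constRep (Complex.I / κ) else 0)
    (w := fun j => if μ = j.succ then constRep (-(Complex.I / κ)) else 0) half_mul_two]
  · fin_cases μ <;> fin_cases ν <;> fin_cases b <;>
      simp [eta, smul_constRep, constRep_neg]
  · rw [opE_coordRep]
    congr 3
    push_cast; ring
  · rw [opE_coordRep]
    split_ifs
    · rw [sub_eq_add_neg, ← constRep_neg]
      congr 2
      push_cast; ring
    · rw [sub_zero, add_zero]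
  · intro j
    rw [mul_smul, opP_coordRep]
    split_ifs
    · rw [algebraMap_opRing_smul, smul_constRep]
      congr 1; ring
    · rw [smul_zero]
  · intro j
    split_ifs
    · rw [opE_constRep]
    · rw [smul_zero]
  · intro j
    split_ifs
    · rw [mul_smul, opP_constRep, smul_zero]
    · rw [smul_zero]

lemma minor_singleton {R : Type*} [CommRing R] (m : Fin 5 → Fin 5 → R) (a b : Fin 5) :
    minor m {a} {b} = m a b := by
  have h := minor_insert_min m (a := a) (I := ∅) (by simp)
  rw [insert_empty_eq] at h
  rw [h, minor_empty, ext, Finset.sum_singleton, Finset.erase_singleton]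
  simp [sg]

lemma e_apply_singleton (a b : Fin 5) : e a {b} = (Pi.single a 1 : Fin 5 → ℂ) b • (1 : Fn) := by
  by_cases h : b = a
  · subst h; simp [e, basisForm]
  · simp [e, basisForm, h]

lemma e_apply_of_card (a : Fin 5) {K : Finset (Fin 5)} (hK : K.card ≠ 1) : e a K = 0 := by
  rw [e, basisForm, Pi.single_eq_of_ne]
  rintro rfl; exact hK (Finset.card_singleton a)

/-- `[x^μ, e^ν]`, for all five one-forms at once. -/
lemma commutator_coord_e (κ : ℝ) (μ : Fin 4) (ν : Fin 5) :
    lmul κ (coord μ) (e ν) - rmul κ (e ν) (coord μ) = (Complex.I / (κ : ℂ)) •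
      (eta μ.castSucc ν • e 0 - eta 0 ν • e μ.castSucc - eta μ.castSucc ν • e 4
        + (if ν = 4 then (1 : ℂ) else 0) • e μ.castSucc) := by
  funext K
  have hl : ∀ K, lmul κ (coord μ) (e ν) K =
      evalRep ((Pi.single {ν} (coordRep μ) : RForm) K) := by
    intro K
    rw [← evalRep_coordRep, e, basisForm_eq, lmul_toForm]
    by_cases hK : K = {ν}
    · subst hK; rw [Pi.single_eq_same, Pi.single_eq_same, starL_one_right]
    · rw [Pi.single_eq_of_ne hK, Pi.single_eq_of_ne hK, map_zero, map_zero]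
  have hr : ∀ K, rmul κ (e ν) (coord μ) K = evalRep (minor (lamR κ) {ν} K • coordRep μ) := by
    intro K
    rw [← evalRep_coordRep, e, rmul_basisForm, toForm_apply]
  rw [Pi.sub_apply, hl, hr]
  simp only [Pi.smul_apply, Pi.add_apply, Pi.sub_apply]
  by_cases hK : K.card = 1
  · obtain ⟨b, rfl⟩ := Finset.card_eq_one.1 hK
    have h1 : (Pi.single {ν} (coordRep μ) : RForm) {b} =
        (Pi.single ν (coordRep μ) : Fin 5 → Rep) b := by
      by_cases h : b = ν
      · subst h; simp
      · simp [h]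
    rw [h1, minor_singleton, lamR_coordRep, ← map_sub, sub_sub_cancel, map_smul, evalRep_one]
    simp only [e_apply_singleton]
    module
  · have h1 : K ≠ {ν} := fun h => hK (h ▸ Finset.card_singleton ν)
    rw [minor_eq_zero _ (by simpa using Ne.symm hK), Pi.single_eq_of_ne h1]
    simp only [e_apply_of_card _ hK, zero_smul, smul_zero, sub_zero, add_zero, map_zero]

/-- The Hodge star intertwines the commutators with the coordinates. -/
lemma commutator_coord_hodge (κ : ℝ) (μ : Fin 4) (ν : Fin 5) :
    lmul κ (coord μ) (hodge (e ν)) - rmul κ (hodge (e ν)) (coord μ) =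
      hodge (lmul κ (coord μ) (e ν) - rmul κ (e ν) (coord μ)) := by
  have hf : coord μ ∈ algA := mem_algA.2 ⟨_, (evalRep_coordRep μ).symm⟩
  have hω : e ν ∈ GamTotal := Gam_algA_subset _ (basisForm_mem_Gam {ν})
  rw [← hodge_lmul κ hf hω, ← hodge_rmul κ hf hω, sub_eq_add_neg, sub_eq_add_neg, hodge_add,
    ← neg_one_smul ℂ (rmul κ (e ν) (coord μ)), hodge_smul, neg_one_smul]

/-- The commutator comes from the dilation in the star product with `x⁰`. -/
lemma commutator_coord_coord_zero (κ : ℝ) (j : Fin 3) :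
    starProd κ (coord j.succ) (coord 0) - starProd κ (coord 0) (coord j.succ) =
      (Complex.I / (κ : ℂ)) • coord j.succ := by
  have h : evalRep (dilR κ (coordRep j.succ)) = (κ : ℂ)⁻¹ • coord j.succ := by
    funext p
    rw [evalRep_dilR, Pi.smul_apply, smul_eq_mul, coord_succ, Finset.sum_eq_single j]
    · simp [gradR_apply, coordRep, evalRep_apply, bandFn_zero]
    · intro i _ hi
      simp [gradR_apply, coordRep, evalRep_apply, bandFn_zero, MvPolynomial.pderiv_X, Ne.symm hi]
    · simp
  have h1 := starProd_coord_succ κ j (coordRep 0)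
  have h2 := starProd_coord_zero κ (coordRep j.succ)
  rw [evalRep_coordRep] at h1 h2
  rw [h1, h2, h, mul_comm, sub_sub_cancel, smul_smul, div_eq_mul_inv]

lemma starProd_coord_succ_comm (κ : ℝ) (j k : Fin 3) :
    starProd κ (coord j.succ) (coord k.succ) = starProd κ (coord k.succ) (coord j.succ) := by
  have h := fun j k : Fin 3 => starProd_coord_succ κ j (coordRep k.succ)
  simp only [evalRep_coordRep] at h
  rw [h, h, mul_comm]

lemma dagFn_coord (κ : ℝ) (μ : Fin 4) : dagFn κ (coord μ) = coord μ := by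
  funext p
  refine Fin.cases ?_ (fun j => ?_) μ
  · have hd := expSmooth_exp 0
    have h := (((HasOsc.pow_mul hd 0).const_mul (p.1 : ℂ)).add (HasOsc.pow_mul hd 1)).osc_eq
    simp only [pow_zero, pow_one, zero_mul, Real.exp_zero, Complex.ofReal_zero,
      Complex.ofReal_one, mul_zero, mul_one, add_zero] at h
    refine Eq.trans ?_ h
    simp only [dagFn, coord_zero, Complex.conj_ofReal]
    simp only [Complex.ofReal_add]
  · have h := ((HasOsc.pow_mul (expSmooth_exp κ⁻¹) 0).const_mul (p.2 j : ℂ)).osc_eq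
    simp only [pow_zero, one_mul, mul_zero, Real.exp_zero, Complex.ofReal_one, mul_one] at h
    refine Eq.trans ?_ h
    simp only [dagFn, coord_succ, Pi.smul_apply, smul_eq_mul, Complex.conj_ofReal, div_eq_inv_mul]
    simp only [Complex.ofReal_mul, mul_comm]

end HodgeStar

end KappaMinkowski

end

open KappaMinkowski in
theorem mainTheorem2 (κ : ℝ) (hκ : κ ≠ 0) :
    -- the star-product realisation satisfies the defining relations of the algebra and the calculus
    ((∀ j : Fin 3, starProd κ (coord j.succ) (coord 0) - starProd κ (coord 0) (coord j.succ) =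
          (Complex.I / (κ : ℂ)) • coord j.succ) ∧
      (∀ j k : Fin 3, starProd κ (coord j.succ) (coord k.succ) =
          starProd κ (coord k.succ) (coord j.succ)) ∧
      (∀ μ : Fin 4, dagFn κ (coord μ) = coord μ) ∧
      (∀ μ ν : Fin 4, lmul κ (coord μ) (e ν.castSucc) - rmul κ (e ν.castSucc) (coord μ) =
          (Complex.I / (κ : ℂ)) •
            (eta μ.castSucc ν.castSucc • e 0 - eta 0 ν.castSucc • e μ.castSucc
              - eta μ.castSucc ν.castSucc • e 4)) ∧
      (∀ μ : Fin 4, lmul κ (coord μ) (e 4) - rmul κ (e 4) (coord μ) =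
          (Complex.I / (κ : ℂ)) • e μ.castSucc)) ∧
    -- the rules define a Hodge star, compatible with the bimodule relations, and only one
    (∃ S : Form → Form, HodgeRules κ S ∧ IsHodgeStar κ S ∧
      (∀ μ ν : Fin 4,
        lmul κ (coord μ) (S (e ν.castSucc)) - rmul κ (S (e ν.castSucc)) (coord μ) =
          (Complex.I / (κ : ℂ)) •
            (eta μ.castSucc ν.castSucc • S (e 0) - eta 0 ν.castSucc • S (e μ.castSucc)
              - eta μ.castSucc ν.castSucc • S (e 4))) ∧
      (∀ μ : Fin 4, lmul κ (coord μ) (S (e 4)) - rmul κ (S (e 4)) (coord μ) =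
          (Complex.I / (κ : ℂ)) • S (e μ.castSucc)) ∧
      (∀ S' : Form → Form, HodgeRules κ S' → IsHodgeStar κ S' →
        ∀ ω ∈ GamTotal, S' ω = S ω)) ∧
    -- the norm of functions is nondegenerate
    (∀ f ∈ schwartzC, (∫ p : Pt, starProd κ (dagFn κ f) f p) = 0 ↔ f = 0) := by
  have hlt : ∀ μ : Fin 4, μ.castSucc ≠ 4 := fun μ => (Fin.castSucc_lt_last μ).ne
  have hc : ∀ μ ν : Fin 4,
      (if ν.castSucc = 4 then (1 : ℂ) else 0) • e μ.castSucc = 0 := fun μ ν => by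
    rw [if_neg (hlt ν), zero_smul]
  have h4 : ∀ μ : Fin 4, eta μ.castSucc 4 = 0 := fun μ => by
    rw [eta, if_neg (hlt μ)]
  have h04 : eta 0 4 = 0 := h4 0
  have hsub : ∀ ω ρ : Form, hodge (ω - ρ) = hodge ω - hodge ρ := fun ω ρ => by
    rw [sub_eq_add_neg, sub_eq_add_neg, hodge_add, ← neg_one_smul ℂ ρ, hodge_smul, neg_one_smul]
  have hν : ∀ μ ν : Fin 4, _ := fun μ ν => commutator_coord_e κ μ ν.castSucc
  have he4 : ∀ μ : Fin 4, _ := fun μ => commutator_coord_e κ μ 4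
  simp only [hc, add_zero] at hν
  simp only [h4, h04, zero_smul, sub_zero, zero_add, if_true, one_smul] at he4
  refine ⟨⟨commutator_coord_coord_zero κ, starProd_coord_succ_comm κ, dagFn_coord κ, hν, he4⟩,
    ⟨hodge, hodgeRules_hodge κ, isHodgeStar_hodge κ, fun μ ν => ?_, fun μ => ?_,
      fun S hS hS' ω hω => hS'.eq_hodge hS hω⟩,
    fun f hf => integral_dagFn_starProd_eq_zero κ hf⟩
  · rw [commutator_coord_hodge, hν]
    simp only [hodge_smul, hsub]
  · rw [commutator_coord_hodge, he4, hodge_smul]
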